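/- **Setting.** $(Y_i,X_i,Z_i,W_i)_{i\ge1}$ are i.i.d. random vectors in $\mathbb R\times\mathbb R^{d_x}\times\mathbb R^{d_z}\times\mathbb R^{d_w}$; $(Y,X,Z,W)$ denotes a generic copy. $F(\cdot|x,z)=F_{W|XZ}(\cdot|x,z)$ is (a version of) the conditional distribution function of $W$ given $(X,Z)=(x,z)$, $V=F(\cdot|X,Z)$ is the function-valued control variable, and $\|\cdot\|$ is the $L^2(\nu)$ norm for a finite measure $\nu$ dominating the conditional law of $W$ given $(X,Z)$. $\mathcal A\subset\mathbb R^{d_x}\times\mathbb R^{d_z}$ is a compact trimming set with $P((X,Z)\in\mathcal A)>0$, $T_i=1\{(X_i,Z_i)\in\mathcal A\}$ and $T=1\{(X,Z)\in\mathcal A\}$, $\bar{\mathcal V}=\{F(\cdot|x,z):(x,z)\in\mathcal A\}$, and $\mathcal D\supseteq\mathcal A$ is a set with $P((X,Z)\in\mathcal D)=1$ (one can take $\mathcal D=\mathcal A$ if $(X,Z)\in\mathcal A$ a.s.). $\hat F_n(\cdot|x,z)\in L^2(\nu)$ is a first-stage estimator, $\hat V_i=\hat F_n(\cdot|X_i,Z_i)$,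 $b_n>0$ is a bandwidth, $K_X$ and $K_V$ are kernels on $\mathbb R^{d_x}$ and $\mathbb R$, $x_0\in\mathbb R^{d_x}$ is fixed, and $$\hat m_n(x_0,v)=\frac{\sum_{j=1}^nY_jK_X\big(\tfrac{X_j-x_0}{b_n}\big)K_V\big(\tfrac{\|\hat V_j-v\|}{b_n}\big)}{\sum_{j=1}^nK_X\big(\tfrac{X_j-x_0}{b_n}\big)K_V\big(\tfrac{\|\hat V_j-v\|}{b_n}\big)},\qquad \hat\mu_n(x_0)=\frac{\sum_{i=1}^n\hat m_n(x_0,\hat V_i)T_i}{\sum_{i=1}^nT_i}$$ (with $0/0=0$). **Assumption Nonparametric.** 1. $X$ and at least one element of $Z$ have a joint Lebesgue density. 2. For some $s>2$, $E[|Y|^s\,|\,X,Z]\le C<\infty$ a.s. For some $\alpha\in(0,1]$ and $C<\infty$, $\|F(\cdot|\tilde x,\tilde z)-F(\cdot|x,z)\|\le C(|\tilde x-x|^\alpha+|\tilde z-z|^\alpha)$ for all $(x,z),(\tilde x,\tilde z)\in\mathcal A$ with $|\tilde x-x|+|\tilde z-z|$ sufficiently small. 3. $K_X,K_V$ are non-negative,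 compactly supported and continuously differentiable. For some $\eta>0$ put $\bar K(u)=\sup_{|t|\le\eta}|K_V'(u+t)|$. For some $d>d_x$ and $0<c\le C<\infty$, for all sufficiently large $n$ and all $v\in\bar{\mathcal V}$, both $$b_n^{-d}E\Big[K_X\big(\tfrac{X-x_0}{b_n}\big)K_V\big(\tfrac{\|V-v\|}{b_n}\big)\Big]\quad\text{and}\quad E\Big[K_X\big(\tfrac{X-x_0}{b_n}\big)K_V\big(\tfrac{\|V-v\|}{b_n}\big)\Big]\Big/E\Big[K_X\big(\tfrac{X-x_0}{b_n}\big)\bar K\big(\tfrac{\|V-v\|}{b_n}\big)\Big]$$ lie in $[c,C]$. 4. $\sup_{(x,z)}\|\hat F_n(\cdot|x,z)-F(\cdot|x,z)\|=O_P(\delta_n)$, the supremum being over $\mathcal A\cup\{(X_i,Z_i):i\le n\}$, where $0\le\delta_n=o(b_n/n^{1/s})$. **Continuity condition** on a function $m(x,v)$: as $r\downarrow0$, the supremum of $|m(\tilde x,\tilde v)-m(x_0,v)|$ over $v\in\bar{\mathcal V}$, $\tilde v\in\{F(\cdot|x,z):(x,z)\in\mathcal D\}$ and $\tilde x$ with $|\tilde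 x-x_0|\vee\|\tilde v-v\|\le r$ tends to $0$. **Theorem NP.** Suppose Assumption Nonparametric holds, $b_n\to0$ and $\dfrac{\log n}{n^{1-1/s}b_n^d}\to0$. (a) If $m$ is a jointly measurable version of $m(x,v)=E[Y|X=x,V=v]$ satisfying the continuity condition, then $\hat\mu_n(x_0)\to_P\mu(x_0):=E[m(x_0,V)\,|\,T=1]$. (b) Suppose further that the structural model $Y=g(X,\varepsilon,\zeta)$ holds, with $g$ measurable, $\varepsilon,\zeta$ taking values in standard Borel spaces, and: $W$ is independent of $(X,Z)$ given $\varepsilon$; $\zeta$ is independent of $(X,Z)$ given $\varepsilon$; for almost every $(x,z)$ the conditional law of $\varepsilon$ given $(X,Z)=(x,z)$ has a bounded density with respect to the law of $\varepsilon$; and $\varepsilon$ is boundedly complete for $W$, i.e. $E[\varphi(\varepsilon)|W]=0$ a.s. with $\varphi$ bounded measurable implies $\varphi(\varepsilon)=0$ a.s. Suppose $g(x_0,\varepsilon,\zeta)$ is integrable. If a jointly measurable function $m$ with $m(x,v)=\int g(x,e,t)\,dP_{(\varepsilon,\zeta)|V=v}(e,t)$ (for almost all $v$, simultaneously for all $x$)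 satisfies the continuity condition, then $\hat\mu_n(x_0)$ converges in probability to the average structural function $\mu(x_0)=E[g(x_0,\varepsilon,\zeta)\,|\,T=1]$. -/

import Mathlib

open MeasureTheory ProbabilityTheory Filter Topology Asymptotics

noncomputable section

/-- Euclidean space of dimension `k`. -/
abbrev Vec (k : ℕ) : Type := EuclideanSpace ℝ (Fin k)

/-- Real functions of the proxy value `w`; conditional distribution functions live here. The space
carries the product sigma-algebra, generated by the evaluations at the points `w`. -/
abbrev ProxyFun (dw : ℕ) : Type := (Fin dw → ℝ) → ℝ

/-- The conditional distribution function `F_{W|XZ}(w | x, z)` of a conditional law `κ`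
of `W` given `(X, Z)`; the set `Set.Iic w` is the orthant of all `u` with `u ≤ w` componentwise. -/
def controlCDF {dx dz dw : ℕ} (κ : Kernel (Vec dx × Vec dz) (Fin dw → ℝ)) (p : Vec dx × Vec dz) :
    ProxyFun dw :=
  fun w => (κ p).real (Set.Iic w)

/-- The `L²(ν)` norm of a function (used for square integrable functions only). -/
def l2Norm {dw : ℕ} (ν : Measure (Fin dw → ℝ)) (f : ProxyFun dw) : ℝ :=
  Real.sqrt (∫ w, f w ^ 2 ∂ν)

/-- The local supremum `K̄(u) = sup_{|t| ≤ η} |K'(u + t)|` of the derivative of a kernel. -/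
def kernelBar (K : ℝ → ℝ) (η u : ℝ) : ℝ :=
  ⨆ t : Set.Icc (-η) η, |deriv K (u + t)|

/-- The set of control function values `F_{W|XZ}(· | x, z)` for `(x, z)` in a set `A`. -/
def controlSet {dx dz dw : ℕ} (κ : Kernel (Vec dx × Vec dz) (Fin dw → ℝ))
    (A : Set (Vec dx × Vec dz)) : Set (ProxyFun dw) :=
  controlCDF κ '' A

/-- The population control variable `V = F_{W|XZ}(· | X, Z)`. -/
def controlVar {Ω : Type*} {dx dz dw : ℕ} (κ : Kernel (Vec dx × Vec dz) (Fin dw → ℝ))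
    (X : Ω → Vec dx) (Z : Ω → Vec dz) (ω : Ω) : ProxyFun dw :=
  controlCDF κ (X ω, Z ω)

/-- The small ball expectation `E[K((X - x₀)/b) L(‖V - v‖/b)]`. -/
def smallBall {Ω : Type*} [MeasurableSpace Ω] {dx dw : ℕ} (P : Measure Ω)
    (ν : Measure (Fin dw → ℝ)) (X : Ω → Vec dx) (V : Ω → ProxyFun dw) (KX : Vec dx → ℝ)
    (L : ℝ → ℝ) (x₀ : Vec dx) (b : ℝ) (v : ProxyFun dw) : ℝ :=
  ∫ ω, KX (b⁻¹ • (X ω - x₀)) * L (l2Norm ν (V ω - v) / b) ∂P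

/-- The kernel regression estimator at `(x, v)` computed from the first `n` triples
`(y j, xs j, vs j)`. -/
def kernelRegression {dx dw : ℕ} (ν : Measure (Fin dw → ℝ)) (KX : Vec dx → ℝ) (KV : ℝ → ℝ)
    (b : ℝ) (n : ℕ) (y : ℕ → ℝ) (xs : ℕ → Vec dx) (vs : ℕ → ProxyFun dw)
    (x : Vec dx) (v : ProxyFun dw) : ℝ :=
  (∑ j ∈ Finset.range n, y j * KX (b⁻¹ • (xs j - x)) * KV (l2Norm ν (vs j - v) / b)) /
    ∑ j ∈ Finset.range n, KX (b⁻¹ • (xs j - x)) * KV (l2Norm ν (vs j - v) / b)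

open Classical in
/-- The estimator `μ̂ₙ(x₀) = ∑ᵢ m̂ₙ(x₀, V̂ᵢ) Tᵢ / ∑ᵢ Tᵢ` with `V̂ᵢ = F̂ₙ(· | Xᵢ, Zᵢ)` and with
`Tᵢ` the indicator of `(Xᵢ, Zᵢ) ∈ A`, based on observations `0, …, n - 1`. Here `F` is the
realized first-stage estimate. -/
def asfEstimator {dx dz dw : ℕ} (ν : Measure (Fin dw → ℝ)) (KX : Vec dx → ℝ) (KV : ℝ → ℝ)
    (A : Set (Vec dx × Vec dz)) (x₀ : Vec dx) (b : ℝ) (n : ℕ) (y : ℕ → ℝ) (xs : ℕ → Vec dx)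
    (zs : ℕ → Vec dz) (F : Vec dx × Vec dz → ProxyFun dw) : ℝ :=
  (∑ i ∈ Finset.range n, if (xs i, zs i) ∈ A then
      kernelRegression ν KX KV b n y xs (fun j => F (xs j, zs j)) x₀ (F (xs i, zs i)) else 0) /
    ∑ i ∈ Finset.range n, if (xs i, zs i) ∈ A then (1 : ℝ) else 0

/-- `(Yᵢ, Xᵢ, Zᵢ, Wᵢ)`, `i = 0, 1, 2, …`, is an i.i.d. sequence of random vectors. -/
structure IsRandomSample {Ω : Type*} [MeasurableSpace Ω] {dx dz dw : ℕ} (P : Measure Ω)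
    (Y : ℕ → Ω → ℝ) (X : ℕ → Ω → Vec dx) (Z : ℕ → Ω → Vec dz) (W : ℕ → Ω → (Fin dw → ℝ)) :
    Prop where
  measurable_Y : ∀ i, Measurable (Y i)
  measurable_X : ∀ i, Measurable (X i)
  measurable_Z : ∀ i, Measurable (Z i)
  measurable_W : ∀ i, Measurable (W i)
  indep : iIndepFun (fun i ω => (Y i ω, X i ω, Z i ω, W i ω)) P
  identDistrib : ∀ i, IdentDistrib (fun ω => (Y i ω, X i ω, Z i ω, W i ω))
    (fun ω => (Y 0 ω, X 0 ω, Z 0 ω, W 0 ω)) P P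

/-- The nonparametric estimation assumption, without the continuity condition on the regression
function, which is stated separately. Population quantities are those of observation `0`.

* `κ` is the conditional law of `W` given `(X, Z)`, `ν` the finite measure of the `L²` norm,
  `A` the compact trimming set, `KX` and `KV` the kernels for `X` and for `V`;
* `Fhat n ω (x, z)` is the first-stage estimate of the function `F_{W|XZ}(· | x, z)`. -/
structure NonparametricAssumption {Ω : Type*} [MeasurableSpace Ω] {dx dz dw : ℕ} (P : Measure Ω)
    (Y : ℕ → Ω → ℝ) (X : ℕ → Ω → Vec dx) (Z : ℕ → Ω → Vec dz) (W : ℕ → Ω → (Fin dw → ℝ))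
    (κ : Kernel (Vec dx × Vec dz) (Fin dw → ℝ)) (ν : Measure (Fin dw → ℝ))
    (A : Set (Vec dx × Vec dz)) (x₀ : Vec dx) (KX : Vec dx → ℝ) (KV : ℝ → ℝ) (η d s : ℝ)
    (b δ : ℕ → ℝ) (Fhat : ℕ → Ω → Vec dx × Vec dz → ProxyFun dw) : Prop where
  sample : IsRandomSample P Y X Z W
  /-- `X` and at least one element of `Z` have a joint Lebesgue density. -/
  density : ∃ k : Fin dz, P.map (fun ω => (X 0 ω, Z 0 ω k)) ≪ volume
  /-- `κ` is a version of the conditional law of `W` given `(X, Z)`. -/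
  condLaw : P.map (fun ω => (X 0 ω, Z 0 ω)) ⊗ₘ κ = P.map (fun ω => ((X 0 ω, Z 0 ω), W 0 ω))
  dominated : ∀ᵐ p ∂(P.map (fun ω => (X 0 ω, Z 0 ω))), κ p ≪ ν
  compact : IsCompact A
  trimming : 0 < P {ω | (X 0 ω, Z 0 ω) ∈ A}
  two_lt_s : 2 < s
  moment_integrable : Integrable (fun ω => |Y 0 ω| ^ s) P
  /-- `E[|Y|^s | X, Z] ≤ C` almost surely. -/
  moment_bound : ∃ C : ℝ, ∀ᵐ ω ∂P,
    (P[fun ω => |Y 0 ω| ^ s | MeasurableSpace.comap (fun ω => (X 0 ω, Z 0 ω)) inferInstance]) ω ≤ C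
  /-- Local Hölder continuity of `(x, z) ↦ F_{W|XZ}(· | x, z)` on `A`. -/
  holder : ∃ α C r : ℝ, 0 < α ∧ α ≤ 1 ∧ 0 < r ∧ ∀ p ∈ A, ∀ q ∈ A,
    ‖q.1 - p.1‖ + ‖q.2 - p.2‖ ≤ r →
      l2Norm ν (controlCDF κ q - controlCDF κ p) ≤ C * (‖q.1 - p.1‖ ^ α + ‖q.2 - p.2‖ ^ α)
  KX_nonneg : ∀ u, 0 ≤ KX u
  KX_compact : HasCompactSupport KX
  KX_contDiff : ContDiff ℝ 1 KX
  KV_nonneg : ∀ u, 0 ≤ KV u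
  KV_compact : HasCompactSupport KV
  KV_contDiff : ContDiff ℝ 1 KV
  η_pos : 0 < η
  d_gt : (dx : ℝ) < d
  /-- Small ball condition: `b⁻ᵈ E[K K]` and `E[K K] / E[K K̄]` are bounded and bounded away
  from zero, uniformly over the control values `v` and for all large `n`. -/
  small_ball : ∃ c C : ℝ, 0 < c ∧ ∀ᶠ n in atTop, ∀ v ∈ controlSet κ A,
    let E₁ := smallBall P ν (X 0) (controlVar κ (X 0) (Z 0)) KX KV x₀ (b n) v
    let E₂ := smallBall P ν (X 0) (controlVar κ (X 0) (Z 0)) KX (kernelBar KV η) x₀ (b n) v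
    (c ≤ b n ^ (-d) * E₁ ∧ b n ^ (-d) * E₁ ≤ C) ∧ (c ≤ E₁ / E₂ ∧ E₁ / E₂ ≤ C)
  Fhat_memLp : ∀ n ω p, MemLp (Fhat n ω p) 2 ν
  δ_nonneg : ∀ n, 0 ≤ δ n
  δ_rate : δ =o[atTop] fun n : ℕ => b n / (n : ℝ) ^ (1 / s)
  /-- `‖F̂ₙ - F‖_∞ = O_P(δₙ)`, the supremum being over `A` and the sample points. -/
  first_stage : ∀ e : ℝ, 0 < e → ∃ M : ℝ, ∀ᶠ n in atTop,
    P {ω | ¬ ∀ p ∈ A ∪ {p | ∃ i < n, p = (X i ω, Z i ω)},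
      l2Norm ν (Fhat n ω p - controlCDF κ p) ≤ M * δ n} ≤ ENNReal.ofReal e

/-- `m(x̃, ṽ)` tends to `m(x₀, v)` as `|x̃ - x₀| ∨ ‖ṽ - v‖ → 0`, uniformly over control values
`v` from the trimming set `A` and `ṽ` from the set `S`. -/
def RegressionContinuity {dx dz dw : ℕ} (κ : Kernel (Vec dx × Vec dz) (Fin dw → ℝ))
    (ν : Measure (Fin dw → ℝ)) (A S : Set (Vec dx × Vec dz)) (x₀ : Vec dx)
    (m : Vec dx → ProxyFun dw → ℝ) : Prop :=
  ∀ e : ℝ, 0 < e → ∃ r : ℝ, 0 < r ∧ ∀ v ∈ controlSet κ A, ∀ v' ∈ controlSet κ S, ∀ x : Vec dx,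
    ‖x - x₀‖ ≤ r → l2Norm ν (v' - v) ≤ r → |m x v' - m x₀ v| ≤ e

/-- `m` is a version of the regression function `m(x, v) = E[Y | X = x, V = v]`. -/
def IsRegression {Ω : Type*} [MeasurableSpace Ω] {dx dw : ℕ} (P : Measure Ω) (Y : Ω → ℝ)
    (X : Ω → Vec dx) (V : Ω → ProxyFun dw) (m : Vec dx → ProxyFun dw → ℝ) : Prop :=
  Measurable (Function.uncurry m) ∧
    P[Y | MeasurableSpace.comap (fun ω => (X ω, V ω)) inferInstance] =ᵐ[P] fun ω => m (X ω) (V ω)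

/-- Conditional independence of `f` and `h` given `c`. -/
def CondIndepGiven {Ω α β γ : Type*} [MeasurableSpace Ω] [MeasurableSpace α] [MeasurableSpace β]
    [MeasurableSpace γ] (P : Measure Ω) (f : Ω → α) (h : Ω → β) (c : Ω → γ) : Prop :=
  ∀ (s : Set α) (t : Set β), MeasurableSet s → MeasurableSet t →
    P⟦f ⁻¹' s ∩ h ⁻¹' t | MeasurableSpace.comap c inferInstance⟧ =ᵐ[P]
      P⟦f ⁻¹' s | MeasurableSpace.comap c inferInstance⟧ *
        P⟦h ⁻¹' t | MeasurableSpace.comap c inferInstance⟧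

/-- The structural outcome model with proxies: `Y = g(X, ε, ζ)`, `W` and `ζ` are each independent
of `(X, Z)` given `ε`, the density ratio `f_{ε|XZ} / f_ε` is bounded (for almost every value of
`(X, Z)`), and `ε` is boundedly complete for `W`. -/
structure ProxyModel {Ω E S : Type*} [MeasurableSpace Ω] [MeasurableSpace E]
    [StandardBorelSpace E] [Nonempty E] [MeasurableSpace S] {dx dz dw : ℕ} (P : Measure Ω)
    [IsFiniteMeasure P]
    (Y : Ω → ℝ) (X : Ω → Vec dx) (Z : Ω → Vec dz) (W : Ω → (Fin dw → ℝ))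
    (g : Vec dx → E → S → ℝ) (ε : Ω → E) (ζ : Ω → S) : Prop where
  measurable_g : Measurable fun t : Vec dx × E × S => g t.1 t.2.1 t.2.2
  measurable_ε : Measurable ε
  measurable_ζ : Measurable ζ
  outcome : ∀ᵐ ω ∂P, Y ω = g (X ω) (ε ω) (ζ ω)
  proxy_indep : CondIndepGiven P W (fun ω => (X ω, Z ω)) ε
  shock_indep : CondIndepGiven P ζ (fun ω => (X ω, Z ω)) ε
  bounded_density : ∀ᵐ p ∂(P.map (fun ω => (X ω, Z ω))), ∃ B : NNReal,
    condDistrib ε (fun ω => (X ω, Z ω)) P p ≤ B • P.map ε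
  complete : ∀ φ : E → ℝ, Measurable φ → (∃ B : ℝ, ∀ e, |φ e| ≤ B) →
    P[fun ω => φ (ε ω) | MeasurableSpace.comap W inferInstance] =ᵐ[P] 0 →
      ∀ᵐ ω ∂P, φ (ε ω) = 0

/-- `m` is a version of the structural regression `m(x, v) = E[g(x, ε, ζ) | V = v]`, computed for
all `x` from one conditional law of `(ε, ζ)` given `V`. -/
def IsStructuralRegression {Ω E S : Type*} [MeasurableSpace Ω] [MeasurableSpace E]
    [StandardBorelSpace E] [Nonempty E] [MeasurableSpace S] [StandardBorelSpace S] [Nonempty S]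
    {dx dw : ℕ} (P : Measure Ω) [IsFiniteMeasure P] (V : Ω → ProxyFun dw)
    (g : Vec dx → E → S → ℝ) (ε : Ω → E) (ζ : Ω → S) (m : Vec dx → ProxyFun dw → ℝ) : Prop :=
  Measurable (Function.uncurry m) ∧
    ∀ᵐ v ∂(P.map V), ∀ x, m x v = ∫ t, g x t.1 t.2 ∂(condDistrib (fun ω => (ε ω, ζ ω)) V P v)

end

/-!
Both parts rest on one consistency result: if `m` is a version of `E[Y | X, V]` that satisfies the
continuity condition, the estimator converges in probability to the trimmed average of `m (x₀, V)`
(`NonparametricAssumption.tendstoInMeasure_asfEstimator`). The structural part then has to show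
that the structural regression is such a version and has the right trimmed average
(`ProxyModel.isRegression_and_setIntegral_eq`).

**Consistency.** The estimator averages the kernel regression over the sample, so a bound that
holds on average over the observations `i` is enough: no uniform law over control values is
needed, and second moments suffice. Given observation `i`, the sums over `j ≠ i` of the weights,
of the weights built with the local supremum of `|KV'|`, and of the weighted residuals
`Y - m (X, V)` are sums of independent copies with second moment of order `n * b ^ d`; the
residuals are centred because the weight is a function of `(X, V)`. Fubini and Markov's inequality
control the averages over `i` of the squares of the centred sums
(`measure_average_centredSum_sq_ge_le`).

The deterministic inequality `abs_kernelRegression_sub_le_sq` turns this into a bound for the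
regression error at observation `i`. If both weight sums at `i` are close to their means, the
denominator is of order `n * b ^ d`, a first-stage error of size `Δ` changes the weights by at
most `2 * Δ / b` times the weights with the local supremum, and the noise enters through its
square. If not, the error is still at most `max |Y|` plus a constant, because a kernel regression
is a weighted average of outcomes, and this crude bound is charged to the squares of the centred
weight sums, whose average is of order `n * b ^ d`, against `(n * b ^ d) ^ 2`. Since
`max |Y| = O_P(n ^ (1 / s))`, what remains is of the orders `n ^ (1 / s) / (n * b ^ d)` and
`n ^ (1 / s) * δ / b`, and both vanish.

The set `D` of the continuity condition need not be measurable. The modulus of continuity is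
therefore transferred to the sample through the measurable set `closePairs` of pairs of covariate
values and Fubini (`ae_forall_pair_mem`).

**Identification.** Given `(X, Z)`, the law of the proxy `W` is the mixture of its laws given `ε`
over the law of `ε`. By bounded completeness two mixing laws with bounded densities that produce
the same law of `W` coincide (`eq_of_lintegral_condDistrib_eq`), so the law of `(ε, ζ)` given
`(X, Z)` depends on `(X, Z)` only through the control variable. Blackwell's principle
(`exists_measurable_factor`) makes this dependence measurable, and hence the law given `(X, Z)`
equals the law given the control variable (`ProxyModel.condDistrib_covariates_ae_eq`). Integrating
`g (x, ·)` against this law gives both claims about the structural regression.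
-/

/-! ### The `L²(ν)` seminorm -/

lemma l2Norm_nonneg {dw : ℕ} (ν : Measure (Fin dw → ℝ)) (f : ProxyFun dw) : 0 ≤ l2Norm ν f :=
  Real.sqrt_nonneg _

/-- On square integrable functions `l2Norm` is the norm of Mathlib's space `Lp ℝ 2 ν`. -/
lemma l2Norm_eq_norm_toLp {dw : ℕ} {ν : Measure (Fin dw → ℝ)} {f : ProxyFun dw}
    (hf : MemLp f 2 ν) : l2Norm ν f = ‖hf.toLp f‖ := by
  rw [Lp.norm_toLp, l2Norm, hf.eLpNorm_eq_integral_rpow_norm (by norm_num) (by norm_num),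
    ENNReal.toReal_ofReal (by positivity), Real.sqrt_eq_rpow]
  norm_num

/-- The distance of perturbed functions differs from the distance of the functions by at most the
sum of the perturbations. -/
lemma abs_l2Norm_sub_sub_le {dw : ℕ} {ν : Measure (Fin dw → ℝ)} {f f' h h' : ProxyFun dw}
    (hf : MemLp f 2 ν) (hf' : MemLp f' 2 ν) (hh : MemLp h 2 ν) (hh' : MemLp h' 2 ν) :
    |l2Norm ν (f' - h') - l2Norm ν (f - h)| ≤ l2Norm ν (f' - f) + l2Norm ν (h' - h) := by
  rw [l2Norm_eq_norm_toLp (hf'.sub hh'), l2Norm_eq_norm_toLp (hf.sub hh),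
    l2Norm_eq_norm_toLp (hf'.sub hf), l2Norm_eq_norm_toLp (hh'.sub hh)]
  rw [MemLp.toLp_sub hf' hh', MemLp.toLp_sub hf hh, MemLp.toLp_sub hf' hf, MemLp.toLp_sub hh' hh]
  refine (abs_norm_sub_norm_le _ _).trans ?_
  rw [sub_sub_sub_comm]
  exact norm_sub_le _ _

/-- The orthant below a vector with rational coordinates. -/
def ratOrthant {dw : ℕ} (q : Fin dw → ℚ) : Set (Fin dw → ℝ) := Set.Iic fun i => (q i : ℝ)

lemma isPiSystem_ratOrthants (dw : ℕ) : IsPiSystem (Set.range (ratOrthant (dw := dw))) := by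
  rintro _ ⟨q, rfl⟩ _ ⟨r, rfl⟩ -
  refine ⟨fun i => min (q i) (r i), ?_⟩
  ext x
  simp only [ratOrthant, Set.mem_Iic, Set.mem_inter_iff, Pi.le_def, Rat.cast_min, le_min_iff,
    forall_and]

lemma generateFrom_ratOrthants (dw : ℕ) :
    MeasurableSpace.generateFrom (Set.range (ratOrthant (dw := dw))) = MeasurableSpace.pi := by
  have h := generateFrom_eq_pi (ι := Fin dw) (α := fun _ => ℝ)
    (C := fun _ => ⋃ a : ℚ, {Set.Iic (a : ℝ)})
    (fun _ => (Real.borel_eq_generateFrom_Iic_rat.symm.trans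
      (BorelSpace.measurable_eq (α := ℝ)).symm))
    (fun _ => ⟨fun n : ℕ => Set.Iic (n : ℝ), fun n => Set.mem_iUnion.2 ⟨(n : ℚ), by simp⟩,
      Set.iUnion_eq_univ_iff.2 fun x => exists_nat_ge x⟩)
  rw [← h]
  congr 1
  ext t
  constructor
  · rintro ⟨q, rfl⟩
    exact ⟨fun i => Set.Iic (q i : ℝ), fun i _ => Set.mem_iUnion.2 ⟨q i, rfl⟩, Set.pi_univ_Iic _⟩
  · rintro ⟨f, hf, rfl⟩
    choose q hq using fun i => Set.mem_iUnion.1 (hf i (Set.mem_univ i))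
    refine ⟨q, ?_⟩
    rw [ratOrthant, ← Set.pi_univ_Iic]
    exact congrArg _ (funext fun i => (Set.mem_singleton_iff.1 (hq i)).symm)

/-- Joint measurability of distribution functions, with respect to any sigma-algebra that makes
the value at each fixed point measurable. -/
lemma measurable_cdf_uncurry {α : Type*} [MeasurableSpace α] {dw : ℕ}
    (μ : α → Measure (Fin dw → ℝ)) [∀ a, IsProbabilityMeasure (μ a)]
    (h : ∀ w, Measurable fun a => (μ a).real (Set.Iic w)) :
    Measurable fun t : α × (Fin dw → ℝ) => (μ t.1).real (Set.Iic t.2) := by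
  have hμ : Measurable μ :=
    Measurable.measure_of_isPiSystem_of_isProbabilityMeasure
      (generateFrom_ratOrthants dw).symm (isPiSystem_ratOrthants dw) <| by
        rintro _ ⟨q, rfl⟩
        have := (h fun i => (q i : ℝ)).ennreal_ofReal
        simpa [ratOrthant] using this
  let k : Kernel α (Fin dw → ℝ) := ⟨μ, hμ⟩
  have : IsMarkovKernel k := ⟨fun a => by show IsProbabilityMeasure (μ a); infer_instance⟩
  have hs : MeasurableSet {q : (α × (Fin dw → ℝ)) × (Fin dw → ℝ) | q.2 ≤ q.1.2} :=
    measurableSet_le measurable_snd (measurable_snd.comp measurable_fst)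
  have h2 := Kernel.measurable_kernel_prodMk_left (κ := Kernel.prodMkRight (Fin dw → ℝ) k) hs
  exact h2.ennreal_toReal

lemma measurable_l2Norm {α : Type*} [MeasurableSpace α] {dw : ℕ} (ν : Measure (Fin dw → ℝ))
    [IsFiniteMeasure ν] {f : α → ProxyFun dw} (hf : Measurable (Function.uncurry f)) :
    Measurable fun a => l2Norm ν (f a) := by
  refine Measurable.sqrt ?_
  have : StronglyMeasurable (Function.uncurry fun a w => f a w ^ 2) :=
    (hf.pow_const 2).stronglyMeasurable
  exact this.integral_prod_right.measurable

/-! ### The control function -/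

section control

variable {dx dz dw : ℕ} (κ : Kernel (Vec dx × Vec dz) (Fin dw → ℝ)) [IsMarkovKernel κ]

lemma measurable_controlCDF_uncurry :
    Measurable fun t : (Vec dx × Vec dz) × (Fin dw → ℝ) => controlCDF κ t.1 t.2 :=
  measurable_cdf_uncurry (fun p => κ p) fun _ =>
    (Kernel.measurable_coe κ measurableSet_Iic).ennreal_toReal

omit [IsMarkovKernel κ] in
lemma measurable_controlCDF : Measurable (controlCDF κ) :=
  measurable_pi_lambda _ fun _ => (Kernel.measurable_coe κ measurableSet_Iic).ennreal_toReal

lemma memLp_controlCDF (ν : Measure (Fin dw → ℝ)) [IsFiniteMeasure ν] (p : Vec dx × Vec dz) :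
    MemLp (controlCDF κ p) 2 ν := by
  refine MemLp.of_bound (C := 1)
    ((measurable_controlCDF_uncurry κ).comp measurable_prodMk_left).aestronglyMeasurable ?_
  refine ae_of_all _ fun w => ?_
  simp only [controlCDF, Real.norm_eq_abs, abs_of_nonneg measureReal_nonneg]
  exact measureReal_le_one

lemma measurable_l2Norm_controlCDF_sub (ν : Measure (Fin dw → ℝ)) [IsFiniteMeasure ν] :
    Measurable fun t : (Vec dx × Vec dz) × (Vec dx × Vec dz) =>
      l2Norm ν (controlCDF κ t.1 - controlCDF κ t.2) := by
  refine measurable_l2Norm ν ?_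
  have h := measurable_controlCDF_uncurry κ
  exact (h.comp (f := fun s : ((Vec dx × Vec dz) × (Vec dx × Vec dz)) × (Fin dw → ℝ) =>
    (s.1.1, s.2)) (by fun_prop)).sub (h.comp (f := fun s : ((Vec dx × Vec dz) ×
    (Vec dx × Vec dz)) × (Fin dw → ℝ) => (s.1.2, s.2)) (by fun_prop))

/-- The `L²(ν)` distance of the control variable to a fixed control value is measurable with
respect to the control variable, although `l2Norm ν` itself is not measurable for the product
sigma-algebra of `ProxyFun dw`. -/
lemma measurable_comap_l2Norm_controlVar {Ω : Type*} (ν : Measure (Fin dw → ℝ))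
    [IsFiniteMeasure ν] (X : Ω → Vec dx) (Z : Ω → Vec dz) (q : Vec dx × Vec dz) :
    Measurable[MeasurableSpace.comap (controlVar κ X Z) inferInstance]
      fun ω => l2Norm ν (controlVar κ X Z ω - controlCDF κ q) := by
  let _ : MeasurableSpace Ω := MeasurableSpace.comap (controlVar κ X Z) inferInstance
  refine measurable_l2Norm ν ?_
  have hV : Measurable (controlVar κ X Z) := comap_measurable _
  have h := measurable_cdf_uncurry (fun ω => κ (X ω, Z ω)) fun w =>
    (measurable_pi_apply w).comp hV
  exact h.sub ((measurable_controlCDF_uncurry κ).comp (f := fun s : Ω × (Fin dw → ℝ) =>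
    (q, s.2)) (by fun_prop))

end control

/-! ### The kernels -/

lemma norm_le_of_hasCompactSupport {E : Type*} [NormedAddCommGroup E] {K : E → ℝ}
    (hK : HasCompactSupport K) : ∃ R : ℝ, 0 < R ∧ ∀ u, K u ≠ 0 → ‖u‖ ≤ R := by
  obtain ⟨R, hR, h⟩ := hK.isCompact.isBounded.exists_pos_norm_le
  exact ⟨R, hR, fun u hu => h u (subset_tsupport K hu)⟩

lemma exists_bound_of_hasCompactSupport {E : Type*} [NormedAddCommGroup E] {K : E → ℝ}
    (hc : Continuous K) (hK : HasCompactSupport K) : ∃ B : ℝ, 0 < B ∧ ∀ u, |K u| ≤ B := by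
  obtain ⟨B, hB⟩ := hc.bounded_above_of_compact_support hK
  exact ⟨max B 1, by positivity, fun u => (hB u).trans (le_max_left _ _)⟩

section kernelBar

variable {K : ℝ → ℝ} {η : ℝ}

lemma kernelBar_nonneg (K : ℝ → ℝ) (η u : ℝ) : 0 ≤ kernelBar K η u :=
  Real.iSup_nonneg fun _ => abs_nonneg _

lemma kernelBar_le {B : ℝ} (hB : ∀ u, |deriv K u| ≤ B) (hη : 0 < η) (u : ℝ) :
    kernelBar K η u ≤ B := by
  have : Nonempty (Set.Icc (-η) η) := ⟨⟨0, by simp [hη.le]⟩⟩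
  exact ciSup_le fun t => hB _

lemma abs_deriv_le_kernelBar {B : ℝ} (hB : ∀ u, |deriv K u| ≤ B) {u t : ℝ} (ht : |t| ≤ η) :
    |deriv K (u + t)| ≤ kernelBar K η u :=
  le_ciSup (f := fun t : Set.Icc (-η) η => |deriv K (u + t)|)
    ⟨B, by rintro _ ⟨t, rfl⟩; exact hB _⟩ ⟨t, abs_le.1 ht⟩

lemma measurable_kernelBar {B : ℝ} (hK : ContDiff ℝ 1 K) (hB : ∀ u, |deriv K u| ≤ B) :
    Measurable (kernelBar K η) := by
  refine LowerSemicontinuous.measurable (lowerSemicontinuous_ciSup (fun u => ?_) fun t => ?_)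
  · exact ⟨B, by rintro _ ⟨t, rfl⟩; exact hB _⟩
  · exact ((hK.continuous_deriv le_rfl).comp (continuous_add_const _)).abs.lowerSemicontinuous

/-- A perturbation of the argument by at most `η` changes the kernel by at most its size times the
local supremum of the derivative. -/
lemma abs_sub_le_kernelBar {B : ℝ} (hK : ContDiff ℝ 1 K) (hB : ∀ u, |deriv K u| ≤ B) {u v : ℝ}
    (huv : |v - u| ≤ η) : |K v - K u| ≤ kernelBar K η u * |v - u| := by
  have := Convex.norm_image_sub_le_of_norm_deriv_le (f := K) (s := Set.Icc (u - η) (u + η))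
    (C := kernelBar K η u) (x := u) (y := v)
    (fun x _ => (hK.differentiable (by norm_num)).differentiableAt) (fun x hx => ?_)
    (convex_Icc _ _) ?_ ?_
  · simpa using this
  · have h := abs_deriv_le_kernelBar hB (u := u) (t := x - u) (η := η)
      (abs_le.2 ⟨by linarith [hx.1], by linarith [hx.2]⟩)
    simpa using h
  · have := abs_nonneg (v - u)
    constructor <;> linarith
  · rw [abs_le] at huv
    constructor <;> linarith

end kernelBar

/-! ### Perturbation of a weighted average -/

/-- The error of a weighted average with nonnegative, perturbed weights `w'`, in terms of a weighted
sum of regression errors `y j - r j` with the unperturbed weights `w`. -/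
lemma abs_weighted_average_sub_le {ι : Type*} {s : Finset ι} {y r w w' wb : ι → ℝ}
    {μ τ e U M L H : ℝ} (hw'0 : ∀ j ∈ s, 0 ≤ w' j)
    (hww' : ∀ j ∈ s, |w' j - w j| ≤ τ * wb j) (hτ : 0 ≤ τ)
    (hr : ∀ j ∈ s, w' j ≠ 0 ∨ w j ≠ 0 → |r j - μ| ≤ e) (hy : ∀ j ∈ s, |y j| ≤ U)
    (hμ : |μ| ≤ M) (hU : 0 ≤ U) (he : 0 ≤ e) (hL : 0 < L) (hLw : L ≤ ∑ j ∈ s, w j)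
    (hH : ∑ j ∈ s, wb j ≤ H) (hτH : τ * H ≤ L / 2) :
    |(∑ j ∈ s, y j * w' j) / ∑ j ∈ s, w' j - μ| ≤
      e + 2 / L * (|∑ j ∈ s, (y j - r j) * w j| + (U + M + e) * (τ * H)) := by
  have hM : 0 ≤ M := (abs_nonneg _).trans hμ
  have hτH' : τ * ∑ j ∈ s, wb j ≤ τ * H := mul_le_mul_of_nonneg_left hH hτ
  have hdiff : ∑ j ∈ s, |w' j - w j| ≤ τ * H := by
    refine le_trans ?_ hτH'
    rw [Finset.mul_sum]
    exact Finset.sum_le_sum hww'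
  have hden : L / 2 ≤ ∑ j ∈ s, w' j := by
    have h1 : ∑ j ∈ s, w j - ∑ j ∈ s, w' j ≤ ∑ j ∈ s, |w' j - w j| := by
      rw [← Finset.sum_sub_distrib]
      refine Finset.sum_le_sum fun j _ => ?_
      rw [abs_sub_comm]
      exact le_abs_self _
    linarith
  have hpos : 0 < ∑ j ∈ s, w' j := by linarith
  set N := ∑ j ∈ s, w' j with hN
  have hid : (∑ j ∈ s, y j * w' j) / N - μ =
      ((∑ j ∈ s, (r j - μ) * w' j) + ((∑ j ∈ s, (y j - r j) * w j) +
        ∑ j ∈ s, (y j - r j) * (w' j - w j))) / N := by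
    rw [eq_div_iff hpos.ne', sub_mul, div_mul_cancel₀ _ hpos.ne', hN, Finset.mul_sum,
      ← Finset.sum_sub_distrib, ← Finset.sum_add_distrib, ← Finset.sum_add_distrib]
    exact Finset.sum_congr rfl fun j _ => by ring
  have h1 : |∑ j ∈ s, (r j - μ) * w' j| ≤ e * N := by
    rw [hN, Finset.mul_sum]
    refine (Finset.abs_sum_le_sum_abs _ _).trans (Finset.sum_le_sum fun j hj => ?_)
    rw [abs_mul, abs_of_nonneg (hw'0 j hj)]
    by_cases h : w' j = 0
    · simp [h]
    · exact mul_le_mul_of_nonneg_right (hr j hj (Or.inl h)) (hw'0 j hj)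
  have h2 : |∑ j ∈ s, (y j - r j) * (w' j - w j)| ≤ (U + M + e) * (τ * H) := by
    refine le_trans ?_ (mul_le_mul_of_nonneg_left hdiff (by positivity))
    rw [Finset.mul_sum]
    refine (Finset.abs_sum_le_sum_abs _ _).trans (Finset.sum_le_sum fun j hj => ?_)
    rw [abs_mul]
    by_cases h : w' j ≠ 0 ∨ w j ≠ 0
    · refine mul_le_mul_of_nonneg_right ?_ (abs_nonneg _)
      have := hr j hj h
      have h3 : |y j - r j| ≤ |y j| + (|r j - μ| + |μ|) := by
        have e1 : y j - r j = y j + (-(r j - μ) + -μ) := by ring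
        rw [e1]
        refine (abs_add_le _ _).trans (add_le_add le_rfl ((abs_add_le _ _).trans ?_))
        rw [abs_neg, abs_neg]
      linarith [hy j hj]
    · push Not at h
      simp [h.1, h.2]
  rw [hid, abs_div, abs_of_pos hpos, div_le_iff₀ hpos]
  have h3 : 1 ≤ 2 / L * N := by
    rw [div_mul_eq_mul_div, le_div_iff₀ hL]
    linarith
  set a := |∑ j ∈ s, (y j - r j) * w j| + (U + M + e) * (τ * H) with ha
  have ha0 : 0 ≤ a := by
    have : 0 ≤ τ * H := (Finset.sum_nonneg fun j _ => abs_nonneg _).trans hdiff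
    positivity
  have h4 : a ≤ 2 / L * a * N := by
    have := mul_le_mul_of_nonneg_left h3 ha0
    linarith
  have h5 := (abs_add_le (∑ j ∈ s, (r j - μ) * w' j) ((∑ j ∈ s, (y j - r j) * w j) +
        ∑ j ∈ s, (y j - r j) * (w' j - w j)))
  have h6 := abs_add_le (∑ j ∈ s, (y j - r j) * w j) (∑ j ∈ s, (y j - r j) * (w' j - w j))
  have h7 : (e + 2 / L * a) * N = e * N + 2 / L * a * N := by ring
  rw [h7]
  linarith

/-- A weighted average with nonnegative weights (possibly all zero) is bounded by the bound of its
terms. -/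
lemma abs_weighted_average_le {ι : Type*} {s : Finset ι} {y w : ι → ℝ} {U : ℝ}
    (hw : ∀ j ∈ s, 0 ≤ w j) (hy : ∀ j ∈ s, |y j| ≤ U) (hU : 0 ≤ U) :
    |(∑ j ∈ s, y j * w j) / ∑ j ∈ s, w j| ≤ U := by
  rw [abs_div, abs_of_nonneg (Finset.sum_nonneg hw)]
  refine div_le_of_le_mul₀ (Finset.sum_nonneg hw) hU ?_
  rw [Finset.mul_sum]
  refine (Finset.abs_sum_le_sum_abs _ _).trans (Finset.sum_le_sum fun j hj => ?_)
  rw [abs_mul, abs_of_nonneg (hw j hj)]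
  exact mul_le_mul_of_nonneg_right (hy j hj) (hw j hj)

/-! ### Second moments of decoupled sums -/

section decoupled

variable {Ω α : Type*} [MeasurableSpace Ω] [MeasurableSpace α] {P : Measure Ω}
  {ξ : ℕ → Ω → α}

/-- The sum over `j < n`, `j ≠ i`, of the values `h (ξ i) (ξ j)`, centred conditionally on `ξ i`:
the conditional mean is written as an integral over observation `0`, which has the same law. -/
noncomputable def centredSum (P : Measure Ω) (ξ : ℕ → Ω → α) (h : α → α → ℝ) (n i : ℕ) (ω : Ω) :
    ℝ :=
  ∑ j ∈ (Finset.range n).erase i, (h (ξ i ω) (ξ j ω) - ∫ ω', h (ξ i ω) (ξ 0 ω') ∂P)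

lemma measurable_integral_right [SFinite P] {h : α → α → ℝ} (hh : Measurable (Function.uncurry h))
    {f : Ω → α} (hf : Measurable f) : Measurable fun x => ∫ ω, h x (f ω) ∂P := by
  have : StronglyMeasurable (Function.uncurry fun x ω => h x (f ω)) :=
    (hh.comp (measurable_fst.prodMk (hf.comp measurable_snd))).stronglyMeasurable
  exact this.integral_prod_right.measurable

lemma measurable_centredSum [SFinite P] {h : α → α → ℝ} (hh : Measurable (Function.uncurry h))
    (hξ : ∀ i, Measurable (ξ i)) (n i : ℕ) : Measurable (centredSum P ξ h n i) := by
  refine Finset.measurable_sum _ fun j _ => Measurable.sub ?_ ?_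
  · exact hh.comp ((hξ i).prodMk (hξ j))
  · exact (measurable_integral_right hh (hξ 0)).comp (hξ i)

/-- The second moment of a centred sum of independent copies. -/
lemma integral_sq_sum_sub_le [IsProbabilityMeasure P] (hind : iIndepFun ξ P)
    (hid : ∀ i, IdentDistrib (ξ i) (ξ 0) P P) {f : α → ℝ}
    (hf : Measurable f) {σ : ℝ} (hL : MemLp (fun ω => f (ξ 0 ω)) 2 P)
    (hσ : ∫ ω, f (ξ 0 ω) ^ 2 ∂P ≤ σ) (T : Finset ℕ) :
    ∫⁻ ω, ENNReal.ofReal ((∑ j ∈ T, (f (ξ j ω) - ∫ ω', f (ξ 0 ω') ∂P)) ^ 2) ∂P ≤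
      ENNReal.ofReal (T.card * σ) := by
  have hidf : ∀ j, IdentDistrib (fun ω => f (ξ j ω)) (fun ω => f (ξ 0 ω)) P P :=
    fun j => (hid j).comp hf
  have hLj : ∀ j, MemLp (fun ω => f (ξ j ω)) 2 P := fun j => (hidf j).symm.memLp_iff.1 hL
  have hsum : MemLp (∑ j ∈ T, fun ω => f (ξ j ω)) 2 P := memLp_finsetSum' _ fun j _ => hLj j
  have hvar : Var[∑ j ∈ T, fun ω => f (ξ j ω); P] ≤ T.card * σ := by
    rw [IndepFun.variance_sum (fun j _ => hLj j)
      (fun i _ j _ hij => (hind.indepFun hij).comp hf hf)]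
    calc ∑ j ∈ T, Var[fun ω => f (ξ j ω); P] ≤ ∑ j ∈ T, σ := by
          refine Finset.sum_le_sum fun j _ => ?_
          rw [(hidf j).variance_eq]
          exact (variance_le_expectation_sq hL.1).trans hσ
      _ = T.card * σ := by simp
  have hmean : P[∑ j ∈ T, fun ω => f (ξ j ω)] = ∑ j ∈ T, ∫ ω', f (ξ 0 ω') ∂P := by
    simp only [Finset.sum_apply]
    rw [integral_finsetSum _ fun j _ => (hLj j).integrable (by norm_num)]
    exact Finset.sum_congr rfl fun j _ => (hidf j).integral_eq
  refine le_trans (le_of_eq ?_) (ENNReal.ofReal_le_ofReal hvar)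
  rw [hsum.ofReal_variance_eq, evariance_eq_lintegral_ofReal]
  refine lintegral_congr fun ω => ?_
  rw [hmean, Finset.sum_sub_distrib]
  simp

/-- Conditionally on `ξ i`, the sum over `j ≠ i` is a sum of independent copies, so that its second
moment obeys the bound that holds for each fixed value of `ξ i`. -/
lemma lintegral_indicator_centredSum_sq_le [IsProbabilityMeasure P] (hind : iIndepFun ξ P)
    (hξ : ∀ i, Measurable (ξ i)) (hid : ∀ i, IdentDistrib (ξ i) (ξ 0) P P) {h : α → α → ℝ}
    (hh : Measurable (Function.uncurry h)) {A : Set α} (hA : MeasurableSet A) {σ : ℝ}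
    (hL : ∀ x ∈ A, MemLp (fun ω => h x (ξ 0 ω)) 2 P)
    (hσ : ∀ x ∈ A, ∫ ω, h x (ξ 0 ω) ^ 2 ∂P ≤ σ) (hσ0 : 0 ≤ σ) (n i : ℕ) :
    ∫⁻ ω, ENNReal.ofReal ((ξ i ⁻¹' A).indicator (fun ω => centredSum P ξ h n i ω ^ 2) ω) ∂P ≤
      ENNReal.ofReal (n * σ) := by
  set T := (Finset.range n).erase i with hT
  have hcard : (T.card : ℝ) ≤ n := by
    have : T.card ≤ n := by simpa using Finset.card_erase_le (s := Finset.range n) (a := i)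
    exact_mod_cast this
  -- the tuple of the observations other than `i`
  let τ : Ω → (T → α) := fun ω j => ξ j ω
  have hτ : Measurable τ := measurable_pi_lambda _ fun j => hξ j
  have hindep : IndepFun (ξ i) τ P := by
    have := hind.indepFun_finset {i} T (by simp [hT]) hξ
    exact this.comp (φ := fun t : ({i} : Finset ℕ) → α => t ⟨i, Finset.mem_singleton_self i⟩)
      (ψ := id) (measurable_pi_apply _) measurable_id
  let Φ : α × (T → α) → ENNReal := fun t => ENNReal.ofReal (A.indicator
    (fun x => (∑ j, (h x (t.2 j) - ∫ ω', h x (ξ 0 ω') ∂P)) ^ 2) t.1)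
  have hΦ : Measurable Φ := by
    have h1 : Measurable fun t : α × (T → α) =>
        (∑ j, (h t.1 (t.2 j) - ∫ ω', h t.1 (ξ 0 ω') ∂P)) ^ 2 := by
      refine Measurable.pow_const (Finset.measurable_sum _ fun j _ => Measurable.sub ?_ ?_) 2
      · exact hh.comp (measurable_fst.prodMk ((measurable_pi_apply j).comp measurable_snd))
      · exact (measurable_integral_right hh (hξ 0)).comp measurable_fst
    refine Measurable.ennreal_ofReal ?_
    exact h1.indicator (measurable_fst hA)
  have hsumT : ∀ (x : α) (ω : Ω), ∑ j : T, (h x (τ ω j) - ∫ ω', h x (ξ 0 ω') ∂P) =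
      ∑ j ∈ T, (h x (ξ j ω) - ∫ ω', h x (ξ 0 ω') ∂P) := fun x ω =>
    Finset.sum_coe_sort T (fun j => h x (ξ j ω) - ∫ ω', h x (ξ 0 ω') ∂P)
  calc ∫⁻ ω, ENNReal.ofReal ((ξ i ⁻¹' A).indicator (fun ω => centredSum P ξ h n i ω ^ 2) ω) ∂P
      = ∫⁻ ω, Φ (ξ i ω, τ ω) ∂P := by
        refine lintegral_congr fun ω => ?_
        by_cases hω : ξ i ω ∈ A
        · simp only [Φ, Set.indicator_of_mem hω, hsumT]
          rw [Set.indicator_of_mem (show ω ∈ ξ i ⁻¹' A from hω), centredSum]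
        · simp only [Φ, Set.indicator_of_notMem hω]
          rw [Set.indicator_of_notMem (show ω ∉ ξ i ⁻¹' A from hω)]
    _ = ∫⁻ t, Φ t ∂(P.map fun ω => (ξ i ω, τ ω)) :=
        (lintegral_map hΦ ((hξ i).prodMk hτ)).symm
    _ = ∫⁻ x, ∫⁻ ω, Φ (x, τ ω) ∂P ∂(P.map (ξ i)) := by
        rw [hindep.map_prod_eq_prod_map_map (hξ i).aemeasurable hτ.aemeasurable,
          lintegral_prod _ hΦ.aemeasurable]
        refine lintegral_congr fun x => ?_
        exact lintegral_map (hΦ.comp measurable_prodMk_left) hτ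
    _ ≤ ∫⁻ _, ENNReal.ofReal (n * σ) ∂(P.map (ξ i)) := by
        refine lintegral_mono fun x => ?_
        by_cases hx : x ∈ A
        · simp only [Φ, Set.indicator_of_mem hx, hsumT]
          refine (integral_sq_sum_sub_le hind hid (hh.comp measurable_prodMk_left) (hL x hx)
            (hσ x hx) T).trans (ENNReal.ofReal_le_ofReal ?_)
          exact mul_le_mul_of_nonneg_right hcard hσ0
        · simp [Φ, Set.indicator_of_notMem hx]
    _ = ENNReal.ofReal (n * σ) := by
        have := Measure.isProbabilityMeasure_map (μ := P) (hξ i).aemeasurable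
        simp

/-- Markov's inequality for the average over `i` of the squared centred sums. -/
lemma measure_average_centredSum_sq_ge_le [IsProbabilityMeasure P] (hind : iIndepFun ξ P)
    (hξ : ∀ i, Measurable (ξ i)) (hid : ∀ i, IdentDistrib (ξ i) (ξ 0) P P) {h : α → α → ℝ}
    (hh : Measurable (Function.uncurry h)) {A : Set α} (hA : MeasurableSet A) {σ : ℝ}
    (hL : ∀ x ∈ A, MemLp (fun ω => h x (ξ 0 ω)) 2 P)
    (hσ : ∀ x ∈ A, ∫ ω, h x (ξ 0 ω) ^ 2 ∂P ≤ σ) (hσ0 : 0 ≤ σ) {n : ℕ} (hn : 0 < n)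
    {t : ℝ} (ht : 0 < t) :
    P {ω | n * t ≤ ∑ i ∈ Finset.range n,
      (ξ i ⁻¹' A).indicator (fun ω => centredSum P ξ h n i ω ^ 2) ω} ≤
      ENNReal.ofReal (n * σ / t) := by
  have hn' : (0 : ℝ) < n := by exact_mod_cast hn
  have hm : ∀ i, Measurable fun ω => (ξ i ⁻¹' A).indicator
      (fun ω => centredSum P ξ h n i ω ^ 2) ω := fun i =>
    ((measurable_centredSum hh hξ n i).pow_const 2).indicator (hξ i hA)
  have h0 : ∀ i ω, 0 ≤ (ξ i ⁻¹' A).indicator (fun ω => centredSum P ξ h n i ω ^ 2) ω :=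
    fun i ω => Set.indicator_nonneg (fun _ _ => sq_nonneg _) ω
  have hmarkov := mul_meas_ge_le_lintegral (μ := P)
    (Finset.measurable_sum (Finset.range n) fun i _ => (hm i).ennreal_ofReal)
    (ENNReal.ofReal (n * t))
  rw [lintegral_finsetSum _ fun i _ => (hm i).ennreal_ofReal] at hmarkov
  have hbound : ∑ i ∈ Finset.range n, ∫⁻ ω, ENNReal.ofReal
      ((ξ i ⁻¹' A).indicator (fun ω => centredSum P ξ h n i ω ^ 2) ω) ∂P ≤
      ENNReal.ofReal (n * (n * σ)) := by
    refine (Finset.sum_le_sum fun i _ =>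
      lintegral_indicator_centredSum_sq_le hind hξ hid hh hA hL hσ hσ0 n i).trans ?_
    rw [Finset.sum_const, Finset.card_range, nsmul_eq_mul, ← ENNReal.ofReal_natCast,
      ← ENNReal.ofReal_mul hn'.le]
  have hset : {ω | n * t ≤ ∑ i ∈ Finset.range n,
      (ξ i ⁻¹' A).indicator (fun ω => centredSum P ξ h n i ω ^ 2) ω} ⊆
      {ω | ENNReal.ofReal (n * t) ≤ ∑ i ∈ Finset.range n, ENNReal.ofReal
      ((ξ i ⁻¹' A).indicator (fun ω => centredSum P ξ h n i ω ^ 2) ω)} := by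
    intro ω hω
    rw [Set.mem_ofPred_eq, ← ENNReal.ofReal_sum_of_nonneg fun i _ => h0 i ω]
    exact ENNReal.ofReal_le_ofReal hω
  have hfin : P {ω | ENNReal.ofReal (n * t) ≤ ∑ i ∈ Finset.range n, ENNReal.ofReal
      ((ξ i ⁻¹' A).indicator (fun ω => centredSum P ξ h n i ω ^ 2) ω)} ≤
      ENNReal.ofReal (n * (n * σ)) / ENNReal.ofReal (n * t) := by
    have hpos : 0 < n * t := by positivity
    rw [ENNReal.le_div_iff_mul_le (Or.inl (ENNReal.ofReal_pos.2 hpos).ne')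
      (Or.inl ENNReal.ofReal_ne_top), mul_comm]
    exact hmarkov.trans hbound
  refine (measure_mono hset).trans (hfin.trans (le_of_eq ?_))
  rw [← ENNReal.ofReal_div_of_pos (by positivity), mul_div_mul_left _ _ hn'.ne']

end decoupled

/-- Markov's inequality for the maximum of `n` identically distributed variables. -/
lemma measure_exists_gt_le {Ω : Type*} [MeasurableSpace Ω] {P : Measure Ω} {Y : ℕ → Ω → ℝ}
    (hid : ∀ i, IdentDistrib (Y i) (Y 0) P P) {s : ℝ} (hs : 0 < s)
    (hint : Integrable (fun ω => |Y 0 ω| ^ s) P) {B : ℝ} (hB : 0 < B) (n : ℕ) :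
    P {ω | ∃ i < n, B * (n : ℝ) ^ (1 / s) < |Y i ω|} ≤
      ENNReal.ofReal ((∫ ω, |Y 0 ω| ^ s ∂P) / B ^ s) := by
  rcases Nat.eq_zero_or_pos n with rfl | hn
  · simp
  have hn' : (0 : ℝ) < n := by exact_mod_cast hn
  have hsub : {ω | ∃ i < n, B * (n : ℝ) ^ (1 / s) < |Y i ω|} ⊆
      ⋃ i ∈ Finset.range n, {ω | ENNReal.ofReal (B ^ s * n) ≤ ENNReal.ofReal (|Y i ω| ^ s)} := by
    rintro ω ⟨i, hi, h⟩
    refine Set.mem_biUnion (Finset.mem_coe.2 (Finset.mem_range.2 hi)) ?_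
    refine ENNReal.ofReal_le_ofReal ?_
    have := Real.rpow_le_rpow (by positivity) h.le hs.le
    rwa [Real.mul_rpow hB.le (by positivity), ← Real.rpow_mul hn'.le, one_div_mul_cancel hs.ne',
      Real.rpow_one] at this
  have hm : Measurable fun y : ℝ => ENNReal.ofReal (|y| ^ s) := by fun_prop
  have hE : ∫⁻ ω, ENNReal.ofReal (|Y 0 ω| ^ s) ∂P = ENNReal.ofReal (∫ ω, |Y 0 ω| ^ s ∂P) :=
    (ofReal_integral_eq_lintegral_ofReal hint (ae_of_all _ fun ω => by positivity)).symm
  refine (measure_mono hsub).trans ((measure_biUnion_finset_le _ _).trans ?_)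
  have h1 : ∀ i ∈ Finset.range n,
      P {ω | ENNReal.ofReal (B ^ s * n) ≤ ENNReal.ofReal (|Y i ω| ^ s)} ≤
      ENNReal.ofReal ((∫ ω, |Y 0 ω| ^ s ∂P) / (B ^ s * n)) := by
    intro i _
    have hpos : 0 < B ^ s * n := by positivity
    rw [ENNReal.ofReal_div_of_pos hpos, ENNReal.le_div_iff_mul_le
      (Or.inl (by simpa using hpos)) (Or.inl (by simp)), mul_comm, ← hE]
    refine le_trans ?_ ((hid i).comp hm).lintegral_eq.le
    exact mul_meas_ge_le_lintegral₀ (hm.comp_aemeasurable (hid i).aemeasurable_fst) _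
  refine (Finset.sum_le_sum h1).trans (le_of_eq ?_)
  rw [Finset.sum_const, Finset.card_range, nsmul_eq_mul, ← ENNReal.ofReal_natCast,
    ← ENNReal.ofReal_mul hn'.le]
  congr 1
  field_simp

lemma tendstoInMeasure_average {Ω α : Type*} [MeasurableSpace Ω] [MeasurableSpace α]
    {P : Measure Ω} [IsProbabilityMeasure P] {ξ : ℕ → Ω → α} (hind : iIndepFun ξ P)
    (hid : ∀ i, IdentDistrib (ξ i) (ξ 0) P P) {f : α → ℝ} (hf : Measurable f)
    (hint : Integrable (fun ω => f (ξ 0 ω)) P) :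
    TendstoInMeasure P (fun (n : ℕ) ω => (∑ i ∈ Finset.range n, f (ξ i ω)) / n) atTop
      fun _ => ∫ ω, f (ξ 0 ω) ∂P := by
  have hae := strong_law_ae_real (fun i ω => f (ξ i ω)) hint
    (fun i j hij => (hind.indepFun hij).comp hf hf) (fun i => (hid i).comp hf)
  refine tendstoInMeasure_of_tendsto_ae (fun n => ?_) hae
  have h : ∀ i, AEMeasurable (fun ω => f (ξ i ω)) P := fun i =>
    hf.comp_aemeasurable (hid i).aemeasurable_fst
  exact ((Finset.aemeasurable_fun_sum _ fun i _ => h i).div_const _).aestronglyMeasurable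

/-! ### Moments of the kernel weights -/

/-- Bounded functions that are measurable for the conditioning sigma-algebra see only the
conditional expectation. -/
lemma integral_mul_eq_integral_condExp_mul {Ω : Type*} {m m0 : MeasurableSpace Ω} {P : Measure Ω}
    [IsFiniteMeasure P] (hm : m ≤ m0) {f g : Ω → ℝ} (hf : Integrable f P)
    (hg : StronglyMeasurable[m] g) {B : ℝ} (hB : ∀ ω, |g ω| ≤ B) :
    ∫ ω, f ω * g ω ∂P = ∫ ω, (P[f | m]) ω * g ω ∂P := by
  have hfg : Integrable (f * g) P :=
    hf.mul_bdd (c := B) (hg.mono hm).aestronglyMeasurable (ae_of_all _ hB)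
  have := condExp_mul_of_stronglyMeasurable_right hg hfg hf
  rw [← integral_condExp hm (f := fun ω => f ω * g ω)]
  exact integral_congr_ae this

/-- The product kernel weight of an observation with covariates `p` at the control value of `q`. -/
noncomputable def kernelWeight {dx dz dw : ℕ} (κ : Kernel (Vec dx × Vec dz) (Fin dw → ℝ))
    (ν : Measure (Fin dw → ℝ)) (KX : Vec dx → ℝ) (L : ℝ → ℝ) (x₀ : Vec dx) (b : ℝ)
    (p q : Vec dx × Vec dz) : ℝ :=
  KX (b⁻¹ • (p.1 - x₀)) * L (l2Norm ν (controlCDF κ p - controlCDF κ q) / b)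

section weights

variable {dx dz dw : ℕ} {κ : Kernel (Vec dx × Vec dz) (Fin dw → ℝ)} [IsMarkovKernel κ]
  {ν : Measure (Fin dw → ℝ)} [IsFiniteMeasure ν] {KX : Vec dx → ℝ} {L : ℝ → ℝ} {x₀ : Vec dx}
  {b : ℝ}

lemma measurable_kernelWeight (hKX : Measurable KX) (hL : Measurable L) :
    Measurable fun t : (Vec dx × Vec dz) × (Vec dx × Vec dz) =>
      kernelWeight κ ν KX L x₀ b t.1 t.2 := by
  have h₁ : Measurable fun t : (Vec dx × Vec dz) × (Vec dx × Vec dz) => b⁻¹ • (t.1.1 - x₀) :=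
    ((measurable_fst.comp measurable_fst).sub_const x₀).const_smul b⁻¹
  have h₂ := (measurable_l2Norm_controlCDF_sub κ ν).div_const b
  exact (hKX.comp h₁).mul (hL.comp h₂)

lemma measurable_kernelWeight_left (hKX : Measurable KX) (hL : Measurable L)
    (q : Vec dx × Vec dz) : Measurable fun p => kernelWeight κ ν KX L x₀ b p q := by
  have h := (measurable_kernelWeight (κ := κ) (ν := ν) (x₀ := x₀) (b := b) hKX hL).comp
    (measurable_prodMk_right (y := q))
  exact h

omit [IsMarkovKernel κ] [IsFiniteMeasure ν] in
lemma kernelWeight_nonneg (hKX : ∀ u, 0 ≤ KX u) (hL : ∀ u, 0 ≤ L u) (p q : Vec dx × Vec dz) :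
    0 ≤ kernelWeight κ ν KX L x₀ b p q :=
  mul_nonneg (hKX _) (hL _)

omit [IsMarkovKernel κ] [IsFiniteMeasure ν] in
lemma kernelWeight_le {B₁ B₂ : ℝ} (hKX : ∀ u, 0 ≤ KX u) (hL : ∀ u, 0 ≤ L u)
    (hB₁ : ∀ u, KX u ≤ B₁) (hB₂ : ∀ u, L u ≤ B₂) (p q : Vec dx × Vec dz) :
    kernelWeight κ ν KX L x₀ b p q ≤ B₁ * B₂ :=
  mul_le_mul (hB₁ _) (hB₂ _) (hL _) ((hKX 0).trans (hB₁ 0))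

variable {Ω : Type*} {mΩ : MeasurableSpace Ω} {P : Measure Ω} [IsProbabilityMeasure P] {Y : Ω → ℝ}
  {X : Ω → Vec dx} {Z : Ω → Vec dz}

omit mΩ in
/-- The kernel weight at a fixed control value is measurable for the sigma-algebra of `(X, V)`, so
that the weighted regression residual has mean zero. -/
lemma measurable_comap_kernelWeight (hKX : Measurable KX) (hL : Measurable L)
    (q : Vec dx × Vec dz) :
    Measurable[MeasurableSpace.comap (fun ω => (X ω, controlVar κ X Z ω)) inferInstance]
      fun ω => kernelWeight κ ν KX L x₀ b (X ω, Z ω) q := by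
  let _ : MeasurableSpace Ω :=
    MeasurableSpace.comap (fun ω => (X ω, controlVar κ X Z ω)) inferInstance
  have hXV : Measurable fun ω => (X ω, controlVar κ X Z ω) := comap_measurable _
  have hX : Measurable X := measurable_fst.comp hXV
  have hV : Measurable (controlVar κ X Z) := measurable_snd.comp hXV
  have hl : Measurable fun ω => l2Norm ν (controlVar κ X Z ω - controlCDF κ q) :=
    (measurable_comap_l2Norm_controlVar κ ν X Z q).mono hV.comap_le le_rfl
  exact (hKX.comp ((hX.sub_const x₀).const_smul b⁻¹)).mul (hL.comp (hl.div_const b))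

lemma integral_residual_mul_kernelWeight (hX : Measurable X) (hZ : Measurable Z)
    (hKX : Measurable KX) (hL : Measurable L) {B : ℝ}
    (hB : ∀ p q, |kernelWeight κ ν KX L x₀ b p q| ≤ B) (hY : Integrable Y P)
    {m : Vec dx → ProxyFun dw → ℝ} (hm : IsRegression P Y X (controlVar κ X Z) m)
    (q : Vec dx × Vec dz) :
    ∫ ω, (Y ω - m (X ω) (controlVar κ X Z ω)) * kernelWeight κ ν KX L x₀ b (X ω, Z ω) q ∂P = 0 := by
  have hV : Measurable (controlVar κ X Z) := (measurable_controlCDF κ).comp (hX.prodMk hZ)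
  have hle := (hX.prodMk hV).comap_le
  have hw := (measurable_comap_kernelWeight (κ := κ) (ν := ν) (x₀ := x₀) (b := b) (X := X) (Z := Z)
    hKX hL q)
  have hmint : Integrable (fun ω => m (X ω) (controlVar κ X Z ω)) P :=
    integrable_condExp.congr hm.2
  have hbdd : ∀ f : Ω → ℝ, Integrable f P →
      Integrable (fun ω => f ω * kernelWeight κ ν KX L x₀ b (X ω, Z ω) q) P := fun f hf =>
    hf.mul_bdd (c := B) (hw.mono hle le_rfl).aestronglyMeasurable (ae_of_all _ fun ω => hB _ _)
  simp only [sub_mul]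
  rw [integral_sub (hbdd _ hY) (hbdd _ hmint),
    integral_mul_eq_integral_condExp_mul hle hY hw.stronglyMeasurable (fun ω => hB _ _),
    sub_eq_zero]
  refine integral_congr_ae ?_
  filter_upwards [hm.2] with ω hω
  rw [hω]

lemma integral_kernelWeight_sq_le (hX : Measurable X) (hZ : Measurable Z)
    (hKX : Measurable KX) (hL : Measurable L) (hKX0 : ∀ u, 0 ≤ KX u) (hL0 : ∀ u, 0 ≤ L u) {B : ℝ}
    (hB : ∀ p q, kernelWeight κ ν KX L x₀ b p q ≤ B) (q : Vec dx × Vec dz) :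
    MemLp (fun ω => kernelWeight κ ν KX L x₀ b (X ω, Z ω) q) 2 P ∧
    ∫ ω, kernelWeight κ ν KX L x₀ b (X ω, Z ω) q ^ 2 ∂P ≤
      B * smallBall P ν X (controlVar κ X Z) KX L x₀ b (controlCDF κ q) := by
  have hmeas : Measurable fun ω => kernelWeight κ ν KX L x₀ b (X ω, Z ω) q :=
    (measurable_kernelWeight_left hKX hL q).comp (hX.prodMk hZ)
  have h0 : ∀ p, 0 ≤ kernelWeight κ ν KX L x₀ b p q := fun p => kernelWeight_nonneg hKX0 hL0 p q
  have hLp : MemLp (fun ω => kernelWeight κ ν KX L x₀ b (X ω, Z ω) q) 2 P :=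
    MemLp.of_bound hmeas.aestronglyMeasurable B
      (ae_of_all _ fun ω => by rw [Real.norm_eq_abs, abs_of_nonneg (h0 _)]; exact hB _ _)
  refine ⟨hLp, ?_⟩
  change _ ≤ B * ∫ ω, kernelWeight κ ν KX L x₀ b (X ω, Z ω) q ∂P
  rw [← integral_const_mul]
  refine integral_mono hLp.integrable_sq ((hLp.integrable (by norm_num)).const_mul B) fun ω => ?_
  simp only [sq]
  exact mul_le_mul_of_nonneg_right (hB _ _) (h0 _)

/-- The conditional moment bound carries over to expectations weighted by functions of the
covariates. -/
lemma integral_abs_rpow_mul_kernelWeight_le (hX : Measurable X) (hZ : Measurable Z)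
    (hKX : Measurable KX) (hL : Measurable L) (hKX0 : ∀ u, 0 ≤ KX u) (hL0 : ∀ u, 0 ≤ L u) {B : ℝ}
    (hB : ∀ p q, kernelWeight κ ν KX L x₀ b p q ≤ B) {s C : ℝ}
    (hs : Integrable (fun ω => |Y ω| ^ s) P)
    (hC : ∀ᵐ ω ∂P, (P[fun ω => |Y ω| ^ s |
      MeasurableSpace.comap (fun ω => (X ω, Z ω)) inferInstance]) ω ≤ C) (q : Vec dx × Vec dz) :
    ∫ ω, |Y ω| ^ s * kernelWeight κ ν KX L x₀ b (X ω, Z ω) q ∂P ≤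
      C * smallBall P ν X (controlVar κ X Z) KX L x₀ b (controlCDF κ q) := by
  have hp : Measurable fun ω => (X ω, Z ω) := hX.prodMk hZ
  have h0 : ∀ p, 0 ≤ kernelWeight κ ν KX L x₀ b p q := fun p => kernelWeight_nonneg hKX0 hL0 p q
  have habs : ∀ p, |kernelWeight κ ν KX L x₀ b p q| ≤ B := fun p => by
    rw [abs_of_nonneg (h0 p)]; exact hB p q
  have hmeas : Measurable fun p => kernelWeight κ ν KX L x₀ b p q :=
    measurable_kernelWeight_left hKX hL q
  have hw : StronglyMeasurable[MeasurableSpace.comap (fun ω => (X ω, Z ω)) inferInstance]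
      fun ω => kernelWeight κ ν KX L x₀ b (X ω, Z ω) q :=
    (hmeas.comp (comap_measurable _)).stronglyMeasurable
  rw [integral_mul_eq_integral_condExp_mul hp.comap_le hs hw (fun ω => habs _)]
  change _ ≤ C * ∫ ω, kernelWeight κ ν KX L x₀ b (X ω, Z ω) q ∂P
  rw [← integral_const_mul]
  have hbdd : ∀ f : Ω → ℝ, Integrable f P →
      Integrable (fun ω => f ω * kernelWeight κ ν KX L x₀ b (X ω, Z ω) q) P := fun f hf =>
    hf.mul_bdd (c := B) (hmeas.comp hp).aestronglyMeasurable (ae_of_all _ fun ω => habs _)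
  refine integral_mono_ae (hbdd _ integrable_condExp) (hbdd _ (integrable_const C)) ?_
  filter_upwards [hC] with ω hω
  exact mul_le_mul_of_nonneg_right hω (h0 _)

/-- Second moment of the weighted regression residual, when the regression function `r` is bounded
on the support of the weight. -/
lemma integral_residual_mul_kernelWeight_sq_le (hX : Measurable X) (hZ : Measurable Z)
    (hKX : Measurable KX) (hL : Measurable L) (hKX0 : ∀ u, 0 ≤ KX u) (hL0 : ∀ u, 0 ≤ L u) {B : ℝ}
    (hB : ∀ p q, kernelWeight κ ν KX L x₀ b p q ≤ B) (hY : Measurable Y) {s C : ℝ} (hs2 : 2 < s)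
    (hs : Integrable (fun ω => |Y ω| ^ s) P)
    (hC : ∀ᵐ ω ∂P, (P[fun ω => |Y ω| ^ s |
      MeasurableSpace.comap (fun ω => (X ω, Z ω)) inferInstance]) ω ≤ C)
    {r : Ω → ℝ} (hr : Measurable r) {K : ℝ} (q : Vec dx × Vec dz)
    (hK : ∀ᵐ ω ∂P, kernelWeight κ ν KX L x₀ b (X ω, Z ω) q ≠ 0 → |r ω| ≤ K) :
    MemLp (fun ω => (Y ω - r ω) * kernelWeight κ ν KX L x₀ b (X ω, Z ω) q) 2 P ∧
    ∫ ω, ((Y ω - r ω) * kernelWeight κ ν KX L x₀ b (X ω, Z ω) q) ^ 2 ∂P ≤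
      B * (2 * (1 + C) + 2 * K ^ 2) *
        smallBall P ν X (controlVar κ X Z) KX L x₀ b (controlCDF κ q) := by
  set w : Ω → ℝ := fun ω => kernelWeight κ ν KX L x₀ b (X ω, Z ω) q with hw
  have h0 : ∀ ω, 0 ≤ w ω := fun ω => kernelWeight_nonneg hKX0 hL0 _ q
  have hwB : ∀ ω, w ω ≤ B := fun ω => hB _ q
  have hmeas : Measurable w := (measurable_kernelWeight_left hKX hL q).comp (hX.prodMk hZ)
  have hB0 : 0 ≤ B := (kernelWeight_nonneg hKX0 hL0 q q).trans (hB q q)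
  have hsw : Integrable (fun ω => |Y ω| ^ s * w ω) P :=
    hs.mul_bdd (c := B) hmeas.aestronglyMeasurable
      (ae_of_all _ fun ω => by rw [Real.norm_eq_abs, abs_of_nonneg (h0 ω)]; exact hwB ω)
  have hwint : Integrable w P :=
    Integrable.of_bound hmeas.aestronglyMeasurable B
      (ae_of_all _ fun ω => by rw [Real.norm_eq_abs, abs_of_nonneg (h0 ω)]; exact hwB ω)
  have hpt : ∀ᵐ ω ∂P, ((Y ω - r ω) * w ω) ^ 2 ≤
      B * (2 * (w ω + |Y ω| ^ s * w ω) + 2 * K ^ 2 * w ω) := by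
    filter_upwards [hK] with ω hω
    by_cases hz : w ω = 0
    · simp [hz]
    have h1 : Y ω ^ 2 ≤ 1 + |Y ω| ^ s := by
      rw [← sq_abs, ← Real.rpow_natCast]
      rcases le_total |Y ω| 1 with h | h
      · have := Real.rpow_le_one (abs_nonneg (Y ω)) h (z := ((2 : ℕ) : ℝ)) (by norm_num)
        have h2 : 0 ≤ |Y ω| ^ s := by positivity
        linarith
      · have := Real.rpow_le_rpow_of_exponent_le h (y := ((2 : ℕ) : ℝ)) (z := s)
          (by push_cast; linarith)
        linarith
    have h2 : r ω ^ 2 ≤ K ^ 2 := by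
      rw [← sq_abs]
      exact pow_le_pow_left₀ (abs_nonneg _) (hω hz) 2
    have h3 : (Y ω - r ω) ^ 2 ≤ 2 * (1 + |Y ω| ^ s) + 2 * K ^ 2 := by
      nlinarith [sq_nonneg (Y ω + r ω)]
    have h4 : w ω ^ 2 ≤ B * w ω := by
      rw [sq]; exact mul_le_mul_of_nonneg_right (hwB ω) (h0 ω)
    calc ((Y ω - r ω) * w ω) ^ 2 = (Y ω - r ω) ^ 2 * w ω ^ 2 := by ring
      _ ≤ (2 * (1 + |Y ω| ^ s) + 2 * K ^ 2) * (B * w ω) :=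
          mul_le_mul h3 h4 (sq_nonneg _) (by positivity)
      _ = _ := by ring
  have hint : Integrable (fun ω => B * (2 * (w ω + |Y ω| ^ s * w ω) + 2 * K ^ 2 * w ω)) P :=
    (((hwint.add hsw).const_mul 2).add (hwint.const_mul _)).const_mul B
  have hmeas2 : Measurable fun ω => (Y ω - r ω) * w ω := (hY.sub hr).mul hmeas
  have hsq : Integrable (fun ω => ((Y ω - r ω) * w ω) ^ 2) P := by
    refine hint.mono (hmeas2.pow_const 2).aestronglyMeasurable ?_
    filter_upwards [hpt] with ω hω
    rw [Real.norm_eq_abs, Real.norm_eq_abs, abs_of_nonneg (sq_nonneg _)]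
    exact hω.trans (le_abs_self _)
  refine ⟨(memLp_two_iff_integrable_sq hmeas2.aestronglyMeasurable).2 hsq, ?_⟩
  refine (integral_mono_ae hsq hint hpt).trans ?_
  have hb := integral_abs_rpow_mul_kernelWeight_le (Y := Y) hX hZ hKX hL hKX0 hL0 hB hs hC q
  have hE : smallBall P ν X (controlVar κ X Z) KX L x₀ b (controlCDF κ q) = ∫ ω, w ω ∂P := rfl
  have hsum : Integrable (fun ω => 2 * (w ω + |Y ω| ^ s * w ω)) P := (hwint.add hsw).const_mul 2
  rw [integral_const_mul, integral_add hsum (hwint.const_mul _),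
    integral_const_mul, integral_add hwint hsw, integral_const_mul, hE]
  rw [hE] at hb
  have : ∫ ω, |Y ω| ^ s * w ω ∂P ≤ C * ∫ ω, w ω ∂P := hb
  calc _ ≤ B * (2 * (∫ ω, w ω ∂P + C * ∫ ω, w ω ∂P) + 2 * K ^ 2 * ∫ ω, w ω ∂P) := by gcongr
    _ = _ := by ring

end weights

/-! ### The error of the kernel regression at one observation -/

section pointwise

variable {dx dz dw : ℕ} {κ : Kernel (Vec dx × Vec dz) (Fin dw → ℝ)} [IsMarkovKernel κ]
  {ν : Measure (Fin dw → ℝ)} [IsFiniteMeasure ν] {KX : Vec dx → ℝ} {KV : ℝ → ℝ} {x₀ : Vec dx}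
  {η b B' R U M e Δ : ℝ} {y : ℕ → ℝ} {p : ℕ → Vec dx × Vec dz}
  {F : Vec dx × Vec dz → ProxyFun dw} {m : Vec dx → ProxyFun dw → ℝ} {n i : ℕ}

/-- The deterministic comparison of the feasible kernel regression, which uses the estimated control
values `F (p j)`, with the regression function: the first-stage error `Δ` enters through
`2 * Δ / b` times the sum of the weights formed with the local supremum of `|KV'|`. -/
lemma abs_kernelRegression_sub_le (hi : i < n) (hF : ∀ q, MemLp (F q) 2 ν)
    (hΔ : ∀ j < n, l2Norm ν (F (p j) - controlCDF κ (p j)) ≤ Δ) (hy : ∀ j < n, |y j| ≤ U)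
    (hKX0 : ∀ u, 0 ≤ KX u) (hKV0 : ∀ u, 0 ≤ KV u)
    (hKV : ContDiff ℝ 1 KV) (hB' : ∀ u, |deriv KV u| ≤ B') (hRX : ∀ u, KX u ≠ 0 → ‖u‖ ≤ R)
    (hRV : ∀ u, KV u ≠ 0 → ‖u‖ ≤ R) (hb : 0 < b) (hη : 2 * Δ / b ≤ η)
    (hcont : ∀ j < n, ‖(p j).1 - x₀‖ ≤ R * b →
      l2Norm ν (controlCDF κ (p j) - controlCDF κ (p i)) ≤ R * b + 2 * Δ →
      |m (p j).1 (controlCDF κ (p j)) - m x₀ (controlCDF κ (p i))| ≤ e)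
    (hM : |m x₀ (controlCDF κ (p i))| ≤ M) (hU : 0 ≤ U) (he : 0 ≤ e) {L H : ℝ} (hL : 0 < L)
    (hLw : L ≤ ∑ j ∈ Finset.range n, kernelWeight κ ν KX KV x₀ b (p j) (p i))
    (hH : ∑ j ∈ Finset.range n, kernelWeight κ ν KX (kernelBar KV η) x₀ b (p j) (p i) ≤ H)
    (hτH : 2 * Δ / b * H ≤ L / 2) :
    |kernelRegression ν KX KV b n y (fun j => (p j).1) (fun j => F (p j)) x₀ (F (p i)) -
        m x₀ (controlCDF κ (p i))| ≤
      e + 2 / L * (|∑ j ∈ Finset.range n, (y j - m (p j).1 (controlCDF κ (p j))) *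
        kernelWeight κ ν KX KV x₀ b (p j) (p i)| + (U + M + e) * (2 * Δ / b * H)) := by
  have hΔ0 : 0 ≤ Δ := (l2Norm_nonneg ν _).trans (hΔ i hi)
  have hdist : ∀ j < n, |l2Norm ν (F (p j) - F (p i)) -
      l2Norm ν (controlCDF κ (p j) - controlCDF κ (p i))| ≤ 2 * Δ := fun j hj => by
    have := abs_l2Norm_sub_sub_le (memLp_controlCDF κ ν (p j)) (hF (p j))
      (memLp_controlCDF κ ν (p i)) (hF (p i))
    linarith [hΔ j hj, hΔ i hi]
  have hdistb : ∀ j < n, |l2Norm ν (F (p j) - F (p i)) / b -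
      l2Norm ν (controlCDF κ (p j) - controlCDF κ (p i)) / b| ≤ 2 * Δ / b := fun j hj => by
    rw [← sub_div, abs_div, abs_of_pos hb]
    exact div_le_div_of_nonneg_right (hdist j hj) hb.le
  rw [kernelRegression]
  simp only [mul_assoc]
  refine abs_weighted_average_sub_le
    (w := fun j => kernelWeight κ ν KX KV x₀ b (p j) (p i))
    (wb := fun j => kernelWeight κ ν KX (kernelBar KV η) x₀ b (p j) (p i))
    (r := fun j => m (p j).1 (controlCDF κ (p j)))
    (fun j _ => mul_nonneg (hKX0 _) (hKV0 _)) (fun j hj => ?_) (by positivity) (fun j hj h => ?_)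
    (fun j hj => hy j (Finset.mem_range.1 hj)) hM hU he hL hLw hH
    hτH
  · have hj' := Finset.mem_range.1 hj
    simp only [kernelWeight]
    rw [← mul_sub, abs_mul, abs_of_nonneg (hKX0 _), mul_left_comm]
    refine mul_le_mul_of_nonneg_left ?_ (hKX0 _)
    refine (abs_sub_le_kernelBar hKV hB' ((hdistb j hj').trans hη)).trans ?_
    rw [mul_comm]
    refine mul_le_mul_of_nonneg_right ?_ (kernelBar_nonneg _ _ _)
    exact (hdistb j hj').trans (by rw [mul_div_assoc])
  · have hj' := Finset.mem_range.1 hj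
    -- a nonzero weight, estimated or not, localizes both the covariate and the control value
    have hx : KX (b⁻¹ • ((p j).1 - x₀)) ≠ 0 := by
      rcases h with h | h
      · exact left_ne_zero_of_mul h
      · exact left_ne_zero_of_mul h
    have hx' : ‖(p j).1 - x₀‖ ≤ R * b := by
      have := hRX _ hx
      rwa [norm_smul, norm_inv, Real.norm_eq_abs, abs_of_pos hb, inv_mul_le_iff₀ hb,
        mul_comm] at this
    refine hcont j hj' hx' ?_
    have hV : ∀ t, KV (t / b) ≠ 0 → t ≤ R * b := fun t ht => by
      have := hRV _ ht
      rw [norm_div, Real.norm_eq_abs, Real.norm_eq_abs, abs_of_pos hb, div_le_iff₀ hb] at this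
      exact (le_abs_self t).trans this
    have hd := abs_le.1 (hdist j hj')
    rcases h with h | h
    · have := hV _ (right_ne_zero_of_mul h)
      linarith
    · have := hV _ (right_ne_zero_of_mul h)
      linarith

/-- If the centred sums `D₂` and `D₃` of the weights are small, the denominator of the kernel
regression is of its expected order and the regression error is governed by the noise term `D₁`;
otherwise the crude bound `U + M` is charged to `D₂ ^ 2` and `D₃ ^ 2`. -/
lemma abs_kernelRegression_sub_le_sq (hi : i < n) (hF : ∀ q, MemLp (F q) 2 ν)
    (hΔ : ∀ j < n, l2Norm ν (F (p j) - controlCDF κ (p j)) ≤ Δ) (hy : ∀ j < n, |y j| ≤ U)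
    (hKX0 : ∀ u, 0 ≤ KX u) (hKV0 : ∀ u, 0 ≤ KV u)
    (hKV : ContDiff ℝ 1 KV) (hB' : ∀ u, |deriv KV u| ≤ B') (hRX : ∀ u, KX u ≠ 0 → ‖u‖ ≤ R)
    (hRV : ∀ u, KV u ≠ 0 → ‖u‖ ≤ R) (hb : 0 < b) (hη : 2 * Δ / b ≤ η)
    (hcont : ∀ j < n, ‖(p j).1 - x₀‖ ≤ R * b →
      l2Norm ν (controlCDF κ (p j) - controlCDF κ (p i)) ≤ R * b + 2 * Δ →
      |m (p j).1 (controlCDF κ (p j)) - m x₀ (controlCDF κ (p i))| ≤ e)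
    (hM : |m x₀ (controlCDF κ (p i))| ≤ M) (hU : 0 ≤ U) (he : 0 < e)
    {D₁ D₂ D₃ E₁ E₂ Bw a c C₂ : ℝ} (ha : 0 < a) (hc : 0 < c) (hC₂ : 0 ≤ C₂)
    (hD₁ : ∑ j ∈ (Finset.range n).erase i, (y j - m (p j).1 (controlCDF κ (p j))) *
      kernelWeight κ ν KX KV x₀ b (p j) (p i) = D₁)
    (hD₂ : ∑ j ∈ (Finset.range n).erase i,
      (kernelWeight κ ν KX KV x₀ b (p j) (p i) - E₁) = D₂)
    (hD₃ : ∑ j ∈ (Finset.range n).erase i,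
      (kernelWeight κ ν KX (kernelBar KV η) x₀ b (p j) (p i) - E₂) = D₃)
    (hE₁ : c * a ≤ n * E₁) (hE₁B : E₁ ≤ Bw) (hE₂0 : 0 ≤ E₂) (hE₂ : n * E₂ ≤ C₂ * a)
    (hBw : ∀ q q', kernelWeight κ ν KX KV x₀ b q q' ≤ Bw)
    (hBw' : ∀ q q', kernelWeight κ ν KX (kernelBar KV η) x₀ b q q' ≤ Bw)
    (hBwa : Bw ≤ a) (hBwc : Bw ≤ c * a / 4) (hτ : 2 * Δ / b * (C₂ + 2) ≤ c / 4) :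
    |kernelRegression ν KX KV b n y (fun j => (p j).1) (fun j => F (p j)) x₀ (F (p i)) -
        m x₀ (controlCDF κ (p i))| ≤
      e + 4 / c * (e + (U + M + e) * (Bw / a + 2 * Δ / b * (C₂ + 2))) +
        4 / (c * e) * (D₁ ^ 2 / a ^ 2) +
        (U + M) * (16 / c ^ 2 * (D₂ ^ 2 / a ^ 2) + D₃ ^ 2 / a ^ 2) := by
  have hΔ0 : 0 ≤ Δ := (l2Norm_nonneg ν _).trans (hΔ i hi)
  have hM0 : 0 ≤ M := (abs_nonneg _).trans hM
  have hin : i ∈ Finset.range n := Finset.mem_range.2 hi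
  have hw0 : ∀ q q', 0 ≤ kernelWeight κ ν KX KV x₀ b q q' := kernelWeight_nonneg hKX0 hKV0
  have hwb0 : ∀ q q', 0 ≤ kernelWeight κ ν KX (kernelBar KV η) x₀ b q q' :=
    kernelWeight_nonneg hKX0 (kernelBar_nonneg _ _)
  have hBw0 : 0 ≤ Bw := (hw0 (p i) (p i)).trans (hBw _ _)
  have hcard : (((Finset.range n).erase i).card : ℝ) = n - 1 := by
    rw [Finset.card_erase_of_mem hin, Finset.card_range, Nat.cast_sub (by omega), Nat.cast_one]
  rw [Finset.sum_sub_distrib, Finset.sum_const, nsmul_eq_mul, hcard] at hD₂ hD₃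
  have hsplit : ∀ f : ℕ → ℝ, ∑ j ∈ Finset.range n, f j =
      f i + ∑ j ∈ (Finset.range n).erase i, f j := fun f =>
    (Finset.add_sum_erase _ _ hin).symm
  set τ := 2 * Δ / b with hτdef
  have hτ0 : 0 ≤ τ := by positivity
  by_cases hgood : |D₂| ≤ c * a / 4 ∧ |D₃| ≤ a
  · have hg2 := abs_le.1 hgood.1
    have hg3 := abs_le.1 hgood.2
    have hLw : c * a / 2 ≤ ∑ j ∈ Finset.range n, kernelWeight κ ν KX KV x₀ b (p j) (p i) := by
      rw [hsplit]
      have := hw0 (p i) (p i)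
      linarith
    have hH : ∑ j ∈ Finset.range n, kernelWeight κ ν KX (kernelBar KV η) x₀ b (p j) (p i) ≤
        (C₂ + 2) * a := by
      rw [hsplit]
      have := hBw' (p i) (p i)
      linarith
    have hτH : τ * ((C₂ + 2) * a) ≤ c * a / 2 / 2 := by
      have := mul_le_mul_of_nonneg_right hτ ha.le
      linarith
    have hmain := abs_kernelRegression_sub_le (x₀ := x₀) hi hF hΔ hy hKX0 hKV0 hKV hB' hRX hRV hb
      hη hcont hM hU he.le (by positivity) hLw hH hτH
    refine hmain.trans ?_
    have hdiag : |(y i - m (p i).1 (controlCDF κ (p i))) *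
        kernelWeight κ ν KX KV x₀ b (p i) (p i)| ≤ (U + M + e) * Bw := by
      rw [abs_mul, abs_of_nonneg (hw0 _ _)]
      by_cases hz : kernelWeight κ ν KX KV x₀ b (p i) (p i) = 0
      · rw [hz, mul_zero]
        positivity
      refine mul_le_mul ?_ (hBw _ _) (hw0 _ _) (by positivity)
      have hx : ‖(p i).1 - x₀‖ ≤ R * b := by
        have := hRX _ (left_ne_zero_of_mul hz)
        rwa [norm_smul, norm_inv, Real.norm_eq_abs, abs_of_pos hb, inv_mul_le_iff₀ hb,
          mul_comm] at this
      have h1 := hcont i hi hx (by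
        have h0 : l2Norm ν (controlCDF κ (p i) - controlCDF κ (p i)) = 0 := by
          simp [l2Norm]
        rw [h0]
        have := (norm_nonneg _).trans hx
        linarith)
      have h2 := abs_sub_abs_le_abs_sub (m (p i).1 (controlCDF κ (p i)))
        (m x₀ (controlCDF κ (p i)))
      have h3 := abs_sub (y i) (m (p i).1 (controlCDF κ (p i)))
      have h4 := hy i hi
      linarith
    have hsum : |∑ j ∈ Finset.range n, (y j - m (p j).1 (controlCDF κ (p j))) *
        kernelWeight κ ν KX KV x₀ b (p j) (p i)| ≤ (U + M + e) * Bw + |D₁| := by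
      rw [hsplit, hD₁]
      exact (abs_add_le _ _).trans (add_le_add hdiag le_rfl)
    -- `t ≤ e + t ^ 2 / e` replaces the noise term by its square
    have hD1 : |D₁| / a ≤ e + D₁ ^ 2 / a ^ 2 / e := by
      have h1 : D₁ ^ 2 / a ^ 2 = (|D₁| / a) ^ 2 := by rw [div_pow, sq_abs]
      rw [h1]
      set t := |D₁| / a
      have : 0 ≤ t := by positivity
      rw [← sub_le_iff_le_add', le_div_iff₀ he]
      linarith [sq_nonneg (t - e), mul_nonneg this he.le, sq_nonneg e,
        (by ring : (t - e) ^ 2 + t * e = t ^ 2 - (t - e) * e)]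
    calc e + 2 / (c * a / 2) * (|∑ j ∈ Finset.range n, (y j - m (p j).1 (controlCDF κ (p j))) *
          kernelWeight κ ν KX KV x₀ b (p j) (p i)| + (U + M + e) * (τ * ((C₂ + 2) * a)))
        ≤ e + 2 / (c * a / 2) * (((U + M + e) * Bw + |D₁|) +
          (U + M + e) * (τ * ((C₂ + 2) * a))) := by gcongr
      _ = e + 4 / c * (|D₁| / a + (U + M + e) * (Bw / a + τ * (C₂ + 2))) := by
          field_simp
          ring
      _ ≤ e + 4 / c * ((e + D₁ ^ 2 / a ^ 2 / e) + (U + M + e) * (Bw / a + τ * (C₂ + 2))) := by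
          gcongr
      _ = e + 4 / c * (e + (U + M + e) * (Bw / a + τ * (C₂ + 2))) +
        4 / (c * e) * (D₁ ^ 2 / a ^ 2) := by
          field_simp
          ring
      _ ≤ _ := by
          refine le_add_of_nonneg_right ?_
          positivity
  · have hcrude : |kernelRegression ν KX KV b n y (fun j => (p j).1) (fun j => F (p j)) x₀
        (F (p i)) - m x₀ (controlCDF κ (p i))| ≤ U + M := by
      refine (abs_sub _ _).trans (add_le_add ?_ hM)
      rw [kernelRegression]
      simp only [mul_assoc]
      exact abs_weighted_average_le (fun j _ => mul_nonneg (hKX0 _) (hKV0 _))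
        (fun j hj => hy j (Finset.mem_range.1 hj)) hU
    have hone : 1 ≤ 16 / c ^ 2 * (D₂ ^ 2 / a ^ 2) + D₃ ^ 2 / a ^ 2 := by
      rw [not_and_or, not_le, not_le] at hgood
      rcases hgood with h | h
      · have h1 : (c * a / 4) ^ 2 ≤ D₂ ^ 2 := by
          rw [← sq_abs D₂]
          exact pow_le_pow_left₀ (by positivity) h.le 2
        have h2 : 1 ≤ 16 / c ^ 2 * (D₂ ^ 2 / a ^ 2) := by
          rw [div_mul_div_comm, le_div_iff₀ (by positivity)]
          linarith
        have : 0 ≤ D₃ ^ 2 / a ^ 2 := by positivity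
        linarith
      · have h1 : a ^ 2 ≤ D₃ ^ 2 := by
          rw [← sq_abs D₃]
          exact pow_le_pow_left₀ ha.le h.le 2
        have h2 : 1 ≤ D₃ ^ 2 / a ^ 2 := by
          rw [le_div_iff₀ (by positivity)]
          linarith
        have : 0 ≤ 16 / c ^ 2 * (D₂ ^ 2 / a ^ 2) := by positivity
        linarith
    have hUM : U + M ≤ (U + M) * (16 / c ^ 2 * (D₂ ^ 2 / a ^ 2) + D₃ ^ 2 / a ^ 2) :=
      le_mul_of_one_le_right (by positivity) hone
    refine hcrude.trans (hUM.trans (le_add_of_nonneg_left ?_))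
    positivity

end pointwise

/-! ### Consequences of the assumptions -/

/-- A measurable relation that each point of `A` has with almost every observation, and with
itself, holds almost surely between all pairs of observations whose first member is in `A`. -/
lemma ae_forall_pair_mem {Ω α : Type*} [MeasurableSpace Ω] [MeasurableSpace α] {P : Measure Ω}
    [IsProbabilityMeasure P] {ξ : ℕ → Ω → α} (hind : iIndepFun ξ P) (hξ : ∀ i, Measurable (ξ i))
    (hid : ∀ i, IdentDistrib (ξ i) (ξ 0) P P) {A : Set α} (hA : MeasurableSet A)
    {G : Set (α × α)} (hG : MeasurableSet G) (hGA : ∀ q ∈ A, ∀ᵐ ω ∂P, (q, ξ 0 ω) ∈ G)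
    (hdiag : ∀ q ∈ A, (q, q) ∈ G) :
    ∀ᵐ ω ∂P, ∀ i j, ξ i ω ∈ A → (ξ i ω, ξ j ω) ∈ G := by
  rw [ae_all_iff]
  intro i
  rw [ae_all_iff]
  intro j
  by_cases hij : i = j
  · subst hij
    exact ae_of_all _ fun ω h => hdiag _ h
  have hN : MeasurableSet ((A ×ˢ Set.univ) ∩ Gᶜ : Set (α × α)) :=
    (hA.prod MeasurableSet.univ).inter hG.compl
  have hmap := (hind.indepFun hij).map_prod_eq_prod_map_map (hξ i).aemeasurable (hξ j).aemeasurable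
  have hj := Measure.isProbabilityMeasure_map (μ := P) (hξ j).aemeasurable
  have hnull : P.map (fun ω => (ξ i ω, ξ j ω)) ((A ×ˢ Set.univ) ∩ Gᶜ) = 0 := by
    rw [hmap, Measure.measure_prod_null hN]
    refine ae_of_all _ fun q => ?_
    by_cases hq : q ∈ A
    · have h1 : Prod.mk q ⁻¹' ((A ×ˢ Set.univ) ∩ Gᶜ) ⊆ Prod.mk q ⁻¹' Gᶜ :=
        Set.preimage_mono Set.inter_subset_right
      refine measure_mono_null h1 ?_
      have hm : MeasurableSet (Prod.mk q ⁻¹' Gᶜ) := measurable_prodMk_left hG.compl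
      rw [(hid j).map_eq, Measure.map_apply (hξ 0) hm]
      exact hGA q hq
    · have h1 : Prod.mk q ⁻¹' ((A ×ˢ Set.univ) ∩ Gᶜ) = ∅ := by
        ext x
        simp [hq]
      simp only [h1, measure_empty, Pi.zero_apply]
  rw [Measure.map_apply ((hξ i).prodMk (hξ j)) hN] at hnull
  have h2 : ∀ᵐ ω ∂P, ω ∉ (fun ω => (ξ i ω, ξ j ω)) ⁻¹' ((A ×ˢ Set.univ) ∩ Gᶜ) :=
    measure_eq_zero_iff_ae_notMem.1 hnull
  filter_upwards [h2] with ω hω hA'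
  by_contra hcon
  exact hω ⟨⟨hA', Set.mem_univ _⟩, hcon⟩

section consequences

variable {Ω : Type*} [MeasurableSpace Ω] {dx dz dw : ℕ} {P : Measure Ω}
  {Y : ℕ → Ω → ℝ} {X : ℕ → Ω → Vec dx} {Z : ℕ → Ω → Vec dz} {W : ℕ → Ω → (Fin dw → ℝ)}
  {κ : Kernel (Vec dx × Vec dz) (Fin dw → ℝ)} {ν : Measure (Fin dw → ℝ)}
  {A D : Set (Vec dx × Vec dz)} {x₀ : Vec dx} {KX : Vec dx → ℝ} {KV : ℝ → ℝ} {η d s : ℝ}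
  {b δ : ℕ → ℝ} {Fhat : ℕ → Ω → Vec dx × Vec dz → ProxyFun dw}

/-- Both small ball expectations are of exact or smaller order than `b ^ d`. -/
lemma NonparametricAssumption.exists_smallBall_bounds
    (h : NonparametricAssumption P Y X Z W κ ν A x₀ KX KV η d s b δ Fhat)
    (hb : ∀ n, 0 < b n) :
    ∃ c C : ℝ, 0 < c ∧ 0 < C ∧ ∀ᶠ n in atTop, ∀ q ∈ A,
      c * b n ^ d ≤ smallBall P ν (X 0) (controlVar κ (X 0) (Z 0)) KX KV x₀ (b n)
        (controlCDF κ q) ∧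
      smallBall P ν (X 0) (controlVar κ (X 0) (Z 0)) KX KV x₀ (b n) (controlCDF κ q) ≤
        C * b n ^ d ∧
      0 ≤ smallBall P ν (X 0) (controlVar κ (X 0) (Z 0)) KX (kernelBar KV η) x₀ (b n)
        (controlCDF κ q) ∧
      smallBall P ν (X 0) (controlVar κ (X 0) (Z 0)) KX (kernelBar KV η) x₀ (b n)
        (controlCDF κ q) ≤ C * b n ^ d := by
  obtain ⟨c, C, hc, hev⟩ := h.small_ball
  refine ⟨c, max (max C (C / c)) 1, hc, by positivity, ?_⟩
  filter_upwards [hev] with n hn q hq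
  obtain ⟨⟨h1, h2⟩, h3, h4⟩ := hn _ ⟨q, hq, rfl⟩
  set E₁ := smallBall P ν (X 0) (controlVar κ (X 0) (Z 0)) KX KV x₀ (b n) (controlCDF κ q)
  set E₂ := smallBall P ν (X 0) (controlVar κ (X 0) (Z 0)) KX (kernelBar KV η) x₀ (b n)
    (controlCDF κ q) with hE₂
  have hbd : 0 < b n ^ d := Real.rpow_pos_of_pos (hb n) d
  have hE₂0 : 0 ≤ E₂ := integral_nonneg fun ω => mul_nonneg (h.KX_nonneg _) (kernelBar_nonneg _ _ _)
  -- the lower bound on the ratio excludes `E₂ = 0`, where the quotient would be `0`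
  have hE₂pos : 0 < E₂ := by
    refine hE₂0.lt_of_ne fun h0 => ?_
    rw [← h0, div_zero] at h3
    linarith
  rw [Real.rpow_neg (hb n).le, le_inv_mul_iff₀ hbd] at h1
  rw [Real.rpow_neg (hb n).le, inv_mul_le_iff₀ hbd] at h2
  rw [le_div_iff₀ hE₂pos] at h3
  refine ⟨by linarith, ?_, hE₂0, ?_⟩
  · have : C * b n ^ d ≤ max (max C (C / c)) 1 * b n ^ d :=
      mul_le_mul_of_nonneg_right ((le_max_left _ _).trans (le_max_left _ _)) hbd.le
    linarith
  · have h5 : C / c * b n ^ d ≤ max (max C (C / c)) 1 * b n ^ d :=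
      mul_le_mul_of_nonneg_right ((le_max_right _ _).trans (le_max_left _ _)) hbd.le
    refine le_trans ?_ h5
    rw [div_mul_eq_mul_div, le_div_iff₀ hc]
    linarith

/-- The regression function at `x₀` is bounded over the trimming set, by compactness. -/
lemma NonparametricAssumption.exists_bound_regression
    (h : NonparametricAssumption P Y X Z W κ ν A x₀ KX KV η d s b δ Fhat) (hAD : A ⊆ D)
    {m : Vec dx → ProxyFun dw → ℝ} (hcont : RegressionContinuity κ ν A D x₀ m) :
    ∃ M : ℝ, 0 ≤ M ∧ ∀ q ∈ A, |m x₀ (controlCDF κ q)| ≤ M := by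
  obtain ⟨α, C, r, hα, -, hr, hH⟩ := h.holder
  have hc : ContinuousOn (fun q => m x₀ (controlCDF κ q)) A := by
    intro p hp
    rw [ContinuousWithinAt, Metric.tendsto_nhds]
    intro e he
    obtain ⟨r', hr', hm⟩ := hcont (e / 2) (half_pos he)
    have hlim : Tendsto (fun q : Vec dx × Vec dz => C * (‖q.1 - p.1‖ ^ α + ‖q.2 - p.2‖ ^ α))
        (𝓝[A] p) (𝓝 0) := by
      have hct : Continuous fun q : Vec dx × Vec dz =>
          C * (‖q.1 - p.1‖ ^ α + ‖q.2 - p.2‖ ^ α) := by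
        refine continuous_const.mul (Continuous.add ?_ ?_)
        · exact (continuous_fst.sub continuous_const).norm.rpow_const fun _ => Or.inr hα.le
        · exact (continuous_snd.sub continuous_const).norm.rpow_const fun _ => Or.inr hα.le
      have := hct.tendsto p
      simp only [sub_self, norm_zero, Real.zero_rpow hα.ne', add_zero, mul_zero] at this
      exact this.mono_left nhdsWithin_le_nhds
    have hlim2 : Tendsto (fun q : Vec dx × Vec dz => ‖q.1 - p.1‖ + ‖q.2 - p.2‖)
        (𝓝[A] p) (𝓝 0) := by
      have hct : Continuous fun q : Vec dx × Vec dz => ‖q.1 - p.1‖ + ‖q.2 - p.2‖ := by fun_prop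
      have := hct.tendsto p
      simp only [sub_self, norm_zero, add_zero] at this
      exact this.mono_left nhdsWithin_le_nhds
    filter_upwards [hlim.eventually (gt_mem_nhds hr'), hlim2.eventually (gt_mem_nhds hr),
      self_mem_nhdsWithin] with q hq1 hq2 hqA
    have h1 := hH p hp q hqA hq2.le
    have h2 := hm _ ⟨p, hp, rfl⟩ _ ⟨q, hAD hqA, rfl⟩ x₀ (by simp [hr'.le]) (h1.trans hq1.le)
    rw [Real.dist_eq]
    linarith
  obtain ⟨M, hM⟩ := h.compact.exists_bound_of_continuousOn hc
  exact ⟨max M 0, le_max_right _ _, fun q hq => (hM q hq).trans (le_max_left _ _)⟩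

end consequences

/-! ### Rates -/

section rates

variable {b δ : ℕ → ℝ} {d s : ℝ}

/-- The sample maximum of order `n ^ (1 / s)` is negligible compared to the effective local sample
size `n * b n ^ d`. -/
lemma tendsto_rpow_div_mul_rpow (hb : ∀ n, 0 < b n)
    (hrate : Tendsto (fun n : ℕ => Real.log n / ((n : ℝ) ^ (1 - 1 / s) * b n ^ d)) atTop (𝓝 0)) :
    Tendsto (fun n : ℕ => (n : ℝ) ^ (1 / s) / (n * b n ^ d)) atTop (𝓝 0) := by
  refine tendsto_of_tendsto_of_tendsto_of_le_of_le' tendsto_const_nhds hrate ?_ ?_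
  · filter_upwards with n
    have := (hb n).le
    positivity
  · filter_upwards [eventually_ge_atTop 3] with n hn
    have hn' : (3 : ℝ) ≤ n := by exact_mod_cast hn
    have hn0 : (0 : ℝ) < n := by linarith
    have hbd : 0 < b n ^ d := Real.rpow_pos_of_pos (hb n) d
    have hlog : 1 ≤ Real.log n := by
      rw [Real.le_log_iff_exp_le hn0]
      linarith [Real.exp_one_lt_d9]
    have h1 : (n : ℝ) ^ (1 / s) / (n * b n ^ d) = 1 / ((n : ℝ) ^ (1 - 1 / s) * b n ^ d) := by
      rw [Real.rpow_sub hn0, Real.rpow_one]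
      field_simp
    rw [h1]
    gcongr

lemma one_le_rpow_one_div (hs : 0 < s) {n : ℕ} (hn : 1 ≤ n) : 1 ≤ (n : ℝ) ^ (1 / s) :=
  Real.one_le_rpow (by exact_mod_cast hn) (by positivity)

lemma tendsto_mul_rpow_atTop (hb : ∀ n, 0 < b n) (hs : 0 < s)
    (hrate : Tendsto (fun n : ℕ => (n : ℝ) ^ (1 / s) / (n * b n ^ d)) atTop (𝓝 0)) :
    Tendsto (fun n : ℕ => n * b n ^ d) atTop atTop := by
  have h1 : Tendsto (fun n : ℕ => (n * b n ^ d)⁻¹) atTop (𝓝[>] 0) := by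
    refine tendsto_nhdsWithin_iff.2 ⟨?_, ?_⟩
    · refine tendsto_of_tendsto_of_tendsto_of_le_of_le' tendsto_const_nhds hrate ?_ ?_
      · filter_upwards with n
        have := (hb n).le
        positivity
      · filter_upwards [eventually_ge_atTop 1] with n hn
        have := (hb n).le
        rw [inv_eq_one_div]
        exact div_le_div_of_nonneg_right (one_le_rpow_one_div hs hn) (by positivity)
    · filter_upwards [eventually_ge_atTop 1] with n hn
      have : 0 < b n ^ d := Real.rpow_pos_of_pos (hb n) d
      have hn' : (0 : ℝ) < n := by exact_mod_cast hn
      exact inv_pos.2 (mul_pos hn' this)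
  exact h1.inv_tendsto_nhdsGT_zero.congr fun n => inv_inv _

lemma tendsto_rpow_mul_div
    (hδ : δ =o[atTop] fun n : ℕ => b n / (n : ℝ) ^ (1 / s)) :
    Tendsto (fun n : ℕ => (n : ℝ) ^ (1 / s) * (δ n / b n)) atTop (𝓝 0) := by
  refine hδ.tendsto_div_nhds_zero.congr' ?_
  filter_upwards with n
  rw [div_div_eq_mul_div]
  ring

end rates

/-! ### Consistency of the kernel regression on average over the sample -/

/-- Averaging a bound of the form `det + k₁ D₁ + k₂ D₂ + k₃ D₃` over the trimmed observations. -/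
lemma abs_average_ite_le {n : ℕ} (hn : 0 < n) {Q : ℕ → Prop} [DecidablePred Q]
    {err D₁ D₂ D₃ : ℕ → ℝ} {det k₁ k₂ k₃ t : ℝ} (hdet : 0 ≤ det) (h₁ : 0 ≤ k₁) (h₂ : 0 ≤ k₂)
    (h₃ : 0 ≤ k₃)
    (h : ∀ i < n, Q i → |err i| ≤ det + k₁ * D₁ i + k₂ * D₂ i + k₃ * D₃ i)
    (hD₁ : ∑ i ∈ Finset.range n, (if Q i then D₁ i else 0) ≤ n * t)
    (hD₂ : ∑ i ∈ Finset.range n, (if Q i then D₂ i else 0) ≤ n * t)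
    (hD₃ : ∑ i ∈ Finset.range n, (if Q i then D₃ i else 0) ≤ n * t) :
    |(∑ i ∈ Finset.range n, if Q i then err i else 0) / n| ≤ det + (k₁ + k₂ + k₃) * t := by
  have hn' : (0 : ℝ) < n := by exact_mod_cast hn
  rw [abs_div, Nat.abs_cast, div_le_iff₀ hn']
  have h4 : |∑ i ∈ Finset.range n, if Q i then err i else 0| ≤ ∑ i ∈ Finset.range n,
      (det + k₁ * (if Q i then D₁ i else 0) + k₂ * (if Q i then D₂ i else 0) +
        k₃ * (if Q i then D₃ i else 0)) := by
    refine (Finset.abs_sum_le_sum_abs _ _).trans (Finset.sum_le_sum fun i hi => ?_)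
    by_cases hQ : Q i
    · simpa only [hQ, if_true] using h i (Finset.mem_range.1 hi) hQ
    · simpa [hQ] using hdet
  refine h4.trans ?_
  rw [Finset.sum_add_distrib, Finset.sum_add_distrib, Finset.sum_add_distrib, Finset.sum_const,
    Finset.card_range, nsmul_eq_mul, ← Finset.mul_sum, ← Finset.mul_sum, ← Finset.mul_sum]
  have e1 := mul_le_mul_of_nonneg_left hD₁ h₁
  have e2 := mul_le_mul_of_nonneg_left hD₂ h₂
  have e3 := mul_le_mul_of_nonneg_left hD₃ h₃
  linarith

lemma tendsto_measure_zero_of_forall_le {Ω : Type*} [MeasurableSpace Ω] {P : Measure Ω}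
    {S : ℕ → Set Ω} {K : ℝ} (hK : 0 < K)
    (h : ∀ g : ℝ, 0 < g → ∀ᶠ n in atTop, P (S n) ≤ ENNReal.ofReal (K * g)) :
    Tendsto (fun n => P (S n)) atTop (𝓝 0) := by
  rw [ENNReal.tendsto_nhds_zero]
  intro γ hγ
  obtain ⟨r, -, hr0, hr⟩ := ENNReal.lt_iff_exists_real_btwn.1 hγ
  have hr1 : 0 < r := by simpa using hr0
  filter_upwards [h (r / K) (by positivity)] with n hn
  refine hn.trans ?_
  rw [mul_div_cancel₀ _ hK.ne']
  exact hr.le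

section core

variable {Ω : Type*} [MeasurableSpace Ω] {dx dz dw : ℕ} {P : Measure Ω} [IsProbabilityMeasure P]
  {Y : ℕ → Ω → ℝ} {X : ℕ → Ω → Vec dx} {Z : ℕ → Ω → Vec dz} {W : ℕ → Ω → (Fin dw → ℝ)}
  {κ : Kernel (Vec dx × Vec dz) (Fin dw → ℝ)} [IsMarkovKernel κ] {ν : Measure (Fin dw → ℝ)}
  [IsFiniteMeasure ν]
  {A D : Set (Vec dx × Vec dz)} {x₀ : Vec dx} {KX : Vec dx → ℝ} {KV : ℝ → ℝ} {η d s : ℝ}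
  {b δ : ℕ → ℝ} {Fhat : ℕ → Ω → Vec dx × Vec dz → ProxyFun dw}

omit [IsProbabilityMeasure P] [IsMarkovKernel κ] [IsFiniteMeasure ν] in
/-- Common bounds for the supports and the sizes of the kernels. -/
lemma NonparametricAssumption.exists_kernel_bounds
    (h : NonparametricAssumption P Y X Z W κ ν A x₀ KX KV η d s b δ Fhat) :
    ∃ R B B' : ℝ, 0 < R ∧ 0 < B ∧ (∀ u, KX u ≠ 0 → ‖u‖ ≤ R) ∧ (∀ u, KV u ≠ 0 → ‖u‖ ≤ R) ∧
      (∀ u, |deriv KV u| ≤ B') ∧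
      (∀ β q q', kernelWeight κ ν KX KV x₀ β q q' ≤ B) ∧
      ∀ β q q', kernelWeight κ ν KX (kernelBar KV η) x₀ β q q' ≤ B := by
  obtain ⟨R₁, hR₁, h₁⟩ := norm_le_of_hasCompactSupport h.KX_compact
  obtain ⟨R₂, hR₂, h₂⟩ := norm_le_of_hasCompactSupport h.KV_compact
  obtain ⟨B₁, hB₁, k₁⟩ := exists_bound_of_hasCompactSupport h.KX_contDiff.continuous h.KX_compact
  obtain ⟨B₂, hB₂, k₂⟩ := exists_bound_of_hasCompactSupport h.KV_contDiff.continuous h.KV_compact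
  obtain ⟨B₃, hB₃, k₃⟩ := exists_bound_of_hasCompactSupport
    (h.KV_contDiff.continuous_deriv le_rfl) h.KV_compact.deriv
  refine ⟨max R₁ R₂, B₁ * (B₂ + B₃), B₃, by positivity, by positivity,
    fun u hu => (h₁ u hu).trans (le_max_left _ _), fun u hu => (h₂ u hu).trans (le_max_right _ _),
    k₃, fun β q q' => ?_, fun β q q' => ?_⟩
  · refine (kernelWeight_le h.KX_nonneg h.KV_nonneg (fun u => (le_abs_self _).trans (k₁ u))
      (fun u => (le_abs_self _).trans (k₂ u)) q q').trans ?_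
    exact mul_le_mul_of_nonneg_left (by linarith) hB₁.le
  · refine (kernelWeight_le h.KX_nonneg (kernelBar_nonneg KV η)
      (fun u => (le_abs_self _).trans (k₁ u)) (kernelBar_le k₃ h.η_pos) q q').trans ?_
    exact mul_le_mul_of_nonneg_left (by linarith) hB₁.le

omit [IsMarkovKernel κ] [IsFiniteMeasure ν] in
lemma NonparametricAssumption.integrable_Y
    (h : NonparametricAssumption P Y X Z W κ ν A x₀ KX KV η d s b δ Fhat) :
    Integrable (Y 0) P := by
  have hs := h.two_lt_s
  refine (h.moment_integrable.add (integrable_const (1 : ℝ))).mono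
    (h.sample.measurable_Y 0).aestronglyMeasurable (ae_of_all _ fun ω => ?_)
  have h0 : 0 ≤ |Y 0 ω| ^ s := by positivity
  simp only [Pi.add_apply, Real.norm_eq_abs]
  rw [abs_of_nonneg (by positivity : 0 ≤ |Y 0 ω| ^ s + 1)]
  rcases le_total |Y 0 ω| 1 with h1 | h1
  · linarith
  · have := Real.rpow_le_rpow_of_exponent_le h1 (y := 1) (z := s) (by linarith)
    rw [Real.rpow_one] at this
    linarith

/-- The pairs of covariate values `(q, p)` for which closeness of the covariate `p.1` to `x₀` and of
the control values implies closeness of the regression function. -/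
def closePairs (κ : Kernel (Vec dx × Vec dz) (Fin dw → ℝ)) (ν : Measure (Fin dw → ℝ))
    (x₀ : Vec dx) (m : Vec dx → ProxyFun dw → ℝ) (r e : ℝ) :
    Set ((Vec dx × Vec dz) × (Vec dx × Vec dz)) :=
  {t | ‖t.2.1 - x₀‖ ≤ r → l2Norm ν (controlCDF κ t.2 - controlCDF κ t.1) ≤ r →
    |m t.2.1 (controlCDF κ t.2) - m x₀ (controlCDF κ t.1)| ≤ e}

lemma measurableSet_closePairs {m : Vec dx → ProxyFun dw → ℝ}
    (hm : Measurable (Function.uncurry m)) (r e : ℝ) :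
    MeasurableSet (closePairs κ ν x₀ m r e) := by
  have hF := measurable_controlCDF κ
  have h1 : Measurable fun t : (Vec dx × Vec dz) × (Vec dx × Vec dz) =>
      l2Norm ν (controlCDF κ t.2 - controlCDF κ t.1) := by
    have := (measurable_l2Norm_controlCDF_sub κ ν).comp measurable_swap
    exact this
  have h2 : Measurable fun t : (Vec dx × Vec dz) × (Vec dx × Vec dz) =>
      |m t.2.1 (controlCDF κ t.2) - m x₀ (controlCDF κ t.1)| := by
    have e1 : Measurable fun t : (Vec dx × Vec dz) × (Vec dx × Vec dz) =>
        m t.2.1 (controlCDF κ t.2) :=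
      hm.comp ((measurable_fst.comp measurable_snd).prodMk (hF.comp measurable_snd))
    have e2 : Measurable fun t : (Vec dx × Vec dz) × (Vec dx × Vec dz) =>
        m x₀ (controlCDF κ t.1) :=
      hm.comp (measurable_const.prodMk (hF.comp measurable_fst))
    exact continuous_abs.measurable.comp (e1.sub e2)
  have h3 : Measurable fun t : (Vec dx × Vec dz) × (Vec dx × Vec dz) => ‖t.2.1 - x₀‖ := by
    fun_prop
  have hs : closePairs κ ν x₀ m r e =
      {t | ‖t.2.1 - x₀‖ ≤ r}ᶜ ∪ ({t | l2Norm ν (controlCDF κ t.2 - controlCDF κ t.1) ≤ r}ᶜ ∪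
        {t | |m t.2.1 (controlCDF κ t.2) - m x₀ (controlCDF κ t.1)| ≤ e}) := by
    ext t
    simp only [closePairs, Set.mem_ofPred_eq, Set.mem_union, Set.mem_compl_iff]
    tauto
  rw [hs]
  exact (measurableSet_le h3 measurable_const).compl.union
    ((measurableSet_le h1 measurable_const).compl.union (measurableSet_le h2 measurable_const))

/-- Second moments, given the control value of an observation in the trimming set, of the weighted
residual and of the two weights: all are of the order `b ^ d` of the small ball probability. -/
lemma NonparametricAssumption.exists_second_moment_bounds
    (h : NonparametricAssumption P Y X Z W κ ν A x₀ KX KV η d s b δ Fhat)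
    (hb_pos : ∀ n, 0 < b n) (hb : Tendsto b atTop (𝓝 0)) {m : Vec dx → ProxyFun dw → ℝ}
    (hm : IsRegression P (Y 0) (X 0) (controlVar κ (X 0) (Z 0)) m)
    {M r e : ℝ} (hM : ∀ q ∈ A, |m x₀ (controlCDF κ q)| ≤ M) (hr : 0 < r)
    (hclose : ∀ q ∈ A, ∀ᵐ ω ∂P, (q, (X 0 ω, Z 0 ω)) ∈ closePairs κ ν x₀ m r e) :
    ∃ S : ℝ, 0 < S ∧ ∀ᶠ n in atTop, ∀ q ∈ A,
      (MemLp (fun ω => (Y 0 ω - m (X 0 ω) (controlCDF κ (X 0 ω, Z 0 ω))) *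
          kernelWeight κ ν KX KV x₀ (b n) (X 0 ω, Z 0 ω) q) 2 P ∧
        ∫ ω, ((Y 0 ω - m (X 0 ω) (controlCDF κ (X 0 ω, Z 0 ω))) *
          kernelWeight κ ν KX KV x₀ (b n) (X 0 ω, Z 0 ω) q) ^ 2 ∂P ≤ S * b n ^ d) ∧
      (MemLp (fun ω => kernelWeight κ ν KX KV x₀ (b n) (X 0 ω, Z 0 ω) q) 2 P ∧
        ∫ ω, kernelWeight κ ν KX KV x₀ (b n) (X 0 ω, Z 0 ω) q ^ 2 ∂P ≤ S * b n ^ d) ∧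
      (MemLp (fun ω => kernelWeight κ ν KX (kernelBar KV η) x₀ (b n) (X 0 ω, Z 0 ω) q) 2 P ∧
        ∫ ω, kernelWeight κ ν KX (kernelBar KV η) x₀ (b n) (X 0 ω, Z 0 ω) q ^ 2 ∂P ≤
          S * b n ^ d) := by
  obtain ⟨R, B, B', hR, hB, hRX, hRV, hB', hBw, hBw'⟩ := h.exists_kernel_bounds
  obtain ⟨c, C, hc, hC, hball⟩ := h.exists_smallBall_bounds hb_pos
  obtain ⟨Cm, hCm⟩ := h.moment_bound
  have hCm' : ∀ᵐ ω ∂P, (P[fun ω => |Y 0 ω| ^ s |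
      MeasurableSpace.comap (fun ω => (X 0 ω, Z 0 ω)) inferInstance]) ω ≤ |Cm| := by
    filter_upwards [hCm] with ω hω
    exact hω.trans (le_abs_self _)
  have hX := h.sample.measurable_X 0
  have hZ := h.sample.measurable_Z 0
  have hY := h.sample.measurable_Y 0
  have hF := measurable_controlCDF κ
  have hmeasKX := h.KX_contDiff.continuous.measurable
  have hmeasKV := h.KV_contDiff.continuous.measurable
  have hmeasKb : Measurable (kernelBar KV η) := measurable_kernelBar h.KV_contDiff hB'
  have hmm : Measurable fun ω => m (X 0 ω) (controlCDF κ (X 0 ω, Z 0 ω)) :=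
    hm.1.comp (hX.prodMk (hF.comp (hX.prodMk hZ)))
  set K : ℝ := 2 * (1 + |Cm|) + 2 * (M + e) ^ 2 with hK
  have hK1 : 1 ≤ K := by
    have := abs_nonneg Cm
    have := sq_nonneg (M + e)
    linarith
  have hRb : ∀ᶠ n in atTop, R * b n ≤ r := by
    have : Tendsto (fun n => R * b n) atTop (𝓝 (R * 0)) := hb.const_mul R
    rw [mul_zero] at this
    exact this.eventually_le_const hr
  refine ⟨B * K * C, by positivity, ?_⟩
  filter_upwards [hball, hRb] with n hn hRn q hq
  obtain ⟨-, h1, h2, h3⟩ := hn q hq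
  have hbd : 0 < b n ^ d := Real.rpow_pos_of_pos (hb_pos n) d
  have hBK : B ≤ B * K := le_mul_of_one_le_right hB.le hK1
  have hfin : ∀ E : ℝ, E ≤ C * b n ^ d → B * K * E ≤ B * K * C * b n ^ d := fun E hE => by
    rw [mul_assoc (B * K)]
    exact mul_le_mul_of_nonneg_left hE (by positivity)
  have hfin' : ∀ E : ℝ, E ≤ C * b n ^ d → B * E ≤ B * K * C * b n ^ d := fun E hE => by
    refine (mul_le_mul_of_nonneg_left hE hB.le).trans ?_
    rw [mul_assoc (B * K)]
    exact mul_le_mul_of_nonneg_right hBK (by positivity)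
  refine ⟨?_, ?_, ?_⟩
  · have hsupp : ∀ᵐ ω ∂P, kernelWeight κ ν KX KV x₀ (b n) (X 0 ω, Z 0 ω) q ≠ 0 →
        |m (X 0 ω) (controlCDF κ (X 0 ω, Z 0 ω))| ≤ M + e := by
      filter_upwards [hclose q hq] with ω hω hw
      have hx := hRX _ (left_ne_zero_of_mul hw)
      rw [norm_smul, norm_inv, Real.norm_eq_abs, abs_of_pos (hb_pos n),
        inv_mul_le_iff₀ (hb_pos n), mul_comm] at hx
      have hv := hRV _ (right_ne_zero_of_mul hw)
      rw [norm_div, Real.norm_eq_abs, Real.norm_eq_abs, abs_of_pos (hb_pos n),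
        abs_of_nonneg (l2Norm_nonneg _ _), div_le_iff₀ (hb_pos n)] at hv
      have hcl := hω (hx.trans hRn) (hv.trans hRn)
      have := abs_sub_abs_le_abs_sub (m (X 0 ω) (controlCDF κ (X 0 ω, Z 0 ω)))
        (m x₀ (controlCDF κ q))
      have := hM q hq
      linarith
    have := integral_residual_mul_kernelWeight_sq_le (Y := Y 0) hX hZ hmeasKX hmeasKV h.KX_nonneg
      h.KV_nonneg (hBw (b n)) hY h.two_lt_s h.moment_integrable hCm' hmm q hsupp
    exact ⟨this.1, this.2.trans (hfin _ h1)⟩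
  · have := integral_kernelWeight_sq_le (P := P) hX hZ hmeasKX hmeasKV h.KX_nonneg
      h.KV_nonneg (hBw (b n)) q
    exact ⟨this.1, this.2.trans (hfin' _ h1)⟩
  · have := integral_kernelWeight_sq_le (P := P) hX hZ hmeasKX hmeasKb h.KX_nonneg
      (kernelBar_nonneg _ _) (hBw' (b n)) q
    exact ⟨this.1, this.2.trans (hfin' _ h3)⟩

end core

/-- The contribution of the three centred sums, when the average of each of their squares is at most
`θ * a ^ 2 / (1 + N)`; the truncation level `T * N` of the outcomes is absorbed by `1 + N`. -/
lemma noise_budget_le {a N c e T M θ : ℝ} (ha : 0 < a) (hN : 1 ≤ N) (hc : 0 < c) (he : 0 < e)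
    (hT : 0 ≤ T) (hM : 0 ≤ M) (hθ : 0 ≤ θ) :
    (4 / (c * e) / a ^ 2 + (T * N + M) * (16 / c ^ 2) / a ^ 2 + (T * N + M) / a ^ 2) *
      (θ * a ^ 2 / (1 + N)) ≤ θ * (4 / (c * e) + (T + M) * (16 / c ^ 2 + 1)) := by
  have h1 : (4 / (c * e) / a ^ 2 + (T * N + M) * (16 / c ^ 2) / a ^ 2 + (T * N + M) / a ^ 2) *
      (θ * a ^ 2 / (1 + N)) =
      (4 / (c * e) + (T * N + M) * (16 / c ^ 2 + 1)) * θ / (1 + N) := by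
    field_simp
    ring
  rw [h1, div_le_iff₀ (by linarith)]
  have h2 : T * N + M ≤ (T + M) * (1 + N) := by nlinarith
  have h3 : 4 / (c * e) ≤ 4 / (c * e) * (1 + N) :=
    le_mul_of_one_le_right (by positivity) (by linarith)
  calc (4 / (c * e) + (T * N + M) * (16 / c ^ 2 + 1)) * θ
      ≤ (4 / (c * e) * (1 + N) + (T + M) * (1 + N) * (16 / c ^ 2 + 1)) * θ := by gcongr
    _ = _ := by ring

section consistency

variable {Ω : Type*} [MeasurableSpace Ω] {dx dz dw : ℕ} {P : Measure Ω} [IsProbabilityMeasure P]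
  {Y : ℕ → Ω → ℝ} {X : ℕ → Ω → Vec dx} {Z : ℕ → Ω → Vec dz} {W : ℕ → Ω → (Fin dw → ℝ)}
  {κ : Kernel (Vec dx × Vec dz) (Fin dw → ℝ)} [IsMarkovKernel κ] {ν : Measure (Fin dw → ℝ)}
  [IsFiniteMeasure ν]
  {A D : Set (Vec dx × Vec dz)} {x₀ : Vec dx} {KX : Vec dx → ℝ} {KV : ℝ → ℝ} {η d s : ℝ}
  {b δ : ℕ → ℝ} {Fhat : ℕ → Ω → Vec dx × Vec dz → ProxyFun dw}

omit [IsProbabilityMeasure P] in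
lemma IsRandomSample.iIndepFun_outcome_covariates (h : IsRandomSample P Y X Z W) :
    iIndepFun (fun i ω => (Y i ω, (X i ω, Z i ω))) P :=
  h.indep.comp (fun _ t => (t.1, (t.2.1, t.2.2.1))) fun _ => by fun_prop

omit [IsProbabilityMeasure P] in
lemma IsRandomSample.identDistrib_outcome_covariates (h : IsRandomSample P Y X Z W) (i : ℕ) :
    IdentDistrib (fun ω => (Y i ω, (X i ω, Z i ω))) (fun ω => (Y 0 ω, (X 0 ω, Z 0 ω))) P P := by
  have := (h.identDistrib i).comp (u := fun t : ℝ × Vec dx × Vec dz × (Fin dw → ℝ) =>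
    (t.1, (t.2.1, t.2.2.1))) (by fun_prop)
  exact this

set_option maxHeartbeats 800000 in
open Classical in
/-- The kernel regression at the estimated control values is consistent on average over the
trimmed observations. -/
lemma NonparametricAssumption.tendsto_measure_average_error
    (h : NonparametricAssumption P Y X Z W κ ν A x₀ KX KV η d s b δ Fhat)
    (hAD : A ⊆ D) (hD : ∀ᵐ ω ∂P, (X 0 ω, Z 0 ω) ∈ D)
    (hb_pos : ∀ n, 0 < b n) (hb : Tendsto b atTop (𝓝 0))
    (hrate : Tendsto (fun n : ℕ => Real.log n / ((n : ℝ) ^ (1 - 1 / s) * b n ^ d)) atTop (𝓝 0))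
    {m : Vec dx → ProxyFun dw → ℝ}
    (hm : IsRegression P (Y 0) (X 0) (controlVar κ (X 0) (Z 0)) m)
    (hcont : RegressionContinuity κ ν A D x₀ m) {ε : ℝ} (hε : 0 < ε) :
    Tendsto (fun n : ℕ => P {ω | ε ≤ |(∑ i ∈ Finset.range n, if (X i ω, Z i ω) ∈ A then
      (kernelRegression ν KX KV (b n) n (fun j => Y j ω) (fun j => X j ω)
        (fun j => Fhat n ω (X j ω, Z j ω)) x₀ (Fhat n ω (X i ω, Z i ω)) -
        m x₀ (controlCDF κ (X i ω, Z i ω))) else 0) / n|}) atTop (𝓝 0) := by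
  have hs0 : 0 < s := by linarith [h.two_lt_s]
  have hA := h.compact.measurableSet
  obtain ⟨R, B, B', hR, hB, hRX, hRV, hB', hBw, hBw'⟩ := h.exists_kernel_bounds
  obtain ⟨c, C, hc, hC, hball⟩ := h.exists_smallBall_bounds hb_pos
  obtain ⟨M, hM0, hM⟩ := h.exists_bound_regression hAD hcont
  have hX := h.sample.measurable_X
  have hZ := h.sample.measurable_Z
  have hY := h.sample.measurable_Y
  have hF := measurable_controlCDF κ
  have hmeasKX := h.KX_contDiff.continuous.measurable
  have hmeasKV := h.KV_contDiff.continuous.measurable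
  have hmeasKb : Measurable (kernelBar KV η) := measurable_kernelBar h.KV_contDiff hB'
  -- the sample of outcomes and covariates
  set ξ : ℕ → Ω → ℝ × (Vec dx × Vec dz) := fun i ω => (Y i ω, (X i ω, Z i ω)) with hξdef
  have hξ : ∀ i, Measurable (ξ i) := fun i => (hY i).prodMk ((hX i).prodMk (hZ i))
  have hind : iIndepFun ξ P := h.sample.iIndepFun_outcome_covariates
  have hid : ∀ i, IdentDistrib (ξ i) (ξ 0) P P := h.sample.identDistrib_outcome_covariates
  set A' : Set (ℝ × (Vec dx × Vec dz)) := {x | x.2 ∈ A} with hA'def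
  have hA' : MeasurableSet A' := measurable_snd hA
  -- the smoothing bias allowed for, and the corresponding radius of uniform continuity
  set e : ℝ := ε / 8 / (1 + 4 / c) with hedef
  have he : 0 < e := by positivity
  obtain ⟨r, hr, hre⟩ := hcont e he
  have hclose : ∀ q ∈ A, ∀ᵐ ω ∂P, (q, (X 0 ω, Z 0 ω)) ∈ closePairs κ ν x₀ m r e := by
    intro q hq
    filter_upwards [hD] with ω hω h1 h2
    exact hre _ ⟨q, hq, rfl⟩ _ ⟨_, hω, rfl⟩ _ h1 h2
  have hdiag : ∀ q ∈ A, (q, q) ∈ closePairs κ ν x₀ m r e := fun q hq h1 h2 =>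
    hre _ ⟨q, hq, rfl⟩ _ ⟨q, hAD hq, rfl⟩ _ h1 h2
  have hpairs : ∀ᵐ ω ∂P, ∀ i j, (X i ω, Z i ω) ∈ A →
      ((X i ω, Z i ω), (X j ω, Z j ω)) ∈ closePairs κ ν x₀ m r e :=
    ae_forall_pair_mem (ξ := fun i ω => (X i ω, Z i ω))
      (hind.comp (fun _ t => t.2) fun _ => measurable_snd) (fun i => (hX i).prodMk (hZ i))
      (fun i => (hid i).comp measurable_snd) hA (measurableSet_closePairs hm.1 r e) hclose hdiag
  obtain ⟨S, hS, hmom⟩ := h.exists_second_moment_bounds hb_pos hb hm hM hr hclose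
  -- the order `N n` of the sample maximum and the local sample size `a n`
  set N : ℕ → ℝ := fun n => (n : ℝ) ^ (1 / s) with hNdef
  set a : ℕ → ℝ := fun n => n * b n ^ d with hadef
  have hNa : Tendsto (fun n => N n / a n) atTop (𝓝 0) := tendsto_rpow_div_mul_rpow hb_pos hrate
  have ha_top : Tendsto a atTop atTop := tendsto_mul_rpow_atTop hb_pos hs0 hNa
  have hNδ : Tendsto (fun n => N n * (δ n / b n)) atTop (𝓝 0) := tendsto_rpow_mul_div h.δ_rate
  have hN1 : ∀ n : ℕ, 1 ≤ n → 1 ≤ N n := fun n hn => one_le_rpow_one_div hs0 hn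
  have hδb0 : ∀ n, 0 ≤ δ n / b n := fun n => div_nonneg (h.δ_nonneg n) (hb_pos n).le
  have hδb : Tendsto (fun n => δ n / b n) atTop (𝓝 0) := by
    refine tendsto_of_tendsto_of_tendsto_of_le_of_le' tendsto_const_nhds hNδ
      (Eventually.of_forall hδb0) ?_
    filter_upwards [eventually_ge_atTop 1] with n hn
    exact le_mul_of_one_le_left (hδb0 n) (hN1 n hn)
  have hδ : Tendsto δ atTop (𝓝 0) := by
    have := hδb.mul hb
    rw [mul_zero] at this
    refine this.congr fun n => ?_
    rw [div_mul_cancel₀ _ (hb_pos n).ne']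
  refine tendsto_measure_zero_of_forall_le (K := 5) (by norm_num) fun g hg => ?_
  obtain ⟨M₁, hfirst⟩ := h.first_stage g hg
  -- the truncation level of the outcomes
  set EY : ℝ := ∫ ω, |Y 0 ω| ^ s ∂P with hEY
  have hEY0 : 0 ≤ EY := integral_nonneg fun ω => by positivity
  set T : ℝ := ((EY + 1) / g) ^ (1 / s) with hTdef
  have hT : 0 < T := by positivity
  have hTs : EY / T ^ s ≤ g := by
    rw [hTdef, ← Real.rpow_mul (by positivity), one_div_mul_cancel hs0.ne', Real.rpow_one,
      div_div_eq_mul_div, div_le_iff₀ (by positivity)]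
    nlinarith
  set θ : ℝ := ε / 8 / (4 / (c * e) + (T + M) * (16 / c ^ 2 + 1)) with hθdef
  have hθ : 0 < θ := by positivity
  have hτlim : ∀ k : ℝ, Tendsto (fun n => k * (2 * (|M₁| * δ n) / b n)) atTop (𝓝 0) := fun k => by
    have := hδb.const_mul (k * (2 * |M₁|))
    rw [mul_zero] at this
    refine this.congr fun n => ?_
    ring
  have hdetlim : Tendsto (fun n => 4 / c * ((T * N n + M + e) *
      (B / a n + 2 * (|M₁| * δ n) / b n * (C + 2)))) atTop (𝓝 0) := by
    have h1 := ((hNa.const_mul B).add (hNδ.const_mul (2 * |M₁| * (C + 2)))).const_mul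
      (4 / c * (T + M + e))
    simp only [mul_zero, add_zero] at h1
    refine tendsto_of_tendsto_of_tendsto_of_le_of_le' tendsto_const_nhds h1 ?_ ?_
    · filter_upwards [ha_top.eventually_gt_atTop 0] with n hn
      have h2 := hδb0 n
      have h3 : 0 ≤ N n := by positivity
      have h4 : 0 ≤ 2 * (|M₁| * δ n) / b n := by
        have := h.δ_nonneg n
        have := (hb_pos n).le
        positivity
      positivity
    · filter_upwards [ha_top.eventually_gt_atTop 0, eventually_ge_atTop 1] with n hn hn1
      have h2 := hN1 n hn1
      have h4 : 0 ≤ 2 * (|M₁| * δ n) / b n := by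
        have := h.δ_nonneg n
        have := (hb_pos n).le
        positivity
      have h5 : T * N n + M + e ≤ (T + M + e) * N n := by nlinarith
      calc _ ≤ 4 / c * (((T + M + e) * N n) *
          (B / a n + 2 * (|M₁| * δ n) / b n * (C + 2))) := by gcongr
        _ = _ := by ring
  have hvarlim : Tendsto (fun n => S / θ * ((1 + N n) / a n)) atTop (𝓝 0) := by
    have h1 : Tendsto (fun n => (a n)⁻¹) atTop (𝓝 0) := ha_top.inv_tendsto_atTop
    have := (h1.add hNa).const_mul (S / θ)
    simp only [add_zero, mul_zero] at this
    refine this.congr fun n => ?_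
    ring
  have hradius : Tendsto (fun n => R * b n + 2 * (|M₁| * δ n)) atTop (𝓝 0) := by
    have := (hb.const_mul R).add (hδ.const_mul (2 * |M₁|))
    simp only [add_zero, mul_zero] at this
    refine this.congr fun n => ?_
    ring
  filter_upwards [hball, hmom, hfirst, eventually_ge_atTop 1,
    hradius.eventually_le_const hr, (hτlim 1).eventually_le_const h.η_pos,
    (hτlim (C + 2)).eventually_le_const (by positivity : 0 < c / 4),
    hdetlim.eventually_le_const (by positivity : 0 < ε / 8),
    hvarlim.eventually_le_const hg, ha_top.eventually_ge_atTop B,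
    ha_top.eventually_ge_atTop (4 * B / c)]
    with n hball hmom hfirst hn1 hrad hη hτ hdet hvar haB haBc
  have hn' : (0 : ℝ) < n := by exact_mod_cast hn1
  have hbd : 0 < b n ^ d := Real.rpow_pos_of_pos (hb_pos n) d
  have han : 0 < a n := mul_pos hn' hbd
  have hNn : 1 ≤ N n := hN1 n hn1
  -- the three families of centred sums
  set h₁ : ℝ × (Vec dx × Vec dz) → ℝ × (Vec dx × Vec dz) → ℝ := fun x y =>
    (y.1 - m y.2.1 (controlCDF κ y.2)) * kernelWeight κ ν KX KV x₀ (b n) y.2 x.2 with hh₁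
  set h₂ : ℝ × (Vec dx × Vec dz) → ℝ × (Vec dx × Vec dz) → ℝ := fun x y =>
    kernelWeight κ ν KX KV x₀ (b n) y.2 x.2 with hh₂
  set h₃ : ℝ × (Vec dx × Vec dz) → ℝ × (Vec dx × Vec dz) → ℝ := fun x y =>
    kernelWeight κ ν KX (kernelBar KV η) x₀ (b n) y.2 x.2 with hh₃
  have hswap : Measurable fun t : (ℝ × (Vec dx × Vec dz)) × (ℝ × (Vec dx × Vec dz)) =>
      (t.2.2, t.1.2) := by fun_prop
  have hm₂ : Measurable (Function.uncurry h₂) := by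
    have := (measurable_kernelWeight (κ := κ) (ν := ν) (x₀ := x₀) (b := b n) hmeasKX hmeasKV).comp
      hswap
    exact this
  have hm₃ : Measurable (Function.uncurry h₃) := by
    have := (measurable_kernelWeight (κ := κ) (ν := ν) (x₀ := x₀) (b := b n) hmeasKX hmeasKb).comp
      hswap
    exact this
  have hm₁ : Measurable (Function.uncurry h₁) := by
    have e1 : Measurable fun y : ℝ × (Vec dx × Vec dz) => m y.2.1 (controlCDF κ y.2) :=
      hm.1.comp ((measurable_fst.comp measurable_snd).prodMk (hF.comp measurable_snd))
    have e2 := ((measurable_fst.sub e1).comp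
      (measurable_snd (α := ℝ × (Vec dx × Vec dz)))).mul hm₂
    exact e2
  set t : ℝ := θ * a n ^ 2 / (1 + N n) with htdef
  have ht : 0 < t := by positivity
  have htail : n * (S * b n ^ d) / t ≤ g := by
    refine le_trans (le_of_eq ?_) hvar
    have : n * (S * b n ^ d) = S * a n := by simp only [hadef]; ring
    rw [this, htdef]
    field_simp
  have hbad : ∀ f : ℝ × (Vec dx × Vec dz) → ℝ × (Vec dx × Vec dz) → ℝ,
      Measurable (Function.uncurry f) → (∀ x ∈ A', MemLp (fun ω => f x (ξ 0 ω)) 2 P) →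
      (∀ x ∈ A', ∫ ω, f x (ξ 0 ω) ^ 2 ∂P ≤ S * b n ^ d) →
      P {ω | n * t ≤ ∑ i ∈ Finset.range n,
        (ξ i ⁻¹' A').indicator (fun ω => centredSum P ξ f n i ω ^ 2) ω} ≤ ENNReal.ofReal g :=
    fun f hf h1 h2 => (measure_average_centredSum_sq_ge_le hind hξ hid hf hA' h1 h2
      (by positivity) hn1 ht).trans (ENNReal.ofReal_le_ofReal htail)
  have hbad₁ := hbad h₁ hm₁ (fun x hx => (hmom _ hx).1.1) (fun x hx => (hmom _ hx).1.2)
  have hbad₂ := hbad h₂ hm₂ (fun x hx => (hmom _ hx).2.1.1) (fun x hx => (hmom _ hx).2.1.2)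
  have hbad₃ := hbad h₃ hm₃ (fun x hx => (hmom _ hx).2.2.1) (fun x hx => (hmom _ hx).2.2.2)
  have hbadY := (measure_exists_gt_le (fun i => (hid i).comp measurable_fst) hs0
    h.moment_integrable hT n).trans (ENNReal.ofReal_le_ofReal hTs)
  have hnull : P {ω | ¬ ∀ i j, (X i ω, Z i ω) ∈ A →
      ((X i ω, Z i ω), (X j ω, Z j ω)) ∈ closePairs κ ν x₀ m r e} = 0 := hpairs
  have hsub : {ω | ε ≤ |(∑ i ∈ Finset.range n, if (X i ω, Z i ω) ∈ A then
      (kernelRegression ν KX KV (b n) n (fun j => Y j ω) (fun j => X j ω)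
        (fun j => Fhat n ω (X j ω, Z j ω)) x₀ (Fhat n ω (X i ω, Z i ω)) -
        m x₀ (controlCDF κ (X i ω, Z i ω))) else 0) / n|} ⊆
      {ω | ¬ ∀ p ∈ A ∪ {p | ∃ i < n, p = (X i ω, Z i ω)},
        l2Norm ν (Fhat n ω p - controlCDF κ p) ≤ M₁ * δ n} ∪
      ({ω | ∃ i < n, T * (n : ℝ) ^ (1 / s) < |Y i ω|} ∪
      ({ω | n * t ≤ ∑ i ∈ Finset.range n,
        (ξ i ⁻¹' A').indicator (fun ω => centredSum P ξ h₁ n i ω ^ 2) ω} ∪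
      ({ω | n * t ≤ ∑ i ∈ Finset.range n,
        (ξ i ⁻¹' A').indicator (fun ω => centredSum P ξ h₂ n i ω ^ 2) ω} ∪
      ({ω | n * t ≤ ∑ i ∈ Finset.range n,
        (ξ i ⁻¹' A').indicator (fun ω => centredSum P ξ h₃ n i ω ^ 2) ω} ∪
      {ω | ¬ ∀ i j, (X i ω, Z i ω) ∈ A →
        ((X i ω, Z i ω), (X j ω, Z j ω)) ∈ closePairs κ ν x₀ m r e})))) := by
    intro ω hω
    by_contra hcon
    simp only [Set.mem_union, Set.mem_ofPred_eq, not_or, not_not] at hcon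
    obtain ⟨g1, g2, g3, g4, g5, g6⟩ := hcon
    push Not at g2 g3 g4 g5
    refine absurd hω ?_
    simp only [Set.mem_ofPred_eq, not_le]
    have hind_ite : ∀ f : ℝ × (Vec dx × Vec dz) → ℝ × (Vec dx × Vec dz) → ℝ,
        ∑ i ∈ Finset.range n, (ξ i ⁻¹' A').indicator (fun ω => centredSum P ξ f n i ω ^ 2) ω =
        ∑ i ∈ Finset.range n, if (X i ω, Z i ω) ∈ A then centredSum P ξ f n i ω ^ 2 else 0 :=
      fun f => Finset.sum_congr rfl fun i _ => by
        by_cases hi : (X i ω, Z i ω) ∈ A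
        · rw [Set.indicator_of_mem (show ω ∈ ξ i ⁻¹' A' from hi), if_pos hi]
        · rw [Set.indicator_of_notMem (show ω ∉ ξ i ⁻¹' A' from hi), if_neg hi]
    rw [hind_ite] at g3 g4 g5
    have hδn := h.δ_nonneg n
    have hbn := hb_pos n
    have hΔ0 : 0 ≤ 2 * (|M₁| * δ n) / b n := by positivity
    set U : ℝ := T * N n with hU
    have hU0 : 0 ≤ U := by positivity
    set det : ℝ := e + 4 / c * (e + (U + M + e) * (B / a n + 2 * (|M₁| * δ n) / b n * (C + 2)))
      with hdetdef
    have herr : ∀ i < n, (X i ω, Z i ω) ∈ A →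
        |kernelRegression ν KX KV (b n) n (fun j => Y j ω) (fun j => X j ω)
          (fun j => Fhat n ω (X j ω, Z j ω)) x₀ (Fhat n ω (X i ω, Z i ω)) -
          m x₀ (controlCDF κ (X i ω, Z i ω))| ≤
        det + 4 / (c * e) / a n ^ 2 * centredSum P ξ h₁ n i ω ^ 2 +
          (U + M) * (16 / c ^ 2) / a n ^ 2 * centredSum P ξ h₂ n i ω ^ 2 +
          (U + M) / a n ^ 2 * centredSum P ξ h₃ n i ω ^ 2 := by
      intro i hi hiA
      obtain ⟨b1, b2, b3, b4⟩ := hball _ hiA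
      have hE₁B : smallBall P ν (X 0) (controlVar κ (X 0) (Z 0)) KX KV x₀ (b n)
          (controlCDF κ (X i ω, Z i ω)) ≤ B := by
        have hint := ((hmom _ hiA).2.1.1).integrable (by norm_num)
        have := integral_mono hint (integrable_const B) fun ω' => hBw (b n) _ _
        rw [integral_const, probReal_univ, one_smul] at this
        exact this
      have hD₁ : ∑ j ∈ (Finset.range n).erase i,
          (Y j ω - m (X j ω) (controlCDF κ (X j ω, Z j ω))) *
          kernelWeight κ ν KX KV x₀ (b n) (X j ω, Z j ω) (X i ω, Z i ω) =
          centredSum P ξ h₁ n i ω := by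
        have hz : ∫ ω', h₁ (ξ i ω) (ξ 0 ω') ∂P = 0 :=
          integral_residual_mul_kernelWeight (hX 0) (hZ 0) hmeasKX hmeasKV (B := B)
            (fun p q => by
              rw [abs_of_nonneg (kernelWeight_nonneg h.KX_nonneg h.KV_nonneg p q)]
              exact hBw _ _ _) h.integrable_Y hm (X i ω, Z i ω)
        simp only [centredSum, hz, sub_zero]
        rfl
      have hmain := abs_kernelRegression_sub_le_sq (κ := κ) (ν := ν) (KX := KX) (KV := KV)
        (x₀ := x₀) (η := η) (b := b n) (B' := B') (R := R) (U := U) (M := M) (e := e)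
        (Δ := |M₁| * δ n) (y := fun j => Y j ω) (p := fun j => (X j ω, Z j ω)) (F := Fhat n ω)
        (m := m) (Bw := B) (a := a n) (c := c) (C₂ := C) hi (h.Fhat_memLp n ω)
        (fun j hj => (g1 _ (Or.inr ⟨j, hj, rfl⟩)).trans
          (mul_le_mul_of_nonneg_right (le_abs_self _) hδn)) g2 h.KX_nonneg h.KV_nonneg
        h.KV_contDiff hB' hRX hRV hbn (by simpa using hη)
        (fun j _ hx hv => g6 i j hiA
          (hx.trans (le_trans (le_add_of_nonneg_right (by positivity)) hrad)) (hv.trans hrad))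
        (hM _ hiA) hU0 he han hc hC.le hD₁ rfl rfl
        (by
          have := mul_le_mul_of_nonneg_left b1 hn'.le
          simp only [hadef]
          linarith) hE₁B b3
        (by
          have := mul_le_mul_of_nonneg_left b4 hn'.le
          simp only [hadef]
          linarith) (hBw _) (hBw' _) haB
        (by
          rw [div_le_iff₀ hc] at haBc
          linarith)
        (by linarith)
      refine hmain.trans (le_of_eq ?_)
      rw [hdetdef]
      change _ + _ * (centredSum P ξ h₁ n i ω ^ 2 / _) +
        _ * (_ * (centredSum P ξ h₂ n i ω ^ 2 / _) + centredSum P ξ h₃ n i ω ^ 2 / _) = _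
      ring
    have havg := abs_average_ite_le (Q := fun i => (X i ω, Z i ω) ∈ A) hn1
      (by positivity : 0 ≤ det) (by positivity : 0 ≤ 4 / (c * e) / a n ^ 2)
      (by positivity : 0 ≤ (U + M) * (16 / c ^ 2) / a n ^ 2)
      (by positivity : 0 ≤ (U + M) / a n ^ 2) herr g3.le g4.le g5.le
    refine havg.trans_lt ?_
    have hsmall := noise_budget_le han hNn hc he hT.le hM0 hθ.le
    have hθe : θ * (4 / (c * e) + (T + M) * (16 / c ^ 2 + 1)) = ε / 8 :=
      div_mul_cancel₀ _ (by positivity)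
    rw [hθe] at hsmall
    have hdet' : det ≤ ε / 8 + ε / 8 := by
      have e1 : (1 + 4 / c) * e = ε / 8 := by
        rw [hedef]
        exact mul_div_cancel₀ _ (by positivity)
      have e2 : det = (1 + 4 / c) * e + 4 / c * ((U + M + e) *
          (B / a n + 2 * (|M₁| * δ n) / b n * (C + 2))) := by
        rw [hdetdef]
        ring
      rw [e2, e1]
      exact add_le_add le_rfl hdet
    linarith
  refine (measure_mono hsub).trans ?_
  have hfive : ENNReal.ofReal (5 * g) = ENNReal.ofReal g + (ENNReal.ofReal g + (ENNReal.ofReal g +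
      (ENNReal.ofReal g + (ENNReal.ofReal g + 0)))) := by
    rw [add_zero, ← ENNReal.ofReal_add hg.le hg.le, ← ENNReal.ofReal_add hg.le (by positivity),
      ← ENNReal.ofReal_add hg.le (by positivity), ← ENNReal.ofReal_add hg.le (by positivity)]
    congr 1
    ring
  rw [hfive]
  exact (measure_union_le _ _).trans (add_le_add hfirst <| (measure_union_le _ _).trans <|
    add_le_add hbadY <| (measure_union_le _ _).trans <| add_le_add hbad₁ <|
    (measure_union_le _ _).trans <| add_le_add hbad₂ <| (measure_union_le _ _).trans <|
    add_le_add hbad₃ hnull.le)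

/-! ### Consistency of the estimator -/

omit [IsProbabilityMeasure P] in
/-- A ratio of sequences converging in probability to constants converges to the ratio, if the limit
of the denominator is not zero; no measurability is needed. -/
lemma tendstoInMeasure_div_const {f g : ℕ → Ω → ℝ} {x y : ℝ} (hy : y ≠ 0)
    (hf : TendstoInMeasure P f atTop fun _ => x) (hg : TendstoInMeasure P g atTop fun _ => y) :
    TendstoInMeasure P (fun n ω => f n ω / g n ω) atTop fun _ => x / y := by
  rw [tendstoInMeasure_iff_dist] at hf hg ⊢
  intro ε hε
  have hct : ContinuousAt (fun q : ℝ × ℝ => q.1 / q.2) (x, y) :=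
    continuousAt_fst.div continuousAt_snd hy
  obtain ⟨r, hr, hball⟩ := Metric.continuousAt_iff.1 hct ε hε
  have hsum := (hf r hr).add (hg r hr)
  rw [add_zero] at hsum
  refine tendsto_of_tendsto_of_tendsto_of_le_of_le tendsto_const_nhds hsum (fun _ => zero_le)
    fun n => ?_
  refine (measure_mono ?_).trans (measure_union_le _ _)
  intro ω hω
  by_contra hcon
  simp only [Set.mem_union, Set.mem_ofPred_eq, not_or, not_le] at hcon
  have := hball (x := (f n ω, g n ω)) (by
    rw [Prod.dist_eq]
    exact max_lt hcon.1 hcon.2)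
  exact absurd hω (not_le.2 this)

omit [IsProbabilityMeasure P] in
lemma tendstoInMeasure_of_sub {f g : ℕ → Ω → ℝ} {x : ℝ}
    (hf : TendstoInMeasure P f atTop fun _ => x)
    (hg : ∀ ε : ℝ, 0 < ε → Tendsto (fun n => P {ω | ε ≤ |g n ω - f n ω|}) atTop (𝓝 0)) :
    TendstoInMeasure P g atTop fun _ => x := by
  rw [tendstoInMeasure_iff_dist] at hf ⊢
  intro ε hε
  have hsum := (hf (ε / 2) (half_pos hε)).add (hg (ε / 2) (half_pos hε))
  rw [add_zero] at hsum
  refine tendsto_of_tendsto_of_tendsto_of_le_of_le tendsto_const_nhds hsum (fun _ => zero_le)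
    fun n => ?_
  refine (measure_mono ?_).trans (measure_union_le _ _)
  intro ω hω
  by_contra hcon
  simp only [Set.mem_union, Set.mem_ofPred_eq, not_or, not_le] at hcon hω
  rw [Real.dist_eq] at hcon hω
  have := abs_sub_le (g n ω) (f n ω) x
  linarith

/-- Consistency of the estimator for the trimmed average of any version of the regression function
that satisfies the continuity condition. -/
theorem NonparametricAssumption.tendstoInMeasure_asfEstimator
    (h : NonparametricAssumption P Y X Z W κ ν A x₀ KX KV η d s b δ Fhat)
    (hAD : A ⊆ D) (hD : ∀ᵐ ω ∂P, (X 0 ω, Z 0 ω) ∈ D)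
    (hb_pos : ∀ n, 0 < b n) (hb : Tendsto b atTop (𝓝 0))
    (hrate : Tendsto (fun n : ℕ => Real.log n / ((n : ℝ) ^ (1 - 1 / s) * b n ^ d)) atTop (𝓝 0))
    {m : Vec dx → ProxyFun dw → ℝ}
    (hm : IsRegression P (Y 0) (X 0) (controlVar κ (X 0) (Z 0)) m)
    (hcont : RegressionContinuity κ ν A D x₀ m) :
    TendstoInMeasure P
      (fun n ω => asfEstimator ν KX KV A x₀ (b n) n (fun i => Y i ω) (fun i => X i ω)
        (fun i => Z i ω) (Fhat n ω))
      atTop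
      (fun _ => ∫ ω, m x₀ (controlVar κ (X 0) (Z 0) ω)
        ∂(ProbabilityTheory.cond P {ω | (X 0 ω, Z 0 ω) ∈ A})) := by
  classical
  have hA := h.compact.measurableSet
  have hX := h.sample.measurable_X
  have hZ := h.sample.measurable_Z
  have hF := measurable_controlCDF κ
  obtain ⟨M, hM0, hM⟩ := h.exists_bound_regression hAD hcont
  have hind : iIndepFun (fun i ω => (X i ω, Z i ω)) P :=
    h.sample.iIndepFun_outcome_covariates.comp (fun _ t => t.2) fun _ => measurable_snd
  have hid : ∀ i, IdentDistrib (fun ω => (X i ω, Z i ω)) (fun ω => (X 0 ω, Z 0 ω)) P P :=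
    fun i => (h.sample.identDistrib_outcome_covariates i).comp measurable_snd
  have hp : Measurable fun ω => (X 0 ω, Z 0 ω) := (hX 0).prodMk (hZ 0)
  have hAω : MeasurableSet {ω | (X 0 ω, Z 0 ω) ∈ A} := hp hA
  have hmF : Measurable fun q : Vec dx × Vec dz => m x₀ (controlCDF κ q) :=
    hm.1.comp (measurable_const.prodMk hF)
  set f : Vec dx × Vec dz → ℝ := fun q => if q ∈ A then m x₀ (controlCDF κ q) else 0 with hf
  set k : Vec dx × Vec dz → ℝ := fun q => if q ∈ A then 1 else 0 with hk
  have hfm : Measurable f := Measurable.ite hA hmF measurable_const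
  have hkm : Measurable k := Measurable.ite hA measurable_const measurable_const
  have hfint : Integrable (fun ω => f (X 0 ω, Z 0 ω)) P := by
    refine Integrable.of_bound (hfm.comp hp).aestronglyMeasurable M (ae_of_all _ fun ω => ?_)
    by_cases hω : (X 0 ω, Z 0 ω) ∈ A
    · simpa [hf, hω] using hM _ hω
    · simpa [hf, hω] using hM0
  have hkint : Integrable (fun ω => k (X 0 ω, Z 0 ω)) P := by
    refine Integrable.of_bound (hkm.comp hp).aestronglyMeasurable 1 (ae_of_all _ fun ω => ?_)
    by_cases hω : (X 0 ω, Z 0 ω) ∈ A <;> simp [hk, hω]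
  have hlf := tendstoInMeasure_average hind hid hfm hfint
  have hlk := tendstoInMeasure_average hind hid hkm hkint
  have hkE : ∫ ω, k (X 0 ω, Z 0 ω) ∂P = P.real {ω | (X 0 ω, Z 0 ω) ∈ A} := by
    rw [← integral_indicator_one hAω]
    refine integral_congr_ae (ae_of_all _ fun ω => ?_)
    by_cases hω : (X 0 ω, Z 0 ω) ∈ A <;> simp [hk, hω]
  have hfE : ∫ ω, f (X 0 ω, Z 0 ω) ∂P =
      ∫ ω in {ω | (X 0 ω, Z 0 ω) ∈ A}, m x₀ (controlVar κ (X 0) (Z 0) ω) ∂P := by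
    rw [← integral_indicator hAω]
    refine integral_congr_ae (ae_of_all _ fun ω => ?_)
    by_cases hω : (X 0 ω, Z 0 ω) ∈ A <;> simp [hf, hω, controlVar]
  have hpos : 0 < P.real {ω | (X 0 ω, Z 0 ω) ∈ A} :=
    ENNReal.toReal_pos h.trimming.ne' (measure_ne_top _ _)
  have hlim : ∫ ω, m x₀ (controlVar κ (X 0) (Z 0) ω)
      ∂(ProbabilityTheory.cond P {ω | (X 0 ω, Z 0 ω) ∈ A}) =
      (∫ ω, f (X 0 ω, Z 0 ω) ∂P) / ∫ ω, k (X 0 ω, Z 0 ω) ∂P := by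
    rw [ProbabilityTheory.cond, integral_smul_measure, hfE, hkE, ENNReal.toReal_inv, smul_eq_mul,
      div_eq_inv_mul]
    rfl
  rw [hlim]
  have hnum : TendstoInMeasure P (fun n ω => (∑ i ∈ Finset.range n, if (X i ω, Z i ω) ∈ A then
      kernelRegression ν KX KV (b n) n (fun j => Y j ω) (fun j => X j ω)
        (fun j => Fhat n ω (X j ω, Z j ω)) x₀ (Fhat n ω (X i ω, Z i ω)) else 0) / n) atTop
      fun _ => ∫ ω, f (X 0 ω, Z 0 ω) ∂P := by
    refine tendstoInMeasure_of_sub hlf fun ε hε => ?_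
    have := h.tendsto_measure_average_error hAD hD hb_pos hb hrate hm hcont hε
    refine this.congr fun n => ?_
    congr 1
    ext ω
    simp only [Set.mem_ofPred_eq]
    rw [← sub_div, ← Finset.sum_sub_distrib]
    have : ∀ i ∈ Finset.range n, ((if (X i ω, Z i ω) ∈ A then
        kernelRegression ν KX KV (b n) n (fun j => Y j ω) (fun j => X j ω)
        (fun j => Fhat n ω (X j ω, Z j ω)) x₀ (Fhat n ω (X i ω, Z i ω)) else 0) -
        f (X i ω, Z i ω)) = if (X i ω, Z i ω) ∈ A then
      (kernelRegression ν KX KV (b n) n (fun j => Y j ω) (fun j => X j ω)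
        (fun j => Fhat n ω (X j ω, Z j ω)) x₀ (Fhat n ω (X i ω, Z i ω)) -
        m x₀ (controlCDF κ (X i ω, Z i ω))) else 0 := fun i _ => by
      by_cases hi : (X i ω, Z i ω) ∈ A <;> simp [hf, hi]
    rw [Finset.sum_congr rfl this]
  have hdiv := tendstoInMeasure_div_const (by rw [hkE]; exact hpos.ne') hnum hlk
  refine hdiv.congr_left fun n => ae_of_all _ fun ω => ?_
  rcases Nat.eq_zero_or_pos n with rfl | hn
  · simp [asfEstimator]
  · have hn' : (n : ℝ) ≠ 0 := by exact_mod_cast hn.ne'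
    simp only [asfEstimator, hk]
    rw [div_div_div_cancel_right₀ hn']

end consistency

/-! ### Conditional independence and disintegration -/

section disintegration

variable {Ω α β E : Type*} [MeasurableSpace Ω] [MeasurableSpace α] [MeasurableSpace β]
  [MeasurableSpace E] [StandardBorelSpace α] [Nonempty α] [StandardBorelSpace E] [Nonempty E]
  {P : Measure Ω} [IsProbabilityMeasure P] {f : Ω → α} {p : Ω → β} {ε : Ω → E}

omit [StandardBorelSpace E] [Nonempty E] in
lemma CondIndepGiven.integral_indicator_mul_condDistrib (h : CondIndepGiven P f p ε)
    (hf : Measurable f) (hp : Measurable p) (hε : Measurable ε) {T : Set α} {B : Set β} {S : Set E}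
    (hT : MeasurableSet T) (hB : MeasurableSet B) (hS : MeasurableSet S) :
    P.real (p ⁻¹' B ∩ (ε ⁻¹' S ∩ f ⁻¹' T)) =
      ∫ ω in p ⁻¹' B ∩ ε ⁻¹' S, (condDistrib f ε P (ε ω)).real T ∂P := by
  have hle := hε.comap_le
  set Q : Ω → ℝ := fun ω => (condDistrib f ε P (ε ω)).real T with hQ
  have hQm : Measurable[MeasurableSpace.comap ε inferInstance] Q :=
    (measurable_condDistrib hT).ennreal_toReal
  have hSm : MeasurableSet[MeasurableSpace.comap ε inferInstance] (ε ⁻¹' S) := ⟨S, hS, rfl⟩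
  have hQ0 : ∀ ω, 0 ≤ Q ω := fun ω => measureReal_nonneg
  have hQ1 : ∀ ω, Q ω ≤ 1 := fun ω => measureReal_le_one
  have hone : ∀ s : Set Ω, MeasurableSet s → Integrable (s.indicator fun _ => (1 : ℝ)) P :=
    fun s hs => (integrable_const _).indicator hs
  have h1 : ∫ ω, (f ⁻¹' T ∩ p ⁻¹' B).indicator (fun _ => (1 : ℝ)) ω *
      (ε ⁻¹' S).indicator (fun _ => (1 : ℝ)) ω ∂P =
      ∫ ω, (P⟦f ⁻¹' T ∩ p ⁻¹' B | MeasurableSpace.comap ε inferInstance⟧) ω *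
        (ε ⁻¹' S).indicator (fun _ => (1 : ℝ)) ω ∂P :=
    integral_mul_eq_integral_condExp_mul hle (hone _ ((hf hT).inter (hp hB)))
      (stronglyMeasurable_const.indicator hSm) (B := 1) fun ω => by
        by_cases hω : ω ∈ ε ⁻¹' S <;> simp [Set.indicator, hω]
  have h2 : ∫ ω, (p ⁻¹' B).indicator (fun _ => (1 : ℝ)) ω * (ε ⁻¹' S).indicator Q ω ∂P =
      ∫ ω, (P⟦p ⁻¹' B | MeasurableSpace.comap ε inferInstance⟧) ω *
        (ε ⁻¹' S).indicator Q ω ∂P :=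
    integral_mul_eq_integral_condExp_mul hle (hone _ (hp hB))
      (hQm.stronglyMeasurable.indicator hSm) (B := 1) fun ω => by
        by_cases hω : ω ∈ ε ⁻¹' S
        · rw [Set.indicator_of_mem hω, abs_of_nonneg (hQ0 ω)]
          exact hQ1 ω
        · rw [Set.indicator_of_notMem hω]
          simp
  have h3 : ∫ ω, (P⟦f ⁻¹' T ∩ p ⁻¹' B | MeasurableSpace.comap ε inferInstance⟧) ω *
        (ε ⁻¹' S).indicator (fun _ => (1 : ℝ)) ω ∂P =
      ∫ ω, (P⟦p ⁻¹' B | MeasurableSpace.comap ε inferInstance⟧) ω *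
        (ε ⁻¹' S).indicator Q ω ∂P := by
    refine integral_congr_ae ?_
    filter_upwards [h T B hT hB, condDistrib_ae_eq_condExp hε hf hT] with ω hω hω'
    rw [hω, Pi.mul_apply, ← hω']
    by_cases hS' : ω ∈ ε ⁻¹' S
    · rw [Set.indicator_of_mem hS', Set.indicator_of_mem hS', mul_one, mul_comm]
    · rw [Set.indicator_of_notMem hS', Set.indicator_of_notMem hS', mul_zero, mul_zero]
  have h4 : ∫ ω, (f ⁻¹' T ∩ p ⁻¹' B).indicator (fun _ => (1 : ℝ)) ω *
      (ε ⁻¹' S).indicator (fun _ => (1 : ℝ)) ω ∂P =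
      P.real (p ⁻¹' B ∩ (ε ⁻¹' S ∩ f ⁻¹' T)) := by
    rw [← integral_indicator_one ((hp hB).inter ((hε hS).inter (hf hT)))]
    refine integral_congr_ae (ae_of_all _ fun ω => ?_)
    simp only [Set.indicator, Set.mem_inter_iff]
    split_ifs <;> simp_all
  have h5 : ∫ ω, (p ⁻¹' B).indicator (fun _ => (1 : ℝ)) ω * (ε ⁻¹' S).indicator Q ω ∂P =
      ∫ ω in p ⁻¹' B ∩ ε ⁻¹' S, Q ω ∂P := by
    rw [← integral_indicator ((hp hB).inter (hε hS))]
    refine integral_congr_ae (ae_of_all _ fun ω => ?_)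
    simp only [Set.indicator, Set.mem_inter_iff]
    split_ifs <;> simp_all
  rw [← h4, h1, h3, ← h2, h5]

/-- If `f` and `p` are independent given `ε`, then `(ε, f)` is drawn given `p` by drawing `ε` given
`p` and then `f` given `ε`. -/
lemma CondIndepGiven.map_eq_compProd (h : CondIndepGiven P f p ε) (hf : Measurable f)
    (hp : Measurable p) (hε : Measurable ε) :
    P.map (fun ω => (p ω, (ε ω, f ω))) =
      P.map p ⊗ₘ (condDistrib ε p P ⊗ₖ Kernel.prodMkLeft β (condDistrib f ε P)) := by
  have : IsProbabilityMeasure (P.map p) := Measure.isProbabilityMeasure_map hp.aemeasurable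
  have : IsProbabilityMeasure (P.map (fun ω => (p ω, (ε ω, f ω)))) :=
    Measure.isProbabilityMeasure_map (hp.prodMk (hε.prodMk hf)).aemeasurable
  rw [Measure.ext_prod₃_iff]
  intro B S T hB hS hT
  rw [Measure.map_apply (hp.prodMk (hε.prodMk hf)) (hB.prod (hS.prod hT)),
    Measure.compProd_apply_prod hB (hS.prod hT)]
  simp_rw [Kernel.compProd_apply_prod hS hT, Kernel.prodMkLeft_apply]
  have hmeas : Measurable fun t : β × E => condDistrib f ε P t.2 T :=
    (Kernel.measurable_coe _ hT).comp measurable_snd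
  rw [← Measure.setLIntegral_compProd (f := fun t : β × E => condDistrib f ε P t.2 T) hmeas hB hS,
    compProd_map_condDistrib hε.aemeasurable,
    setLIntegral_map (hB.prod hS) hmeas (hp.prodMk hε)]
  have hreal := h.integral_indicator_mul_condDistrib hf hp hε hT hB hS
  have hset : (fun ω => (p ω, (ε ω, f ω))) ⁻¹' (B ×ˢ (S ×ˢ T)) =
    p ⁻¹' B ∩ (ε ⁻¹' S ∩ f ⁻¹' T) := rfl
  have hset2 : (fun ω => (p ω, ε ω)) ⁻¹' (B ×ˢ S) = p ⁻¹' B ∩ ε ⁻¹' S := rfl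
  rw [hset, hset2, ← ofReal_measureReal, hreal, ofReal_integral_eq_lintegral_ofReal]
  · simp [Measure.real]
  · refine Integrable.integrableOn (Integrable.of_bound ?_ 1 (ae_of_all _ fun ω => ?_))
    · exact ((Kernel.measurable_coe _ hT).comp hε).ennreal_toReal.aestronglyMeasurable
    · rw [Real.norm_eq_abs, abs_of_nonneg measureReal_nonneg]
      exact measureReal_le_one
  · exact ae_of_all _ fun ω => measureReal_nonneg

/-- The conditional law of `(ε, f)` given `p` depends on `p` only through that of `ε`. -/
lemma CondIndepGiven.condDistrib_prod_ae_eq [StandardBorelSpace β] (h : CondIndepGiven P f p ε)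
    (hf : Measurable f) (hp : Measurable p) (hε : Measurable ε) :
    ∀ᵐ q ∂(P.map p), condDistrib (fun ω => (ε ω, f ω)) p P q =
      condDistrib ε p P q ⊗ₘ condDistrib f ε P := by
  have h1 := condDistrib_ae_eq_of_measure_eq_compProd p (hε.prodMk hf).aemeasurable
    (h.map_eq_compProd hf hp hε)
  filter_upwards [h1] with q hq
  rw [hq]
  ext s hs
  rw [Kernel.compProd_apply hs, Measure.compProd_apply hs]
  rfl

/-- The conditional law of `f` given `p` is the mixture of its conditional laws given `ε`. -/
lemma CondIndepGiven.condDistrib_apply_ae_eq_lintegral (h : CondIndepGiven P f p ε)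
    (hf : Measurable f) (hp : Measurable p) (hε : Measurable ε) :
    ∀ᵐ q ∂(P.map p), ∀ T : Set α, MeasurableSet T →
      condDistrib f p P q T = ∫⁻ e, condDistrib f ε P e T ∂(condDistrib ε p P q) := by
  have h1 := condDistrib_ae_eq_of_measure_eq_compProd p (hε.prodMk hf).aemeasurable
    (h.map_eq_compProd hf hp hε)
  have h2 := condDistrib_comp (mβ := inferInstance) (μ := P) p (hε.prodMk hf).aemeasurable
    (f := Prod.snd) measurable_snd
  filter_upwards [h1, h2] with q hq1 hq2 T hT
  have h3 : (Prod.snd ∘ fun ω => (ε ω, f ω)) = f := rfl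
  rw [h3] at hq2
  rw [hq2, Kernel.map_apply' _ measurable_snd _ hT, hq1, Kernel.compProd_apply (measurable_snd hT)]
  rfl

end disintegration

/-! ### Factorization through a map on a standard Borel space -/

/-- The Blackwell principle: on a standard Borel space, a measurable function that is constant on
the fibres of a measurable map, over a measurable set, is there a measurable function of that
map. -/
lemma exists_measurable_factor {β γ : Type*} [MeasurableSpace β] [StandardBorelSpace β]
    [MeasurableSpace γ] [MeasurableSpace.CountablySeparated γ] {G : Set β} (hG : MeasurableSet G)
    {φ : β → γ} (hφ : Measurable φ) {l : β → ℝ} (hl : Measurable l)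
    (h : ∀ q ∈ G, ∀ q' ∈ G, φ q = φ q' → l q = l q') :
    ∃ k : γ → ℝ, Measurable k ∧ ∀ q ∈ G, l q = k (φ q) := by
  have : StandardBorelSpace G := hG.standardBorel
  set φG : G → γ := fun q => φ q with hφG
  set lG : G → ℝ := fun q => l q with hlG
  have hφGm : Measurable φG := hφ.comp measurable_subtype_coe
  have hlGm : Measurable lG := hl.comp measurable_subtype_coe
  have hfac : Function.FactorsThrough lG φG := fun q q' hqq => h q q.2 q' q'.2 hqq
  have hext : Function.extend φG lG 0 ∘ φG = lG := funext fun q => hfac.extend_apply 0 q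
  have : MeasurableSpace.CountablySeparated (Set.range φG) :=
    MeasurableSpace.Subtype.countablySeparated
  have hrestr : Measurable ((Set.range φG).domRestrict (Function.extend φG lG 0)) := by
    rw [← hφGm.measurable_comp_iff_restrict, hext]
    exact hlGm
  have hcomap : Measurable[MeasurableSpace.comap φG inferInstance] lG := by
    intro U hU
    obtain ⟨V, hV, hVU⟩ := hrestr hU
    refine ⟨V, hV, ?_⟩
    ext q
    have h1 : (⟨φG q, q, rfl⟩ : Set.range φG) ∈ Subtype.val ⁻¹' V ↔
        (⟨φG q, q, rfl⟩ : Set.range φG) ∈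
          (Set.range φG).domRestrict (Function.extend φG lG 0) ⁻¹' U := by rw [hVU]
    have h2 : Function.extend φG lG 0 (φG q) = lG q := congrFun hext q
    simpa [Set.mem_preimage, Set.domRestrict, h2] using h1
  obtain ⟨k, hk, hkl⟩ := hcomap.exists_eq_measurable_comp
  exact ⟨k, hk, fun q hq => congrFun hkl ⟨q, hq⟩⟩

/-! ### Identification -/

lemma ext_of_forall_ratOrthant {dw : ℕ} {μ₁ μ₂ : Measure (Fin dw → ℝ)} [IsProbabilityMeasure μ₁]
    [IsProbabilityMeasure μ₂] (h : ∀ q, μ₁.real (ratOrthant q) = μ₂.real (ratOrthant q)) :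
    μ₁ = μ₂ := by
  refine ext_of_generate_finite _ (generateFrom_ratOrthants dw).symm (isPiSystem_ratOrthants dw)
    ?_ (by simp)
  rintro _ ⟨q, rfl⟩
  exact (measureReal_eq_measureReal_iff).1 (h q)

/-- A measure with density bounded by `B` has a real density with values in `[0, B]`. -/
lemma exists_bounded_density {E : Type*} [MeasurableSpace E] {μ π : Measure E} [IsFiniteMeasure π]
    [IsFiniteMeasure μ] {B : NNReal} (h : μ ≤ B • π) :
    ∃ φ : E → ℝ, Measurable φ ∧ (∀ e, 0 ≤ φ e) ∧ (∀ e, φ e ≤ B) ∧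
      μ = π.withDensity fun e => ENNReal.ofReal (φ e) := by
  have hac : μ ≪ π := (Measure.absolutelyContinuous_of_le h).trans
    (Measure.smul_absolutelyContinuous (c := (B : ENNReal)))
  have hle : μ.rnDeriv π ≤ᵐ[π] fun _ => (B : ENNReal) := by
    refine ae_le_of_forall_setLIntegral_le_of_sigmaFinite (Measure.measurable_rnDeriv μ π) ?_
    intro s hs _
    rw [setLIntegral_const]
    exact (Measure.setLIntegral_rnDeriv_le s).trans (h s)
  refine ⟨fun e => (min (μ.rnDeriv π e) B).toReal,
    ((Measure.measurable_rnDeriv μ π).min measurable_const).ennreal_toReal,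
    fun e => ENNReal.toReal_nonneg, fun e => ?_, ?_⟩
  · exact ENNReal.toReal_mono ENNReal.coe_ne_top (min_le_right _ _)
  · rw [← Measure.withDensity_rnDeriv_eq μ π hac]
    refine withDensity_congr_ae ?_
    rw [Measure.withDensity_rnDeriv_eq μ π hac]
    filter_upwards [hle] with e he
    rw [min_eq_left he, ENNReal.ofReal_toReal (ne_top_of_le_ne_top ENNReal.coe_ne_top he)]

section completeness

variable {Ω E : Type*} [MeasurableSpace Ω] [MeasurableSpace E] {dw : ℕ} {P : Measure Ω}
  [IsProbabilityMeasure P] {W : Ω → (Fin dw → ℝ)} {ε : Ω → E}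

/-- Bounded completeness: two laws of `ε` with bounded densities that induce the same law of `W`
are equal. -/
lemma eq_of_lintegral_condDistrib_eq (hW : Measurable W) (hε : Measurable ε)
    (hcomp : ∀ φ : E → ℝ, Measurable φ → (∃ B : ℝ, ∀ e, |φ e| ≤ B) →
      P[fun ω => φ (ε ω) | MeasurableSpace.comap W inferInstance] =ᵐ[P] 0 →
        ∀ᵐ ω ∂P, φ (ε ω) = 0)
    {μ₁ μ₂ : Measure E} [IsFiniteMeasure μ₁] [IsFiniteMeasure μ₂] {B₁ B₂ : NNReal}
    (h₁ : μ₁ ≤ B₁ • P.map ε) (h₂ : μ₂ ≤ B₂ • P.map ε)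
    (h : ∀ T : Set (Fin dw → ℝ), MeasurableSet T →
      ∫⁻ e, condDistrib W ε P e T ∂μ₁ = ∫⁻ e, condDistrib W ε P e T ∂μ₂) : μ₁ = μ₂ := by
  obtain ⟨φ₁, hm₁, h0₁, hB₁, hd₁⟩ := exists_bounded_density h₁
  obtain ⟨φ₂, hm₂, h0₂, hB₂, hd₂⟩ := exists_bounded_density h₂
  have hle := hε.comap_le
  have hint : ∀ {φ : E → ℝ} {B : NNReal}, Measurable φ → (∀ e, 0 ≤ φ e) → (∀ e, φ e ≤ B) →
      Integrable (fun ω => φ (ε ω)) P := fun {φ B} hm h0 hB =>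
    Integrable.of_bound (hm.comp hε).aestronglyMeasurable B (ae_of_all _ fun ω => by
      rw [Real.norm_eq_abs, abs_of_nonneg (h0 _)]
      exact hB _)
  -- the expectation of `φ (ε)` over the event `W ∈ T` is the mass of `T` under the induced law
  have key : ∀ {μ : Measure E} {φ : E → ℝ} {B : NNReal}, Measurable φ → (∀ e, 0 ≤ φ e) →
      (∀ e, φ e ≤ B) → μ = (P.map ε).withDensity (fun e => ENNReal.ofReal (φ e)) →
      ∀ T : Set (Fin dw → ℝ), MeasurableSet T →
      ∫ ω in W ⁻¹' T, φ (ε ω) ∂P = (∫⁻ e, condDistrib W ε P e T ∂μ).toReal := by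
    intro μ φ B hm h0 hB hd T hT
    have hφε : StronglyMeasurable[MeasurableSpace.comap ε inferInstance] fun ω => φ (ε ω) :=
      (hm.comp (comap_measurable ε)).stronglyMeasurable
    have h1 := integral_mul_eq_integral_condExp_mul (P := P) hle
      ((integrable_const (1 : ℝ)).indicator (hW hT)) hφε (B := B) fun ω => by
        rw [abs_of_nonneg (h0 _)]
        exact hB _
    have h2 : ∫ ω in W ⁻¹' T, φ (ε ω) ∂P =
        ∫ ω, (W ⁻¹' T).indicator (fun _ => (1 : ℝ)) ω * φ (ε ω) ∂P := by
      rw [← integral_indicator (hW hT)]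
      refine integral_congr_ae (ae_of_all _ fun ω => ?_)
      by_cases hω : ω ∈ W ⁻¹' T
      · simp only [Set.indicator_of_mem hω, one_mul]
      · simp only [Set.indicator_of_notMem hω, zero_mul]
    have h3 : ∫ ω, (P⟦W ⁻¹' T | MeasurableSpace.comap ε inferInstance⟧) ω * φ (ε ω) ∂P =
        ∫ ω, (condDistrib W ε P (ε ω)).real T * φ (ε ω) ∂P := by
      refine integral_congr_ae ?_
      filter_upwards [condDistrib_ae_eq_condExp (μ := P) hε hW hT] with ω hω
      rw [hω]
    have hTm : Measurable fun e => condDistrib W ε P e T := Kernel.measurable_coe _ hT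
    have h4 : ∫⁻ e, condDistrib W ε P e T ∂μ =
        ∫⁻ ω, ENNReal.ofReal ((condDistrib W ε P (ε ω)).real T * φ (ε ω)) ∂P := by
      rw [hd, lintegral_withDensity_eq_lintegral_mul _ hm.ennreal_ofReal hTm,
        lintegral_map (hm.ennreal_ofReal.mul hTm) hε]
      refine lintegral_congr fun ω => ?_
      rw [ENNReal.ofReal_mul measureReal_nonneg, ofReal_measureReal, Pi.mul_apply, mul_comm]
    rw [h2, h1, h3, h4, integral_eq_lintegral_of_nonneg_ae]
    · exact ae_of_all _ fun ω => mul_nonneg measureReal_nonneg (h0 _)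
    · exact ((hTm.comp hε).ennreal_toReal.mul (hm.comp hε)).aestronglyMeasurable
  have hdiff : ∀ᵐ ω ∂P, φ₁ (ε ω) - φ₂ (ε ω) = 0 := by
    refine hcomp (fun e => φ₁ e - φ₂ e) (hm₁.sub hm₂) ⟨B₁ + B₂, fun e => ?_⟩ ?_
    · refine (abs_sub _ _).trans (add_le_add ?_ ?_)
      · rw [abs_of_nonneg (h0₁ e)]
        exact hB₁ e
      · rw [abs_of_nonneg (h0₂ e)]
        exact hB₂ e
    · refine (ae_eq_condExp_of_forall_setIntegral_eq hW.comap_le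
        ((hint hm₁ h0₁ hB₁).sub (hint hm₂ h0₂ hB₂)) (fun _ _ _ => integrableOn_zero) ?_
        stronglyMeasurable_zero.aestronglyMeasurable).symm
      rintro _ ⟨T, hT, rfl⟩ -
      simp only [Pi.sub_apply]
      rw [integral_sub (hint hm₁ h0₁ hB₁).integrableOn (hint hm₂ h0₂ hB₂).integrableOn,
        key hm₁ h0₁ hB₁ hd₁ T hT, key hm₂ h0₂ hB₂ hd₂ T hT, h T hT, sub_self]
      simp
  rw [hd₁, hd₂]
  refine withDensity_congr_ae ?_
  have hset : MeasurableSet {e | φ₁ e - φ₂ e = 0} := (hm₁.sub hm₂) (measurableSet_singleton 0)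
  filter_upwards [(ae_map_iff hε.aemeasurable hset).2 hdiff] with e he
  rw [sub_eq_zero.1 he]

end completeness

section identification

variable {Ω E S : Type*} [MeasurableSpace Ω] [MeasurableSpace E] [StandardBorelSpace E] [Nonempty E]
  [MeasurableSpace S] [StandardBorelSpace S] [Nonempty S] {dx dz dw : ℕ} {P : Measure Ω}
  [IsProbabilityMeasure P] {Y : Ω → ℝ} {X : Ω → Vec dx} {Z : Ω → Vec dz} {W : Ω → (Fin dw → ℝ)}
  {κ : Kernel (Vec dx × Vec dz) (Fin dw → ℝ)} [IsMarkovKernel κ] {g : Vec dx → E → S → ℝ}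
  {ε : Ω → E} {ζ : Ω → S}

/-- The conditional law of the unobservables given the covariates is, almost surely, determined by
the value of the control variable. -/
lemma ProxyModel.exists_set_condDistrib_eq (h : ProxyModel P Y X Z W g ε ζ) (hX : Measurable X)
    (hZ : Measurable Z) (hW : Measurable W)
    (hκ : P.map (fun ω => (X ω, Z ω)) ⊗ₘ κ = P.map (fun ω => ((X ω, Z ω), W ω))) :
    ∃ G : Set (Vec dx × Vec dz), MeasurableSet G ∧ (∀ᵐ q ∂(P.map fun ω => (X ω, Z ω)), q ∈ G) ∧
      ∀ q ∈ G, ∀ q' ∈ G, (∀ r, controlCDF κ q (fun i => ((r : Fin dw → ℚ) i : ℝ)) =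
        controlCDF κ q' fun i => (r i : ℝ)) →
      condDistrib (fun ω => (ε ω, ζ ω)) (fun ω => (X ω, Z ω)) P q =
        condDistrib (fun ω => (ε ω, ζ ω)) (fun ω => (X ω, Z ω)) P q' := by
  have hp : Measurable fun ω => (X ω, Z ω) := hX.prodMk hZ
  have h1 := h.shock_indep.condDistrib_prod_ae_eq h.measurable_ζ hp h.measurable_ε
  have h2 := h.proxy_indep.condDistrib_apply_ae_eq_lintegral hW hp h.measurable_ε
  have h3 : condDistrib W (fun ω => (X ω, Z ω)) P =ᵐ[P.map fun ω => (X ω, Z ω)] κ :=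
    condDistrib_ae_eq_of_measure_eq_compProd _ hW.aemeasurable hκ.symm
  have hall := h1.and (h2.and (h3.and h.bounded_density))
  obtain ⟨G, hG, hGm, hGsub⟩ := hall.exists_measurable_mem
  refine ⟨G, hGm, hG, fun q hq q' hq' hqq => ?_⟩
  obtain ⟨a1, a2, a3, B, a4⟩ := hGsub q hq
  obtain ⟨b1, b2, b3, B', b4⟩ := hGsub q' hq'
  have hκκ : κ q = κ q' := ext_of_forall_ratOrthant hqq
  rw [a1, b1]
  have hlaw : condDistrib ε (fun ω => (X ω, Z ω)) P q = condDistrib ε (fun ω => (X ω, Z ω)) P q' :=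
    eq_of_lintegral_condDistrib_eq hW h.measurable_ε h.complete a4 b4 fun T hT => by
      rw [← a2 T hT, ← b2 T hT, a3, b3, hκκ]
  rw [hlaw]

/-- The control variable is a sufficient conditioning variable: the conditional law of the
unobservables given the covariates equals their conditional law given the control variable. -/
lemma ProxyModel.condDistrib_covariates_ae_eq (h : ProxyModel P Y X Z W g ε ζ) (hX : Measurable X)
    (hZ : Measurable Z) (hW : Measurable W)
    (hκ : P.map (fun ω => (X ω, Z ω)) ⊗ₘ κ = P.map (fun ω => ((X ω, Z ω), W ω))) :
    ∀ᵐ ω ∂P, condDistrib (fun ω => (ε ω, ζ ω)) (fun ω => (X ω, Z ω)) P (X ω, Z ω) =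
      condDistrib (fun ω => (ε ω, ζ ω)) (controlVar κ X Z) P (controlVar κ X Z ω) := by
  have hp : Measurable fun ω => (X ω, Z ω) := hX.prodMk hZ
  have hF := measurable_controlCDF κ
  have hV : Measurable (controlVar κ X Z) := hF.comp hp
  have hU : Measurable fun ω => (ε ω, ζ ω) := h.measurable_ε.prodMk h.measurable_ζ
  have : IsProbabilityMeasure (P.map fun ω => (X ω, Z ω)) :=
    Measure.isProbabilityMeasure_map hp.aemeasurable
  obtain ⟨G, hGm, hG, hGeq⟩ := h.exists_set_condDistrib_eq hX hZ hW hκ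
  set L := condDistrib (fun ω => (ε ω, ζ ω)) (fun ω => (X ω, Z ω)) P with hL
  set R := condDistrib (fun ω => (ε ω, ζ ω)) (controlVar κ X Z) P with hR
  -- evaluation of a distribution function at the rational points
  let ρ : ProxyFun dw → ((Fin dw → ℚ) → ℝ) := fun v r => v fun i => (r i : ℝ)
  have hρ : Measurable ρ := measurable_pi_lambda _ fun r => measurable_pi_apply _
  have hGω : ∀ᵐ ω ∂P, (X ω, Z ω) ∈ G := ae_of_ae_map hp.aemeasurable hG
  have hvle : MeasurableSpace.comap (controlVar κ X Z) inferInstance ≤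
      MeasurableSpace.comap (fun ω => (X ω, Z ω)) inferInstance := by
    have : Measurable[MeasurableSpace.comap (fun ω => (X ω, Z ω)) inferInstance]
        (controlVar κ X Z) := hF.comp (comap_measurable _)
    exact this.comap_le
  have hpt : ∀ T : Set (E × S), MeasurableSet T →
      ∀ᵐ ω ∂P, L (X ω, Z ω) T = R (controlVar κ X Z ω) T := by
    intro T hT
    obtain ⟨k, hk, hkG⟩ := exists_measurable_factor hGm (φ := fun q => ρ (controlCDF κ q))
      (hρ.comp hF) (l := fun q => (L q).real T) (Kernel.measurable_coe L hT).ennreal_toReal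
      fun q hq q' hq' hqq => by
        rw [hGeq q hq q' hq' fun r => congrFun hqq r]
    have h1 : (fun ω => k (ρ (controlVar κ X Z ω))) =ᵐ[P]
        P⟦(fun ω => (ε ω, ζ ω)) ⁻¹' T |
          MeasurableSpace.comap (fun ω => (X ω, Z ω)) inferInstance⟧ := by
      filter_upwards [hGω, condDistrib_ae_eq_condExp (μ := P) hp hU hT] with ω hω hω'
      rw [← hω']
      exact (hkG _ hω).symm
    have hkm : StronglyMeasurable[MeasurableSpace.comap (controlVar κ X Z) inferInstance]
        fun ω => k (ρ (controlVar κ X Z ω)) :=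
      ((hk.comp hρ).comp (comap_measurable _)).stronglyMeasurable
    have h2 : (fun ω => k (ρ (controlVar κ X Z ω))) =ᵐ[P]
        P⟦(fun ω => (ε ω, ζ ω)) ⁻¹' T |
          MeasurableSpace.comap (controlVar κ X Z) inferInstance⟧ := by
      have htower := condExp_condExp_of_le (μ := P)
        (f := ((fun ω => (ε ω, ζ ω)) ⁻¹' T).indicator fun _ => (1 : ℝ)) hvle hp.comap_le
      have hc := condExp_congr_ae (m := MeasurableSpace.comap (controlVar κ X Z) inferInstance) h1
      rw [condExp_of_stronglyMeasurable hV.comap_le hkm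
        (integrable_condExp.congr h1.symm)] at hc
      exact hc.trans htower
    filter_upwards [hGω, h2, condDistrib_ae_eq_condExp (μ := P) hV hU hT] with ω h3 h4 h5
    have h6 : (L (X ω, Z ω)).real T = (R (controlVar κ X Z ω)).real T := by
      rw [h5, ← h4]
      exact hkG _ h3
    exact (measureReal_eq_measureReal_iff).1 h6
  have hae : L =ᵐ[P.map fun ω => (X ω, Z ω)] R.comap (controlCDF κ) hF := by
    refine Kernel.ae_eq_of_compProd_eq (Measure.ext_prod_iff.2 ?_)
    intro B T hB hT
    rw [Measure.compProd_apply_prod hB hT, Measure.compProd_apply_prod hB hT,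
      setLIntegral_map hB (Kernel.measurable_coe _ hT) hp,
      setLIntegral_map hB (Kernel.measurable_coe _ hT) hp]
    refine lintegral_congr_ae (ae_restrict_of_ae ?_)
    filter_upwards [hpt T hT] with ω hω
    rw [Kernel.comap_apply]
    exact hω
  exact ae_of_ae_map hp.aemeasurable hae

/-- The structural regression is a version of the regression of the outcome on the covariate and the
control variable, and averaging it at `x₀` over a set of covariate values recovers the average of
the structural function. -/
lemma ProxyModel.isRegression_and_setIntegral_eq (h : ProxyModel P Y X Z W g ε ζ)
    (hX : Measurable X) (hZ : Measurable Z) (hW : Measurable W) (hY : Integrable Y P)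
    (hκ : P.map (fun ω => (X ω, Z ω)) ⊗ₘ κ = P.map (fun ω => ((X ω, Z ω), W ω))) {x₀ : Vec dx}
    (hg : Integrable (fun ω => g x₀ (ε ω) (ζ ω)) P) {m : Vec dx → ProxyFun dw → ℝ}
    (hm : IsStructuralRegression P (controlVar κ X Z) g ε ζ m) {A : Set (Vec dx × Vec dz)}
    (hA : MeasurableSet A) :
    IsRegression P Y X (controlVar κ X Z) m ∧
      ∫ ω in {ω | (X ω, Z ω) ∈ A}, m x₀ (controlVar κ X Z ω) ∂P =
        ∫ ω in {ω | (X ω, Z ω) ∈ A}, g x₀ (ε ω) (ζ ω) ∂P := by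
  have hp : Measurable fun ω => (X ω, Z ω) := hX.prodMk hZ
  have hF := measurable_controlCDF κ
  have hV : Measurable (controlVar κ X Z) := hF.comp hp
  have hU : Measurable fun ω => (ε ω, ζ ω) := h.measurable_ε.prodMk h.measurable_ζ
  have hlaw := h.condDistrib_covariates_ae_eq hX hZ hW hκ
  have hmV : ∀ᵐ ω ∂P, ∀ x, m x (controlVar κ X Z ω) =
      ∫ t, g x t.1 t.2 ∂(condDistrib (fun ω => (ε ω, ζ ω)) (fun ω => (X ω, Z ω)) P (X ω, Z ω)) := by
    filter_upwards [ae_of_ae_map hV.aemeasurable hm.2, hlaw] with ω h1 h2 x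
    rw [h1 x, h2]
  refine ⟨⟨hm.1, ?_⟩, ?_⟩
  · have hgm : StronglyMeasurable fun t : (Vec dx × Vec dz) × (E × S) => g t.1.1 t.2.1 t.2.2 := by
      have := h.measurable_g.comp (f := fun t : (Vec dx × Vec dz) × (E × S) =>
        (t.1.1, t.2.1, t.2.2)) (by fun_prop)
      exact this.stronglyMeasurable
    have hgint : Integrable (fun ω => g (X ω) (ε ω) (ζ ω)) P := hY.congr h.outcome
    have h1 := condExp_prod_ae_eq_integral_condDistrib (μ := P) hp hU.aemeasurable hgm hgint
    have h2 : P[Y | MeasurableSpace.comap (fun ω => (X ω, Z ω)) inferInstance] =ᵐ[P]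
        fun ω => m (X ω) (controlVar κ X Z ω) := by
      refine (condExp_congr_ae h.outcome).trans (h1.trans ?_)
      filter_upwards [hmV] with ω hω
      exact (hω (X ω)).symm
    have hXV : Measurable fun ω => (X ω, controlVar κ X Z ω) := hX.prodMk hV
    have hle : MeasurableSpace.comap (fun ω => (X ω, controlVar κ X Z ω)) inferInstance ≤
        MeasurableSpace.comap (fun ω => (X ω, Z ω)) inferInstance := by
      have h3 : Measurable[MeasurableSpace.comap (fun ω => (X ω, Z ω)) inferInstance]
          fun ω => (X ω, controlVar κ X Z ω) :=
        (measurable_fst.prodMk hF).comp (comap_measurable _)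
      exact h3.comap_le
    have hmm : StronglyMeasurable[MeasurableSpace.comap
        (fun ω => (X ω, controlVar κ X Z ω)) inferInstance]
        fun ω => m (X ω) (controlVar κ X Z ω) :=
      (hm.1.comp (comap_measurable _)).stronglyMeasurable
    have htower := condExp_condExp_of_le (μ := P) (f := Y) hle hp.comap_le
    have hc := condExp_congr_ae (m := MeasurableSpace.comap
      (fun ω => (X ω, controlVar κ X Z ω)) inferInstance) h2
    rw [condExp_of_stronglyMeasurable hXV.comap_le hmm (integrable_condExp.congr h2)] at hc
    exact htower.symm.trans hc
  · have hgm : StronglyMeasurable fun t : E × S => g x₀ t.1 t.2 := by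
      have := h.measurable_g.comp (measurable_prodMk_left (x := x₀) (β := E × S))
      exact this.stronglyMeasurable
    have h1 := condExp_ae_eq_integral_condDistrib (μ := P) hp hU.aemeasurable hgm hg
    change ∫ ω in (fun ω => (X ω, Z ω)) ⁻¹' A, m x₀ (controlVar κ X Z ω) ∂P =
      ∫ ω in (fun ω => (X ω, Z ω)) ⁻¹' A, g x₀ (ε ω) (ζ ω) ∂P
    rw [← setIntegral_condExp hp.comap_le hg ⟨A, hA, rfl⟩]
    refine setIntegral_congr_ae (hp hA) ?_
    filter_upwards [h1, hmV] with ω h2 h3 _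
    rw [h2, h3 x₀]

end identification

/-! ### Consistency for the regression average and for the structural average -/

theorem mainTheorem2 {Ω E S : Type*} [MeasurableSpace Ω]
    [MeasurableSpace E] [StandardBorelSpace E] [Nonempty E]
    [MeasurableSpace S] [StandardBorelSpace S] [Nonempty S]
    {dx dz dw : ℕ} (P : Measure Ω) [IsProbabilityMeasure P]
    (Y : ℕ → Ω → ℝ) (X : ℕ → Ω → Vec dx) (Z : ℕ → Ω → Vec dz) (W : ℕ → Ω → (Fin dw → ℝ))
    (κ : Kernel (Vec dx × Vec dz) (Fin dw → ℝ)) [IsMarkovKernel κ]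
    (ν : Measure (Fin dw → ℝ)) [IsFiniteMeasure ν]
    (A D : Set (Vec dx × Vec dz)) (x₀ : Vec dx) (KX : Vec dx → ℝ) (KV : ℝ → ℝ) (η d s : ℝ)
    (b δ : ℕ → ℝ) (Fhat : ℕ → Ω → Vec dx × Vec dz → ProxyFun dw)
    (hNP : NonparametricAssumption P Y X Z W κ ν A x₀ KX KV η d s b δ Fhat)
    (hAD : A ⊆ D) (hD : ∀ᵐ ω ∂P, (X 0 ω, Z 0 ω) ∈ D)
    (hb_pos : ∀ n, 0 < b n) (hb : Tendsto b atTop (𝓝 0))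
    (hrate : Tendsto (fun n : ℕ => Real.log n / ((n : ℝ) ^ (1 - 1 / s) * b n ^ d)) atTop (𝓝 0)) :
    (∀ m : Vec dx → ProxyFun dw → ℝ,
      IsRegression P (Y 0) (X 0) (controlVar κ (X 0) (Z 0)) m →
      RegressionContinuity κ ν A D x₀ m →
      TendstoInMeasure P
        (fun n ω => asfEstimator ν KX KV A x₀ (b n) n (fun i => Y i ω) (fun i => X i ω)
          (fun i => Z i ω) (Fhat n ω))
        atTop
        (fun _ => ∫ ω, m x₀ (controlVar κ (X 0) (Z 0) ω)
          ∂(ProbabilityTheory.cond P {ω | (X 0 ω, Z 0 ω) ∈ A}))) ∧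
    (∀ (g : Vec dx → E → S → ℝ) (ε : Ω → E) (ζ : Ω → S) (m : Vec dx → ProxyFun dw → ℝ),
      ProxyModel P (Y 0) (X 0) (Z 0) (W 0) g ε ζ →
      Integrable (fun ω => g x₀ (ε ω) (ζ ω)) P →
      IsStructuralRegression P (controlVar κ (X 0) (Z 0)) g ε ζ m →
      RegressionContinuity κ ν A D x₀ m →
      TendstoInMeasure P
        (fun n ω => asfEstimator ν KX KV A x₀ (b n) n (fun i => Y i ω) (fun i => X i ω)
          (fun i => Z i ω) (Fhat n ω))
        atTop
        (fun _ => ∫ ω, g x₀ (ε ω) (ζ ω)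
          ∂(ProbabilityTheory.cond P {ω | (X 0 ω, Z 0 ω) ∈ A}))) := by
  refine ⟨fun m hm hcont => hNP.tendstoInMeasure_asfEstimator hAD hD hb_pos hb hrate hm hcont, ?_⟩
  intro g ε ζ m hmodel hg hm hcont
  obtain ⟨hreg, heq⟩ := hmodel.isRegression_and_setIntegral_eq (hNP.sample.measurable_X 0)
    (hNP.sample.measurable_Z 0) (hNP.sample.measurable_W 0) hNP.integrable_Y hNP.condLaw hg hm
    hNP.compact.measurableSet
  have hlim : ∫ ω, g x₀ (ε ω) (ζ ω) ∂(ProbabilityTheory.cond P {ω | (X 0 ω, Z 0 ω) ∈ A}) =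
      ∫ ω, m x₀ (controlVar κ (X 0) (Z 0) ω)
        ∂(ProbabilityTheory.cond P {ω | (X 0 ω, Z 0 ω) ∈ A}) := by
    rw [ProbabilityTheory.cond, integral_smul_measure, integral_smul_measure, heq]
  rw [hlim]
  exact hNP.tendstoInMeasure_asfEstimator hAD hD hb_pos hb hrate hreg hcont
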